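/- Let $f\in C^1([0,1],\mathbb R)$ be of bistable type: $f(0)=f(1)=0$, $f'(0)<0$, $f'(1)<0$, and for some $\alpha\in(0,1)$ one has $f<0$ on $(0,\alpha)$ and $f>0$ on $(\alpha,1)$. Let $\Phi_\infty\in C^2(\mathbb R)$ be a $[0,1]$-wave front with speed $c\in\mathbb R$, that is, $\Phi_\infty''+c\,\Phi_\infty'+f(\Phi_\infty)=0$ on $\mathbb R$, $0\le\Phi_\infty\le1$, $\Phi_\infty'>0$, $\Phi_\infty(-\infty)=0$, $\Phi_\infty(+\infty)=1$. Put $$\lambda(\Phi_\infty)=-\frac{\int_0^1 f(s)\,ds}{\|\Phi_\infty'\|_{L^2(\mathbb R)}^2},\qquad \pi_\infty(w)=\frac{-2\lambda(\Phi_\infty)}{\|\Phi_\infty'\|_{L^2(\mathbb R)}^2}\,\langle \Phi_\infty',w'\rangle_{L^2(\mathbb R)},$$ and consider in the complex space $L^2(\mathbb R)$ the unbounded operators with domain $H^2(\mathbb R)$ $$L_0^\infty w=w''+\lambda(\Phi_\infty)w'+f'(\Phi_\infty)w,\qquad L^\infty w=L_0^\infty w+\pi_\infty(w)\,\Phi_\infty'.$$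 The essential spectrum $\sigma_{ess}$ of an operator $T$ is the set of points of its spectrum that are not isolated eigenvalues of finite multiplicity, where an isolated eigenvalue $\mu$ of finite multiplicity is an eigenvalue isolated in $\sigma(T)$ such that $\bigcup_n\ker (T-\mu)^n$ is finite-dimensional and $T-\mu$ has closed range. Then $\sigma(L^\infty)=\sigma(L_0^\infty)$, and $0\in\sigma(L^\infty)$ is an algebraically simple eigenvalue of $L^\infty$, i.e. $\bigcup_n\ker (L^\infty)^n$ is one-dimensional. Moreover: (i) $\sigma_{ess}(L^\infty)\subset\{z\in\mathbb C:\operatorname{Re} z\le\max\{f'(0),f'(1)\}\}$. (ii) There exists $\nu$ with $0<\nu<-\max\{f'(0),f'(1)\}$ such that $\sigma(L^\infty)\cap\{z\in\mathbb C:\operatorname{Re}z\ge-\nu\}=\{0\}$. (iii) There is no $w\in H^2(\mathbb R)$ with $L^\infty w=\Phi_\infty'$, and $\ker\big((L^\infty)^2\big)=\ker(L^\infty)=\operatorname{span}\{\Phi_\infty'\}$; in particular the eigenfunction for the eigenvalue $0$ is $\Phi_\infty'$. -/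

import Mathlib

open MeasureTheory Set Filter Topology
open scoped ContDiff ENNReal

namespace TravellingWave

noncomputable section

/-! ### Spectral notions for unbounded linear operators -/

section Spectral

variable {H : Type*} [NormedAddCommGroup H] [NormedSpace ℂ H]

/-- The resolvent set of an unbounded operator `T : D(T) ⊂ H → H`: those `z` for which
`T - z : D(T) → H` is bijective and has a bounded inverse `R : H → H`. -/
def resolventSet (T : H →ₗ.[ℂ] H) : Set ℂ :=
  {z | ∃ R : H →L[ℂ] H,
    (∀ h : H, ∃ w : T.domain, (w : H) = R h ∧ T w - z • (w : H) = h) ∧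
    (∀ w : T.domain, R (T w - z • (w : H)) = w)}

/-- The spectrum of an unbounded operator. -/
def spectrum (T : H →ₗ.[ℂ] H) : Set ℂ := (resolventSet T)ᶜ

/-- `kerPow T z n` is the kernel of `(T - z) ^ n` on its natural domain: `w` lies in the kernel of
`(T - z) ^ (n + 1)` iff `w ∈ D(T)` and `(T - z) w` lies in the kernel of `(T - z) ^ n`. -/
def kerPow (T : H →ₗ.[ℂ] H) (z : ℂ) : ℕ → Submodule ℂ H
  | 0 => ⊥
  | n + 1 => ((kerPow T z n).comap (T.toFun - z • T.domain.subtype)).map T.domain.subtype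

/-- The generalized eigenspace (root subspace) `⋃ₙ ker (T - z) ^ n`. -/
def rootSpace (T : H →ₗ.[ℂ] H) (z : ℂ) : Submodule ℂ H := ⨆ n, kerPow T z n

/-- `z` is an eigenvalue of `T`. -/
def IsEigenvalue (T : H →ₗ.[ℂ] H) (z : ℂ) : Prop :=
  ∃ w : T.domain, (w : H) ≠ 0 ∧ T w = z • (w : H)

/-- `z` is an algebraically simple eigenvalue of `T`: an eigenvalue whose root subspace is
one-dimensional. -/
def IsAlgebraicallySimpleEigenvalue (T : H →ₗ.[ℂ] H) (z : ℂ) : Prop :=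
  IsEigenvalue T z ∧ Module.finrank ℂ (rootSpace T z) = 1

/-- `z` is an isolated eigenvalue of `T` of finite algebraic multiplicity (in the sense of Browder):
an eigenvalue, isolated in the spectrum, with finite-dimensional root subspace, for which `T - z`
has closed range. -/
def IsIsolatedEigenvalueOfFiniteMultiplicity (T : H →ₗ.[ℂ] H) (z : ℂ) : Prop :=
  IsEigenvalue T z ∧
  (∃ r > 0, spectrum T ∩ Metric.ball z r = {z}) ∧
  FiniteDimensional ℂ (rootSpace T z) ∧
  IsClosed (Set.range fun w : T.domain => T w - z • (w : H))

/-- The essential spectrum: all spectral points except the isolated eigenvalues of finite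
multiplicity. -/
def essentialSpectrum (T : H →ₗ.[ℂ] H) : Set ℂ :=
  {z | z ∈ spectrum T ∧ ¬ IsIsolatedEigenvalueOfFiniteMultiplicity T z}

end Spectral

/-! ### The Sobolev space `H²(ℝ)` -/

/-- The complex Hilbert space `L²(ℝ)`. -/
abbrev L2 : Type := Lp ℂ 2 (volume : Measure ℝ)

/-- `v` is the weak derivative of `u`, both in `L²(ℝ)`. -/
def IsWeakDeriv (u v : L2) : Prop :=
  ∀ φ : ℝ → ℝ, ContDiff ℝ ∞ φ → HasCompactSupport φ →
    ∫ x, deriv φ x • u x = -∫ x, φ x • v x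

lemma L2.integrable_smul (u : L2) {φ : ℝ → ℝ} (h1 : Continuous φ) (h2 : HasCompactSupport φ) :
    Integrable (fun x => φ x • u x) :=
  ((Lp.memLp u).locallyIntegrable (by norm_num)).integrable_smul_left_of_hasCompactSupport h1 h2

lemma IsWeakDeriv.unique {u v v' : L2} (h : IsWeakDeriv u v) (h' : IsWeakDeriv u v') :
    v = v' := by
  apply Lp.ext
  refine ae_eq_of_integral_contDiff_smul_eq
    ((Lp.memLp v).locallyIntegrable (by norm_num))
    ((Lp.memLp v').locallyIntegrable (by norm_num)) ?_
  intro φ h1 h2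
  have := (h φ h1 h2).symm.trans (h' φ h1 h2)
  exact neg_injective this

lemma IsWeakDeriv.add {u v u' v' : L2} (h : IsWeakDeriv u v) (h' : IsWeakDeriv u' v') :
    IsWeakDeriv (u + u') (v + v') := by
  intro φ h1 h2
  have hd : Continuous (deriv φ) := h1.continuous_deriv (by simp)
  have e1 : ∫ x, deriv φ x • (u + u' : L2) x = ∫ x, (deriv φ x • u x + deriv φ x • u' x) := by
    apply integral_congr_ae
    filter_upwards [Lp.coeFn_add u u'] with x hx
    rw [hx, Pi.add_apply, smul_add]
  have e2 : ∫ x, φ x • (v + v' : L2) x = ∫ x, (φ x • v x + φ x • v' x) := by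
    apply integral_congr_ae
    filter_upwards [Lp.coeFn_add v v'] with x hx
    rw [hx, Pi.add_apply, smul_add]
  rw [e1, e2, integral_add (L2.integrable_smul u hd h2.deriv) (L2.integrable_smul u' hd h2.deriv),
    integral_add (L2.integrable_smul v h1.continuous h2) (L2.integrable_smul v' h1.continuous h2),
    h φ h1 h2, h' φ h1 h2]
  ring

lemma IsWeakDeriv.smul {u v : L2} (a : ℂ) (h : IsWeakDeriv u v) :
    IsWeakDeriv (a • u) (a • v) := by
  intro φ h1 h2
  have e1 : ∫ x, deriv φ x • (a • u : L2) x = ∫ x, a • (deriv φ x • u x) := by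
    apply integral_congr_ae
    filter_upwards [Lp.coeFn_smul a u] with x hx
    rw [hx, Pi.smul_apply, smul_comm]
  have e2 : ∫ x, φ x • (a • v : L2) x = ∫ x, a • (φ x • v x) := by
    apply integral_congr_ae
    filter_upwards [Lp.coeFn_smul a v] with x hx
    rw [hx, Pi.smul_apply, smul_comm]
  rw [e1, e2, integral_smul, integral_smul, h φ h1 h2, smul_neg]

lemma IsWeakDeriv.zero : IsWeakDeriv 0 0 := by
  intro φ h1 h2
  have e (ψ : ℝ → ℝ) : ∫ x, ψ x • (0 : L2) x = 0 := by
    rw [← integral_zero ℝ ℂ]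
    apply integral_congr_ae
    filter_upwards [Lp.coeFn_zero ℂ 2 (volume : Measure ℝ)] with x hx
    rw [hx, Pi.zero_apply, smul_zero]
  rw [e, e, neg_zero]

/-- The Sobolev space `H²(ℝ)`: the `u ∈ L²(ℝ)` whose first and second weak derivatives exist and
lie in `L²(ℝ)`. -/
def H2 : Submodule ℂ L2 where
  carrier := {u | ∃ v w : L2, IsWeakDeriv u v ∧ IsWeakDeriv v w}
  add_mem' := by
    rintro _ _ ⟨v, w, h1, h2⟩ ⟨v', w', h1', h2'⟩
    exact ⟨v + v', w + w', h1.add h1', h2.add h2'⟩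
  zero_mem' := ⟨0, 0, IsWeakDeriv.zero, IsWeakDeriv.zero⟩
  smul_mem' := by
    rintro a _ ⟨v, w, h1, h2⟩
    exact ⟨a • v, a • w, h1.smul a, h2.smul a⟩

lemma H2.exists_deriv (u : H2) : ∃ v : L2, IsWeakDeriv u v ∧ ∃ w, IsWeakDeriv v w := by
  obtain ⟨_, v, w, h1, h2⟩ := u
  exact ⟨v, h1, w, h2⟩

/-- The first weak derivative `H²(ℝ) → L²(ℝ)`. -/
def D1 : H2 →ₗ[ℂ] L2 where
  toFun u := (H2.exists_deriv u).choose
  map_add' u v := IsWeakDeriv.unique (H2.exists_deriv (u + v)).choose_spec.1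
    ((H2.exists_deriv u).choose_spec.1.add (H2.exists_deriv v).choose_spec.1)
  map_smul' a u := IsWeakDeriv.unique (H2.exists_deriv (a • u)).choose_spec.1
    ((H2.exists_deriv u).choose_spec.1.smul a)

lemma isWeakDeriv_D1 (u : H2) : IsWeakDeriv u (D1 u) := (H2.exists_deriv u).choose_spec.1

lemma exists_isWeakDeriv_D1 (u : H2) : ∃ w, IsWeakDeriv (D1 u) w :=
  (H2.exists_deriv u).choose_spec.2

/-- The second weak derivative `H²(ℝ) → L²(ℝ)`. -/
def D2 : H2 →ₗ[ℂ] L2 where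
  toFun u := (exists_isWeakDeriv_D1 u).choose
  map_add' u v := IsWeakDeriv.unique (exists_isWeakDeriv_D1 (u + v)).choose_spec (by
    rw [map_add]
    exact (exists_isWeakDeriv_D1 u).choose_spec.add (exists_isWeakDeriv_D1 v).choose_spec)
  map_smul' a u := IsWeakDeriv.unique (exists_isWeakDeriv_D1 (a • u)).choose_spec (by
    rw [map_smul]
    exact (exists_isWeakDeriv_D1 u).choose_spec.smul a)

lemma isWeakDeriv_D2 (u : H2) : IsWeakDeriv (D1 u) (D2 u) := (exists_isWeakDeriv_D1 u).choose_spec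

/-! ### The nonlinearity and the travelling front -/

/-- The derivative `f'` of a function `f` of class `C¹` on `[0, 1]` (one-sided at `0` and `1`). -/
def der (f : ℝ → ℝ) (u : ℝ) : ℝ := derivWithin f (Icc 0 1) u

/-- `f ∈ C¹[0, 1]` is of bistable type. -/
structure IsBistable (f : ℝ → ℝ) : Prop where
  contDiffOn : ContDiffOn ℝ 1 f (Icc 0 1)
  map_zero : f 0 = 0
  map_one : f 1 = 0
  der_zero_neg : der f 0 < 0
  der_one_neg : der f 1 < 0
  sign : ∃ α ∈ Ioo (0 : ℝ) 1, (∀ u ∈ Ioo 0 α, f u < 0) ∧ (∀ u ∈ Ioo α 1, 0 < f u)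

/-- `Φ` is a `[0, 1]`-wave front with speed `c`. -/
structure IsWaveFront (f : ℝ → ℝ) (c : ℝ) (Φ : ℝ → ℝ) : Prop where
  contDiff : ContDiff ℝ 2 Φ
  ode : ∀ x, deriv (deriv Φ) x + c * deriv Φ x + f (Φ x) = 0
  mem_Icc : ∀ x, Φ x ∈ Icc (0 : ℝ) 1
  tendsto_atBot : Tendsto Φ atBot (𝓝 0)
  tendsto_atTop : Tendsto Φ atTop (𝓝 1)
  deriv_pos : ∀ x, 0 < deriv Φ x

/-- The square of the norm of `Φ'` in `L²(ℝ)`. -/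
def normSqDeriv (Φ : ℝ → ℝ) : ℝ := ∫ x, (deriv Φ x) ^ 2

/-- The functional `λ(Φ) = - (∫₀¹ f) / ‖Φ'‖²`. -/
def lam (f Φ : ℝ → ℝ) : ℝ := -(∫ s in (0 : ℝ)..1, f s) / normSqDeriv Φ

section Front

variable {f Φ : ℝ → ℝ} {c : ℝ}

lemma memLp_coeff (hf : IsBistable f) (hΦ : IsWaveFront f c Φ) :
    MemLp (fun x => (der f (Φ x) : ℂ)) ∞ (volume : Measure ℝ) := by
  have hc : ContinuousOn (der f) (Icc 0 1) :=
    hf.contDiffOn.continuousOn_derivWithin (uniqueDiffOn_Icc one_pos) le_rfl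
  obtain ⟨C, hC⟩ := isCompact_Icc.exists_bound_of_continuousOn hc
  have hcont : Continuous fun x => (der f (Φ x) : ℂ) :=
    Complex.continuous_ofReal.comp
      (hc.comp_continuous hΦ.contDiff.continuous hΦ.mem_Icc)
  refine memLp_top_of_bound hcont.aestronglyMeasurable C (Eventually.of_forall fun x => ?_)
  rw [Complex.norm_real]
  exact hC _ (hΦ.mem_Icc x)

lemma integrable_deriv (hΦ : IsWaveFront f c Φ) : Integrable (deriv Φ) := by
  have hd : ∀ x, HasDerivAt Φ (deriv Φ x) x := fun x =>
    (hΦ.contDiff.differentiable (by norm_num) x).hasDerivAt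
  have h1 : IntegrableOn (deriv Φ) (Ioi 0) :=
    integrableOn_Ioi_deriv_of_nonneg' (fun x _ => hd x) (fun x _ => (hΦ.deriv_pos x).le)
      hΦ.tendsto_atTop
  have h2 : IntegrableOn (fun x => deriv Φ (-x)) (Ioi 0) := by
    have ht : Tendsto (fun x => -Φ (-x)) atTop (𝓝 (-0)) :=
      (hΦ.tendsto_atBot.comp tendsto_neg_atTop_atBot).neg
    refine integrableOn_Ioi_deriv_of_nonneg' (g := fun x => -Φ (-x)) (fun x _ => ?_)
      (fun x _ => (hΦ.deriv_pos _).le) ht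
    have h := ((hd (-x)).comp x (hasDerivAt_neg x)).neg
    rw [mul_neg, mul_one, neg_neg] at h
    exact h
  have h3 : IntegrableOn (deriv Φ) (Iic 0) := by
    have h := ((Measure.measurePreserving_neg (volume : Measure ℝ)).integrableOn_comp_preimage
      (Homeomorph.neg ℝ).measurableEmbedding (f := fun x => deriv Φ (-x)) (s := Ioi 0)).2 h2
    have e : (fun x : ℝ => -x) ⁻¹' Ioi 0 = Iio 0 := by ext x; simp
    have e' : ((fun x => deriv Φ (-x)) ∘ fun x : ℝ => -x) = deriv Φ := by ext x; simp
    rw [integrableOn_Iic_iff_integrableOn_Iio, ← e, ← e']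
    exact h
  rw [← integrableOn_univ, ← Iic_union_Ioi (a := (0 : ℝ))]
  exact h3.union h1

lemma exists_deriv_le (hf : IsBistable f) (hΦ : IsWaveFront f c Φ) :
    ∃ B, ∀ x, deriv Φ x ≤ B := by
  obtain ⟨M, hM⟩ := isCompact_Icc.exists_bound_of_continuousOn hf.contDiffOn.continuousOn
  have hd : ∀ x, HasDerivAt Φ (deriv Φ x) x := fun x =>
    (hΦ.contDiff.differentiable (by norm_num) x).hasDerivAt
  have hd2 : ∀ x, HasDerivAt (deriv Φ) (deriv (deriv Φ) x) x := fun x =>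
    (((contDiff_succ_iff_deriv (n := 1)).1 hΦ.contDiff).2.2.differentiable (by norm_num)
      x).hasDerivAt
  have hg : ∀ x, HasDerivAt (fun y => deriv Φ y + c * Φ y) (-f (Φ x)) x := fun x => by
    have h := (hd2 x).add ((hd x).const_mul c)
    have e : deriv (deriv Φ) x + c * deriv Φ x = -f (Φ x) := by linarith [hΦ.ode x]
    rw [e] at h
    exact h
  refine ⟨1 + M + |c|, fun x => ?_⟩
  obtain ⟨y, hy, hy'⟩ := exists_hasDerivAt_eq_slope Φ (deriv Φ) (lt_add_one x)
    hΦ.contDiff.continuous.continuousOn (fun z _ => hd z)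
  have h0 := hΦ.mem_Icc x
  have h1 := hΦ.mem_Icc (x + 1)
  have h2 := hΦ.mem_Icc y
  have hy1 : deriv Φ y ≤ 1 := by
    rw [hy']
    simp only [add_sub_cancel_left, div_one]
    linarith [h0.1, h1.2]
  obtain ⟨t, ht, ht'⟩ := exists_hasDerivAt_eq_slope (fun y => deriv Φ y + c * Φ y)
    (fun x => -f (Φ x)) hy.1 (fun z _ => (hg z).continuousAt.continuousWithinAt) (fun z _ => hg z)
  have hM0 := hM _ (hΦ.mem_Icc t)
  rw [Real.norm_eq_abs] at hM0
  rw [eq_div_iff (by linarith [hy.1])] at ht'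
  have hmul : f (Φ t) * (y - x) ≤ M := by
    have h3 := abs_nonneg (f (Φ t))
    have h4 := le_abs_self (f (Φ t))
    have h5 : 0 < y - x := by linarith [hy.1]
    have h6 : y - x < 1 := by linarith [hy.2]
    nlinarith
  have hc : c * (Φ y - Φ x) ≤ |c| := by
    have h3 : |Φ y - Φ x| ≤ 1 := abs_le.2 ⟨by linarith [h0.2, h2.1], by linarith [h0.1, h2.2]⟩
    calc c * (Φ y - Φ x) ≤ |c * (Φ y - Φ x)| := le_abs_self _
      _ = |c| * |Φ y - Φ x| := abs_mul _ _
      _ ≤ |c| := mul_le_of_le_one_right (abs_nonneg c) h3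
  linarith

lemma memLp_frontDeriv (hf : IsBistable f) (hΦ : IsWaveFront f c Φ) :
    MemLp (fun x => ((deriv Φ x : ℝ) : ℂ)) 2 (volume : Measure ℝ) := by
  have hcont : Continuous (deriv Φ) := hΦ.contDiff.continuous_deriv (by norm_num)
  have hi := integrable_deriv hΦ
  obtain ⟨B, hB⟩ := exists_deriv_le hf hΦ
  have hr : MemLp (deriv Φ) 2 (volume : Measure ℝ) := by
    rw [memLp_two_iff_integrable_sq hcont.aestronglyMeasurable]
    refine (hi.const_mul B).mono' (hcont.pow 2).aestronglyMeasurable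
      (Eventually.of_forall fun x => ?_)
    have h0 := hΦ.deriv_pos x
    rw [Real.norm_eq_abs, abs_of_nonneg (sq_nonneg _), sq]
    exact mul_le_mul_of_nonneg_right (hB x) h0.le
  exact hr.ofReal

/-- `Φ'` as an element of `L²(ℝ)`. -/
def frontDeriv (hf : IsBistable f) (hΦ : IsWaveFront f c Φ) : L2 :=
  (memLp_frontDeriv hf hΦ).toLp

/-- Multiplication by the bounded function `f'(Φ)` on `L²(ℝ)`. -/
def mulCoeff (hf : IsBistable f) (hΦ : IsWaveFront f c Φ) : L2 →ₗ[ℂ] L2 where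
  toFun w := (memLp_coeff hf hΦ).toLp • w
  map_add' u v := Lp.add_smul _ u v
  map_smul' a u := (Lp.smul_comm a _ u).symm

/-- The map `w ↦ w'' + λ(Φ) w' + f'(Φ) w` from `H²(ℝ)` to `L²(ℝ)`. -/
def localMap (hf : IsBistable f) (hΦ : IsWaveFront f c Φ) : H2 →ₗ[ℂ] L2 :=
  D2 + (lam f Φ : ℂ) • D1 + mulCoeff hf hΦ ∘ₗ H2.subtype

/-- The local operator `L₀ w = w'' + λ(Φ) w' + f'(Φ) w` in `L²(ℝ)`, with domain `H²(ℝ)`. -/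
def localOp (hf : IsBistable f) (hΦ : IsWaveFront f c Φ) : L2 →ₗ.[ℂ] L2 where
  domain := H2
  toFun := localMap hf hΦ

/-- The functional `π(w) = (-2 λ(Φ) / ‖Φ'‖²) ⟨Φ', w'⟩`, with the inner product of `L²(ℝ)`. -/
def nonlocalFunctional (hf : IsBistable f) (hΦ : IsWaveFront f c Φ) : H2 →ₗ[ℂ] ℂ :=
  ((-2 * lam f Φ / normSqDeriv Φ : ℝ) : ℂ) •
    ((innerSL ℂ (frontDeriv hf hΦ)).toLinearMap ∘ₗ D1)

/-- The nonlocal operator `L w = L₀ w + π(w) Φ'` in `L²(ℝ)`, with domain `H²(ℝ)`. -/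
def nonlocalOp (hf : IsBistable f) (hΦ : IsWaveFront f c Φ) : L2 →ₗ.[ℂ] L2 where
  domain := H2
  toFun := localMap hf hΦ + (nonlocalFunctional hf hΦ).smulRight (frontDeriv hf hΦ)

end Front

end

end TravellingWave

namespace TravellingWave

noncomputable section

/-! ### Absolutely continuous representatives of weakly differentiable functions -/

/-! Multiplying the front equation by `Φ'` and integrating gives `λ(Φ) = c`, so differentiating the
equation gives `L₀ Φ' = 0`. Integration by parts turns the nonlocal functional into the bounded
functional `w ↦ -κ ⟨Φ'', w⟩`, with `κ = -2λ/‖Φ'‖²`, and this vanishes at `Φ'` because `Φ' Φ''` is an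
exact derivative. Thus `L` is `L₀` plus a rank-one operator whose range is spanned by a null vector
of `L₀` on which its functional is zero. The resolvents of `L` and `L₀` then determine each other
explicitly away from `0`, and `0` is an eigenvalue of both (`spectrum_eq_of_rankOne`).

It remains to study `L₀` to the right of `m = max (f'(0), f'(1))`. There the potential `f'(Φ) - Re
z` is negative near infinity, and a Poincaré inequality on short cells controls the bounded
remainder by finitely many averages. So `L₀ - z` is a finite-rank perturbation of an operator
inverted by Lax-Milgram (`exists_finiteRank_isBoundedInverse`), and the Fredholm alternative makes
every spectral point with `Re z > m` an eigenvalue with finite-dimensional kernel and closed range.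

The drift `c w'` spoils self-adjointness in `L²`, but an energy estimate shows that eigenfunctions,
and generalized eigenfunctions of order two, stay square-integrable after multiplication by `exp (c
x / 2)` (`Sol.memLp_wt`). In the weighted variable the equation is of Schrödinger type, so Green's
identity makes these eigenvalues real and semisimple, and semisimplicity isolates them
(`exists_isolated`). Since `Φ' > 0` is a null solution, factoring the weighted equation through its
logarithmic derivative shows that `0` is the only eigenvalue with `Re z ≥ 0` and that its kernel is
spanned by `Φ'` (`Sol.ground_state`).

The root spaces of `L - z` lie in `ker (L₀ - z) + span Φ'`. At `z = 0` this sum is `span Φ'`, which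
gives algebraic simplicity and excludes `L w = Φ'`. -/

lemma intervalIntegrable_of_locallyIntegrable {f : ℝ → ℂ} (hf : LocallyIntegrable f) (x y : ℝ) :
    IntervalIntegrable f volume x y :=
  intervalIntegrable_iff.2
    ((hf.integrableOn_isCompact isCompact_uIcc).mono_set uIoc_subset_uIcc)

/-- `F` is a primitive of the locally integrable function `f`. -/
def IsPrimitive (F f : ℝ → ℂ) : Prop :=
  LocallyIntegrable f ∧ ∀ x y, F y - F x = ∫ t in x..y, f t

lemma IsPrimitive.intervalIntegrable {F f : ℝ → ℂ} (h : IsPrimitive F f) (x y : ℝ) :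
    IntervalIntegrable f volume x y :=
  intervalIntegrable_of_locallyIntegrable h.1 x y

lemma IsPrimitive.eq {F f : ℝ → ℂ} (h : IsPrimitive F f) (x : ℝ) :
    F = fun y => F x + ∫ t in x..y, f t := by
  funext y
  rw [← h.2 x y]; ring

lemma IsPrimitive.continuous {F f : ℝ → ℂ} (h : IsPrimitive F f) : Continuous F := by
  rw [h.eq 0]
  exact continuous_const.add (intervalIntegral.continuous_primitive h.intervalIntegrable 0)

lemma IsPrimitive.star {F f : ℝ → ℂ} (h : IsPrimitive F f) :
    IsPrimitive (fun x => (starRingEnd ℂ) (F x)) (fun x => (starRingEnd ℂ) (f x)) := by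
  refine ⟨fun x => ?_, fun x y => ?_⟩
  · obtain ⟨s, hs, hi⟩ := h.1 x
    exact ⟨s, hs, Complex.conjCLE.toContinuousLinearMap.integrable_comp hi⟩
  · rw [← map_sub, h.2 x y, intervalIntegral, intervalIntegral, map_sub, integral_conj,
      integral_conj]

lemma isPrimitive_of_hasDerivAt {F f : ℝ → ℂ} (h : ∀ x, HasDerivAt F (f x) x)
    (hf : Continuous f) : IsPrimitive F f :=
  ⟨hf.locallyIntegrable, fun x y => (intervalIntegral.integral_eq_sub_of_hasDerivAt
    (fun t _ => h t) (hf.intervalIntegrable x y)).symm⟩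

lemma IsPrimitive.hasDerivAt {F f : ℝ → ℂ} (h : IsPrimitive F f) (hf : Continuous f) (x : ℝ) :
    HasDerivAt F (f x) x := by
  rw [h.eq x]
  exact (hf.integral_hasStrictDerivAt x x).hasDerivAt.const_add _

lemma IsPrimitive.ae_hasDerivAt {F f : ℝ → ℂ} (h : IsPrimitive F f) :
    ∀ᵐ x, HasDerivAt F (f x) x := by
  filter_upwards [LocallyIntegrable.ae_hasDerivAt_integral h.1] with x hx
  rw [h.eq 0]
  exact (hx 0).const_add _

/-- Used with `N` the real primitive of `‖f‖`, whose increments dominate those of a primitive of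
`f`. -/
lemma absolutelyContinuousOnInterval_of_dist_le {F : ℝ → ℂ} {N : ℝ → ℝ} {a b : ℝ}
    (hN : AbsolutelyContinuousOnInterval N a b) (h : ∀ x y, dist (F x) (F y) ≤ dist (N x) (N y)) :
    AbsolutelyContinuousOnInterval F a b := by
  rw [absolutelyContinuousOnInterval_iff] at hN ⊢
  intro ε hε
  obtain ⟨δ, hδ, H⟩ := hN ε hε
  exact ⟨δ, hδ, fun E hE hE' => (Finset.sum_le_sum fun i _ => h _ _).trans_lt (H E hE hE')⟩

lemma IsPrimitive.absolutelyContinuousOnInterval {F f : ℝ → ℂ} (h : IsPrimitive F f) (a b : ℝ) :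
    AbsolutelyContinuousOnInterval F a b := by
  have hn : ∀ x y, IntervalIntegrable (fun t => ‖f t‖) volume x y :=
    fun x y => (h.intervalIntegrable x y).norm
  refine absolutelyContinuousOnInterval_of_dist_le
    ((hn a b).absolutelyContinuousOnInterval_intervalIntegral left_mem_uIcc) fun x y => ?_
  rw [dist_comm, dist_comm (∫ v in a..x, ‖f v‖), dist_eq_norm, dist_eq_norm, h.2 x y,
    intervalIntegral.integral_interval_sub_left (hn _ _) (hn _ _), Real.norm_eq_abs]
  exact intervalIntegral.norm_integral_le_abs_integral_norm

lemma LocallyIntegrable.mul_continuous {f g : ℝ → ℂ} (hf : LocallyIntegrable f)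
    (hg : Continuous g) : LocallyIntegrable (fun x => f x * g x) := by
  rw [locallyIntegrable_iff]
  intro k hk
  exact (hf.integrableOn_isCompact hk).mul_continuousOn hg.continuousOn hk

/-- The product minus the primitive of the candidate derivative is absolutely continuous with
derivative zero almost everywhere, hence constant. This product rule underlies every integration by
parts between weakly differentiable functions. -/
lemma IsPrimitive.mul {F f G g : ℝ → ℂ} (hF : IsPrimitive F f) (hG : IsPrimitive G g) :
    IsPrimitive (fun x => F x * G x) (fun x => f x * G x + F x * g x) := by
  have hi : LocallyIntegrable (fun x => f x * G x + F x * g x) := by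
    refine (LocallyIntegrable.mul_continuous hF.1 hG.continuous).add ?_
    simpa only [mul_comm] using LocallyIntegrable.mul_continuous hG.1 hF.continuous
  refine ⟨hi, fun x y => ?_⟩
  set h := fun x => f x * G x + F x * g x
  have hP : IsPrimitive (fun t => ∫ s in x..t, h s) h := ⟨hi, fun a b => by
    rw [intervalIntegral.integral_interval_sub_left] <;> exact intervalIntegrable_of_locallyIntegrable hi _ _⟩
  have hAC := ((hF.absolutelyContinuousOnInterval x y).smul
    (hG.absolutelyContinuousOnInterval x y)).sub (hP.absolutelyContinuousOnInterval x y)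
  obtain ⟨C, hC⟩ := hAC.const_of_ae_hasDerivAt_zero (by
    filter_upwards [hF.ae_hasDerivAt, hG.ae_hasDerivAt, hP.ae_hasDerivAt] with t h1 h2 h3 _
    have h4 := (h1.mul h2).sub h3
    rwa [sub_self] at h4)
  have h1 := hC x left_mem_uIcc
  have h2 := hC y right_mem_uIcc
  simp only [Pi.sub_apply, smul_eq_mul, Pi.mul_apply, intervalIntegral.integral_same] at h1 h2
  linear_combination h2 - h1

/-- The integral of the derivative of an integrable function vanishes. -/
lemma IsPrimitive.integral_eq_zero {F f : ℝ → ℂ} (h : IsPrimitive F f) (hF : Integrable F)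
    (hf : Integrable f) : ∫ x, f x = 0 := by
  have h1 : Tendsto (fun R : ℝ => F R - F (-R)) atTop (𝓝 (∫ x, f x)) := by
    simp_rw [h.2]
    exact intervalIntegral_tendsto_integral hf tendsto_neg_atTop_atBot tendsto_id
  have h2 : Integrable (fun R : ℝ => F R - F (-R)) := hF.sub hF.comp_neg
  -- `F R - F (-R)` is integrable and has a limit at infinity; a half-line has infinite measure, so
  -- the limit is zero.
  refine IntegrableAtFilter.eq_zero_of_tendsto (μ := volume) (h2.integrableAtFilter atTop) ?_ h1
  intro s hs
  rcases mem_atTop_sets.1 hs with ⟨b, hb⟩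
  rw [← top_le_iff, ← Real.volume_Ici (a := b)]
  exact measure_mono hb

/-- The lemma of du Bois-Reymond. -/
lemma ae_eq_const_of_integral_deriv_smul_eq_zero {g : ℝ → ℂ} (hg : LocallyIntegrable g)
    (h : ∀ φ : ℝ → ℝ, ContDiff ℝ ∞ φ → HasCompactSupport φ → ∫ x, deriv φ x • g x = 0) :
    ∃ C : ℂ, ∀ᵐ x, g x = C := by
  let b : ContDiffBump (0 : ℝ) := ⟨1, 2, one_pos, one_lt_two⟩
  set ρ : ℝ → ℝ := b.normed volume
  have hρ : ContDiff ℝ ∞ ρ := b.contDiff_normed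
  have hρs : HasCompactSupport ρ := b.hasCompactSupport_normed
  have hρ1 : ∫ x, ρ x = 1 := b.integral_normed
  refine ⟨∫ x, ρ x • g x, ?_⟩
  refine ae_eq_of_integral_contDiff_smul_eq hg (continuous_const.locallyIntegrable) ?_
  intro φ h1 h2
  have int : ∀ ψ : ℝ → ℝ, Continuous ψ → HasCompactSupport ψ → Integrable (fun x => ψ x • g x) :=
    fun ψ c s => hg.integrable_smul_left_of_hasCompactSupport c s
  set m := ∫ x, φ x
  -- Subtracting `m ρ` gives mean zero, which is exactly what makes the primitive `θ` of `η`
  -- compactly supported and so an admissible test function.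
  set η : ℝ → ℝ := fun x => φ x - m * ρ x
  have hη : ContDiff ℝ ∞ η := h1.sub (contDiff_const.mul hρ)
  have hηs : HasCompactSupport η := h2.sub (hρs.mul_left)
  have hηi : Integrable η := hη.continuous.integrable_of_hasCompactSupport hηs
  have hη0 : ∫ x, η x = 0 := by
    rw [integral_sub (h1.continuous.integrable_of_hasCompactSupport h2)
      ((hρ.continuous.integrable_of_hasCompactSupport hρs).const_mul m), integral_const_mul, hρ1,
      mul_one, sub_self]
  obtain ⟨R, hR⟩ := hηs.isCompact.isBounded.subset_closedBall 0
  have hout : ∀ x, R < |x| → η x = 0 := fun x hx => by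
    by_contra hne
    have := hR (subset_tsupport η hne)
    rw [mem_closedBall_zero_iff, Real.norm_eq_abs] at this
    linarith
  set θ : ℝ → ℝ := fun x => ∫ t in (-(|R| + 1))..x, η t
  have hθ : ∀ x, HasDerivAt θ (η x) x := fun x =>
    (hη.continuous.integral_hasStrictDerivAt _ x).hasDerivAt
  have hθd : deriv θ = η := funext fun x => (hθ x).deriv
  have hθc : ContDiff ℝ ∞ θ :=
    contDiff_infty_iff_deriv.2 ⟨fun x => (hθ x).differentiableAt, hθd ▸ hη⟩
  have hR1 := le_abs_self R
  have hR0 := abs_nonneg R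
  have hθs : HasCompactSupport θ := by
    refine HasCompactSupport.intro (isCompact_Icc (a := -(|R| + 1)) (b := |R| + 1)) fun x hx => ?_
    rw [mem_Icc, not_and_or, not_le, not_le] at hx
    rcases hx with hx | hx
    · refine (intervalIntegral.integral_congr (g := fun _ => (0 : ℝ)) fun t ht => ?_).trans
        intervalIntegral.integral_zero
      rw [uIcc_of_ge hx.le] at ht
      refine hout t ?_
      rw [abs_of_nonpos (by linarith [ht.2])]
      linarith [ht.2]
    · have : θ x = ∫ t, η t := by
        refine intervalIntegral.integral_eq_integral_of_support_subset fun t ht => ?_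
        have h3 : |t| ≤ R := not_lt.1 fun h4 => ht (hout t h4)
        have := abs_le.1 h3
        constructor <;> linarith [this.1, this.2]
      rw [this, hη0]
  have key := h θ hθc hθs
  rw [hθd] at key
  have e : (fun x => η x • g x) = fun x => φ x • g x - m • (ρ x • g x) := by
    funext x
    simp only [η, sub_smul, mul_smul]
  rw [e, integral_sub (int φ h1.continuous h2)
    (show Integrable (fun x => m • (ρ x • g x)) from (int ρ hρ.continuous hρs).smul m), integral_smul,
    sub_eq_zero] at key
  rw [key, integral_smul_const]

lemma isPrimitive_of_contDiff {φ : ℝ → ℝ} (h : ContDiff ℝ ∞ φ) :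
    IsPrimitive (fun x => (φ x : ℂ)) (fun x => ((deriv φ x : ℝ) : ℂ)) :=
  isPrimitive_of_hasDerivAt
    (fun x => ((h.differentiable (by simp)).differentiableAt.hasDerivAt).ofReal_comp)
    (Complex.continuous_ofReal.comp (h.continuous_deriv (by simp)))

/-- Integration by parts against test functions. -/
lemma IsPrimitive.integral_deriv_smul {U v : ℝ → ℂ} (h : IsPrimitive U v) {φ : ℝ → ℝ}
    (h1 : ContDiff ℝ ∞ φ) (h2 : HasCompactSupport φ) :
    ∫ x, deriv φ x • U x = -∫ x, φ x • v x := by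
  have hd : Continuous (deriv φ) := h1.continuous_deriv (by simp)
  have i1 : Integrable (fun x => deriv φ x • U x) :=
    h.continuous.locallyIntegrable.integrable_smul_left_of_hasCompactSupport hd h2.deriv
  have i2 : Integrable (fun x => φ x • v x) :=
    h.1.integrable_smul_left_of_hasCompactSupport h1.continuous h2
  have i3 : Integrable (fun x => φ x • U x) :=
    h.continuous.locallyIntegrable.integrable_smul_left_of_hasCompactSupport h1.continuous h2
  have e := ((isPrimitive_of_contDiff h1).mul h).integral_eq_zero
    (by simpa only [Complex.real_smul] using i3)
    (by simp only [← Complex.real_smul]; exact i1.add i2)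
  simp only [← Complex.real_smul] at e
  rw [integral_add i1 i2] at e
  exact eq_neg_of_add_eq_zero_left e

lemma L2.locallyIntegrable (u : L2) : LocallyIntegrable u :=
  (Lp.memLp u).locallyIntegrable (by norm_num)

/-- A weakly differentiable function has an absolutely continuous representative. -/
lemma IsWeakDeriv.exists_isPrimitive {u v : L2} (h : IsWeakDeriv u v) :
    ∃ U : ℝ → ℂ, IsPrimitive U v ∧ ∀ᵐ x, u x = U x := by
  set U₀ : ℝ → ℂ := fun x => ∫ t in (0 : ℝ)..x, v t
  have hv := L2.locallyIntegrable v
  have hU₀ : IsPrimitive U₀ v := ⟨hv, fun a b => by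
    rw [intervalIntegral.integral_interval_sub_left] <;> exact intervalIntegrable_of_locallyIntegrable hv _ _⟩
  obtain ⟨C, hC⟩ := ae_eq_const_of_integral_deriv_smul_eq_zero
    ((L2.locallyIntegrable u).sub hU₀.continuous.locallyIntegrable) (fun φ h1 h2 => by
      have hd : Continuous (deriv φ) := h1.continuous_deriv (by simp)
      simp only [Pi.sub_apply, smul_sub]
      rw [integral_sub (L2.integrable_smul u hd h2.deriv)
        (hU₀.continuous.locallyIntegrable.integrable_smul_left_of_hasCompactSupport hd h2.deriv),
        h φ h1 h2, hU₀.integral_deriv_smul h1 h2, sub_self])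
  refine ⟨fun x => U₀ x + C, ⟨hv, fun x y => by rw [← hU₀.2 x y]; ring⟩, ?_⟩
  filter_upwards [hC] with x hx
  rw [← hx, Pi.sub_apply]; ring

lemma isWeakDeriv_of_isPrimitive {U : ℝ → ℂ} {u v : L2} (hu : ∀ᵐ x, u x = U x)
    (h : IsPrimitive U v) : IsWeakDeriv u v := by
  intro φ h1 h2
  rw [← h.integral_deriv_smul h1 h2]
  refine integral_congr_ae ?_
  filter_upwards [hu] with x hx
  rw [hx]

lemma isWeakDeriv_toLp {U V : ℝ → ℂ} (h : ∀ x, HasDerivAt U (V x) x) (hc : Continuous V)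
    (hU : MemLp U 2 volume) (hV : MemLp V 2 volume) : IsWeakDeriv hU.toLp hV.toLp := by
  have hP := isPrimitive_of_hasDerivAt h hc
  refine isWeakDeriv_of_isPrimitive hU.coeFn_toLp ⟨L2.locallyIntegrable _, fun x y => ?_⟩
  rw [hP.2 x y]
  refine intervalIntegral.integral_congr_ae ?_
  filter_upwards [hV.coeFn_toLp] with t ht _
  exact ht.symm

lemma integrable_conj_mul {f g : ℝ → ℂ} (hf : MemLp f 2 volume) (hg : MemLp g 2 volume) :
    Integrable (fun x => (starRingEnd ℂ) (f x) * g x) :=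
  MemLp.integrable_mul (p := 2) (q := 2) hf.star hg

lemma L2.inner_eq (u v : L2) : inner ℂ u v = ∫ x, (starRingEnd ℂ) (u x) * v x := by
  rw [MeasureTheory.L2.inner_def]
  simp only [RCLike.inner_apply, mul_comm]

/-- Integration by parts in `H¹(ℝ)`. -/
lemma IsWeakDeriv.inner_eq_neg {a b u v : L2} (h : IsWeakDeriv a b) (h' : IsWeakDeriv u v) :
    inner ℂ a v = -inner ℂ b u := by
  obtain ⟨A, hA, hA'⟩ := h.exists_isPrimitive
  obtain ⟨U, hU, hU'⟩ := h'.exists_isPrimitive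
  have i1 := integrable_conj_mul (Lp.memLp a) (Lp.memLp v)
  have i2 := integrable_conj_mul (Lp.memLp b) (Lp.memLp u)
  have i3 := integrable_conj_mul (Lp.memLp a) (Lp.memLp u)
  have e2 : ∀ᵐ x, (starRingEnd ℂ) (b x) * u x + (starRingEnd ℂ) (a x) * v x =
      (starRingEnd ℂ) (b x) * U x + (starRingEnd ℂ) (A x) * v x := by
    filter_upwards [hA', hU'] with x h1 h2
    rw [h1, h2]
  have e := (hA.star.mul hU).integral_eq_zero
    (i3.congr (by filter_upwards [hA', hU'] with x h1 h2; rw [h1, h2]))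
    ((i2.add i1).congr e2)
  rw [← integral_congr_ae e2, integral_add i2 i1] at e
  rw [L2.inner_eq, L2.inner_eq]
  exact eq_neg_of_add_eq_zero_right e

/-! ### The Lax-Milgram theorem in `H¹(ℝ)` -/

section LaxMilgram

variable {E : Type*} [NormedAddCommGroup E] [InnerProductSpace ℂ E] [CompleteSpace E]

/-- A coercive bounded operator on a complex Hilbert space is invertible. -/
lemma exists_inverse_of_re_inner_ge (S : E →L[ℂ] E) {δ : ℝ} (hδ : 0 < δ)
    (h : ∀ x, δ * ‖x‖ ^ 2 ≤ (inner ℂ x (S x)).re) :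
    ∃ T : E ≃L[ℂ] E, ∀ x, T x = S x := by
  have hb : ∀ x, δ * ‖x‖ ≤ ‖S x‖ := fun x => by
    by_cases hx : x = 0
    · simp [hx]
    · have h1 : (inner ℂ x (S x)).re ≤ ‖x‖ * ‖S x‖ :=
        (Complex.re_le_norm _).trans (norm_inner_le_norm x (S x))
      have h2 := h x
      have h3 : 0 < ‖x‖ := norm_pos_iff.2 hx
      nlinarith
  have hanti : AntilipschitzWith (Real.toNNReal δ⁻¹) S := by
    refine ContinuousLinearMap.antilipschitz_of_bound S fun x => ?_
    rw [Real.coe_toNNReal _ (inv_pos.2 hδ).le, ← div_eq_inv_mul, le_div_iff₀ hδ, mul_comm]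
    exact hb x
  have hclosed : IsClosed (S.range : Set E) := hanti.isClosed_range S.uniformContinuous
  have hker : S.ker = ⊥ := LinearMap.ker_eq_bot.2 hanti.injective
  -- The range is closed by the lower bound, and a vector orthogonal to it is orthogonal to its own
  -- image, hence zero by coercivity.
  have hrange : S.range = ⊤ := by
    have := hclosed.completeSpace_coe
    rw [← Submodule.orthogonal_eq_bot_iff, Submodule.eq_bot_iff]
    intro x hx
    have h1 := (Submodule.mem_orthogonal' _ _).1 hx (S x) ⟨x, rfl⟩
    have h2 := h x
    rw [h1, Complex.zero_re] at h2
    have h3 : ‖x‖ ^ 2 ≤ 0 := by nlinarith [sq_nonneg ‖x‖]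
    exact norm_eq_zero.1 (pow_eq_zero_iff two_ne_zero |>.1 (le_antisymm h3 (sq_nonneg _)))
  exact ⟨ContinuousLinearEquiv.ofBijective S hker hrange, fun x => rfl⟩

end LaxMilgram

lemma memLp_test {φ : ℝ → ℝ} (h1 : Continuous φ) (h2 : HasCompactSupport φ) :
    MemLp (fun x => (φ x : ℂ)) 2 (volume : Measure ℝ) :=
  (h1.memLp_of_hasCompactSupport h2).ofReal

lemma inner_test {φ : ℝ → ℝ} (h1 : Continuous φ) (h2 : HasCompactSupport φ) (u : L2) :
    inner ℂ (memLp_test h1 h2).toLp u = ∫ x, φ x • u x := by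
  rw [L2.inner_eq]
  refine integral_congr_ae ?_
  filter_upwards [(memLp_test h1 h2).coeFn_toLp] with x hx
  rw [hx, Complex.conj_ofReal, Complex.real_smul]

lemma isWeakDeriv_test {φ : ℝ → ℝ} (h1 : ContDiff ℝ ∞ φ) (h2 : HasCompactSupport φ) :
    IsWeakDeriv (memLp_test h1.continuous h2).toLp
      (memLp_test (h1.continuous_deriv (by simp)) h2.deriv).toLp :=
  isWeakDeriv_toLp (fun x => ((h1.differentiable (by simp)).differentiableAt.hasDerivAt).ofReal_comp)
    (Complex.continuous_ofReal.comp (h1.continuous_deriv (by simp))) _ _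

/-- The Sobolev space `H¹(ℝ)`, as the graph of the weak derivative. -/
def H1 : Submodule ℂ (WithLp 2 (L2 × L2)) where
  carrier := {p | IsWeakDeriv p.fst p.snd}
  add_mem' := fun h h' => h.add h'
  zero_mem' := IsWeakDeriv.zero
  smul_mem' := fun a _ h => h.smul a

/-- Each test function imposes equality of two continuous functionals on the pair. Closedness makes
the graph a Hilbert space, as Lax-Milgram requires. -/
lemma isClosed_H1 : IsClosed (H1 : Set (WithLp 2 (L2 × L2))) := by
  have e : (H1 : Set (WithLp 2 (L2 × L2))) =
      ⋂ (φ : ℝ → ℝ) (h1 : ContDiff ℝ ∞ φ) (h2 : HasCompactSupport φ),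
        {p | inner ℂ (memLp_test (h1.continuous_deriv (by simp)) h2.deriv).toLp p.fst =
          -inner ℂ (memLp_test h1.continuous h2).toLp p.snd} := by
    ext p
    simp only [mem_iInter, mem_ofPred_eq]
    refine forall_congr' fun φ => forall_congr' fun h1 => forall_congr' fun h2 => ?_
    rw [inner_test (h1.continuous_deriv (by simp)) h2.deriv, inner_test h1.continuous h2]
  rw [e]
  refine isClosed_iInter fun φ => isClosed_iInter fun h1 => isClosed_iInter fun h2 => ?_
  refine isClosed_eq ?_ ?_ <;> fun_prop

instance : CompleteSpace H1 := isClosed_H1.completeSpace_coe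

/-- The inclusion `H¹(ℝ) → L²(ℝ)`. -/
def H1.incl : H1 →L[ℂ] L2 :=
  (ContinuousLinearMap.fst ℂ L2 L2 ∘L (WithLp.prodContinuousLinearEquiv 2 ℂ L2 L2 :
    WithLp 2 (L2 × L2) →L[ℂ] L2 × L2)) ∘L H1.subtypeL

/-- The weak derivative `H¹(ℝ) → L²(ℝ)`. -/
def H1.der : H1 →L[ℂ] L2 :=
  (ContinuousLinearMap.snd ℂ L2 L2 ∘L (WithLp.prodContinuousLinearEquiv 2 ℂ L2 L2 :
    WithLp 2 (L2 × L2) →L[ℂ] L2 × L2)) ∘L H1.subtypeL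

lemma H1.isWeakDeriv (u : H1) : IsWeakDeriv (H1.incl u) (H1.der u) := u.2

/-- The element of `H¹(ℝ)` given by a weakly differentiable function. -/
def H1.mk {u v : L2} (h : IsWeakDeriv u v) : H1 := ⟨WithLp.toLp 2 (u, v), h⟩

@[simp] lemma H1.incl_mk {u v : L2} (h : IsWeakDeriv u v) : H1.incl (H1.mk h) = u := rfl

@[simp] lemma H1.der_mk {u v : L2} (h : IsWeakDeriv u v) : H1.der (H1.mk h) = v := rfl

lemma H1.norm_sq (u : H1) : ‖u‖ ^ 2 = ‖H1.incl u‖ ^ 2 + ‖H1.der u‖ ^ 2 :=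
  WithLp.prod_norm_sq_eq_of_L2 (u : WithLp 2 (L2 × L2))

/-- `⟨u, u'⟩` is minus its own conjugate. Hence the drift term drops out of the real part of the
quadratic form, and coercivity does not depend on `c`. -/
lemma IsWeakDeriv.re_inner_eq_zero {u v : L2} (h : IsWeakDeriv u v) : (inner ℂ u v).re = 0 := by
  have h1 := congrArg Complex.re (h.inner_eq_neg h)
  rw [← inner_conj_symm v u, Complex.neg_re, Complex.conj_re] at h1
  linarith

/-- The element of `H²(ℝ)` with prescribed weak derivatives. -/
lemma exists_H2 {u v w : L2} (h : IsWeakDeriv u v) (h' : IsWeakDeriv v w) :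
    ∃ x : H2, (x : L2) = u ∧ D1 x = v ∧ D2 x = w := by
  set x : H2 := ⟨u, v, w, h, h'⟩
  have h1 : D1 x = v := (isWeakDeriv_D1 x).unique h
  refine ⟨x, rfl, h1, ?_⟩
  have h2 := isWeakDeriv_D2 x
  rw [h1] at h2
  exact h2.unique h'

/-- The operator `w ↦ w'' + c w' + A w` with domain `H²(ℝ)`. -/
def ellipticMap (c : ℝ) (A : L2 →L[ℂ] L2) : H2 →ₗ[ℂ] L2 :=
  D2 + (c : ℂ) • D1 + (A : L2 →ₗ[ℂ] L2) ∘ₗ H2.subtype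

lemma ellipticMap_apply (c : ℝ) (A : L2 →L[ℂ] L2) (w : H2) :
    ellipticMap c A w = D2 w + (c : ℂ) • D1 w + A w := rfl

/-- `B` is a bounded inverse of the operator `T` with domain `H²(ℝ)`. -/
def IsBoundedInverse (T : H2 →ₗ[ℂ] L2) (B : L2 →L[ℂ] L2) : Prop :=
  (∀ h, ∃ w : H2, (w : L2) = B h ∧ T w = h) ∧ ∀ w : H2, B (T w) = w

/-- The operator `w ↦ w'' + c w' + A w` is invertible if its quadratic form is coercive. -/
lemma exists_isBoundedInverse_of_coercive (c : ℝ) (A : L2 →L[ℂ] L2) {δ : ℝ} (hδ : 0 < δ)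
    (hA : ∀ u v, IsWeakDeriv u v →
      δ * (‖u‖ ^ 2 + ‖v‖ ^ 2) ≤ ‖v‖ ^ 2 - (inner ℂ u (A u)).re) :
    ∃ B, IsBoundedInverse (ellipticMap c A) B := by
  -- `S` represents on `H¹` the sesquilinear form of `-(w'' + c w' + A w)`, which explains the sign
  -- in `u = -S⁻¹ (incl* h)` below.
  set S : H1 →L[ℂ] H1 := H1.der.adjoint ∘L H1.der - H1.incl.adjoint ∘L ((c : ℂ) • H1.der) -
    H1.incl.adjoint ∘L A ∘L H1.incl
  have hS : ∀ φ u : H1, inner ℂ φ (S u) = inner ℂ (H1.der φ) (H1.der u) -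
      c * inner ℂ (H1.incl φ) (H1.der u) - inner ℂ (H1.incl φ) (A (H1.incl u)) := fun φ u => by
    have e : S u = H1.der.adjoint (H1.der u) - H1.incl.adjoint ((c : ℂ) • H1.der u) -
      H1.incl.adjoint (A (H1.incl u)) := rfl
    rw [e, inner_sub_right, inner_sub_right, ContinuousLinearMap.adjoint_inner_right,
      ContinuousLinearMap.adjoint_inner_right, ContinuousLinearMap.adjoint_inner_right,
      inner_smul_right]
  obtain ⟨T, hT⟩ := exists_inverse_of_re_inner_ge S hδ (fun u => by
    have h1 := hA _ _ (H1.isWeakDeriv u)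
    rw [hS, H1.norm_sq, Complex.sub_re, Complex.sub_re, Complex.re_ofReal_mul,
      (H1.isWeakDeriv u).re_inner_eq_zero, mul_zero, sub_zero, inner_self_eq_norm_sq_to_K]
    norm_cast)
  have hsol : ∀ h : L2, ∃ w : H2, (w : L2) = H1.incl (-(T.symm (H1.incl.adjoint h))) ∧
      ellipticMap c A w = h := by
    intro h
    set u : H1 := -(T.symm (H1.incl.adjoint h))
    have hu : S u = -(H1.incl.adjoint h) := by
      rw [← hT, map_neg, ContinuousLinearEquiv.apply_symm_apply]
    have hweak : ∀ φ : H1, inner ℂ (H1.der φ) (H1.der u) =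
        -inner ℂ (H1.incl φ) (h - (c : ℂ) • H1.der u - A (H1.incl u)) := fun φ => by
      have h1 := hS φ u
      rw [hu, inner_neg_right, ContinuousLinearMap.adjoint_inner_right] at h1
      rw [inner_sub_right, inner_sub_right, inner_smul_right]
      linear_combination -h1
    -- Regularity: tested against smooth functions, the variational equation says that `u'` has a
    -- weak derivative in `L²`, so `u` lies in `H²`.
    have hd : IsWeakDeriv (H1.der u) (h - (c : ℂ) • H1.der u - A (H1.incl u)) := by
      intro φ h1 h2
      have h3 := hweak (H1.mk (isWeakDeriv_test h1 h2))
      rw [H1.incl_mk, H1.der_mk, inner_test (h1.continuous_deriv (by simp)) h2.deriv,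
        inner_test h1.continuous h2] at h3
      exact h3
    obtain ⟨w, hw, hw1, hw2⟩ := exists_H2 (H1.isWeakDeriv u) hd
    refine ⟨w, hw, ?_⟩
    rw [ellipticMap_apply, hw, hw1, hw2]
    abel
  refine ⟨-(H1.incl ∘L (T.symm : H1 →L[ℂ] H1) ∘L H1.incl.adjoint), fun h => ?_, fun w => ?_⟩
  · obtain ⟨w, hw, hw'⟩ := hsol h
    exact ⟨w, by rw [hw, map_neg]; rfl, hw'⟩
  · obtain ⟨w', hw', hw''⟩ := hsol (ellipticMap c A w)
    have hd : ellipticMap c A (w - w') = 0 := by rw [map_sub, hw'', sub_self]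
    have hz : ((w - w' : H2) : L2) = 0 := by
      set d := w - w'
      have h1 := hA _ _ (isWeakDeriv_D1 d)
      have h2 : inner ℂ (d : L2) (D2 d + (c : ℂ) • D1 d + A d) = 0 := by
        rw [← ellipticMap_apply, hd, inner_zero_right]
      rw [inner_add_right, inner_add_right, inner_smul_right,
        (isWeakDeriv_D1 d).inner_eq_neg (isWeakDeriv_D2 d)] at h2
      have h3 := congrArg Complex.re h2
      rw [Complex.add_re, Complex.add_re, Complex.re_ofReal_mul,
        (isWeakDeriv_D1 d).re_inner_eq_zero, Complex.neg_re, inner_self_eq_norm_sq_to_K,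
        mul_zero, add_zero, Complex.zero_re] at h3
      have h4 : (((‖D1 d‖ : ℝ) : ℂ) ^ 2).re = ‖D1 d‖ ^ 2 := by norm_cast
      have h5 : δ * (‖(d : L2)‖ ^ 2 + ‖D1 d‖ ^ 2) ≤ 0 := by
        refine h1.trans ?_
        change -(((‖D1 d‖ : ℝ) : ℂ) ^ 2).re + _ = 0 at h3
        rw [h4] at h3
        linarith
      have h6 : ‖(d : L2)‖ ^ 2 ≤ 0 := by nlinarith [sq_nonneg ‖(d : L2)‖, sq_nonneg ‖D1 d‖]
      exact norm_eq_zero.1 (pow_eq_zero_iff two_ne_zero |>.1 (le_antisymm h6 (sq_nonneg _)))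
    have : (w : L2) = w' := by
      rw [← sub_eq_zero]; exact hz
    rw [this, hw', map_neg]
    rfl

/-! ### Coercivity up to a finite-rank operator -/

lemma memLp_norm_sq {f : ℝ → ℂ} (hf : MemLp f 2 volume) : Integrable (fun x => ‖f x‖ ^ 2) :=
  (memLp_two_iff_integrable_sq_norm hf.1).1 hf

lemma L2.norm_sq_eq (u : L2) : ‖u‖ ^ 2 = ∫ x, ‖u x‖ ^ 2 := by
  have h1 := inner_self_eq_norm_sq_to_K (𝕜 := ℂ) u
  have h2 : ∫ x, (starRingEnd ℂ) (u x) * u x = ((∫ x, ‖u x‖ ^ 2 : ℝ) : ℂ) := by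
    rw [← integral_complex_ofReal]
    refine integral_congr_ae (Eventually.of_forall fun x => ?_)
    dsimp only
    rw [Complex.conj_mul']
    norm_cast
  rw [L2.inner_eq, h2] at h1
  have h3 : ((∫ x, ‖u x‖ ^ 2 : ℝ) : ℂ) = ((‖u‖ ^ 2 : ℝ) : ℂ) := by
    rw [h1, Complex.ofReal_pow]; rfl
  exact (Complex.ofReal_injective h3).symm

/-- The Cauchy-Schwarz inequality for the integral over an interval. -/
lemma sq_setIntegral_Ioc_le {g : ℝ → ℝ} {a h : ℝ} (hh : 0 < h) (h1 : IntegrableOn g (Ioc a (a + h)))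
    (h2 : IntegrableOn (fun x => g x ^ 2) (Ioc a (a + h))) :
    (∫ x in Ioc a (a + h), g x) ^ 2 ≤ h * ∫ x in Ioc a (a + h), g x ^ 2 := by
  set J := ∫ x in Ioc a (a + h), g x
  -- Nonnegativity of the variance about the mean `J / h`.
  have h0 : 0 ≤ ∫ x in Ioc a (a + h), (g x - J / h) ^ 2 := integral_nonneg fun x => sq_nonneg _
  have e : (fun x => (g x - J / h) ^ 2) = fun x => g x ^ 2 - (2 * J / h) * g x + (J / h) ^ 2 := by
    funext x; ring
  have hc : IntegrableOn (fun _ : ℝ => (J / h) ^ 2) (Ioc a (a + h)) := by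
    simp
  have hs : IntegrableOn (fun x => g x ^ 2 - 2 * J / h * g x) (Ioc a (a + h)) :=
    h2.sub (h1.const_mul _)
  rw [e, integral_add hs hc, integral_sub h2 (h1.const_mul _),
    integral_const_mul, setIntegral_const, Real.volume_real_Ioc_of_le (by linarith)] at h0
  simp only [smul_eq_mul] at h0
  change 0 ≤ _ - 2 * J / h * J + _ at h0
  have h3 : (∫ x in Ioc a (a + h), g x ^ 2) - 2 * J / h * J + (a + h - a) * (J / h) ^ 2 =
      (∫ x in Ioc a (a + h), g x ^ 2) - J ^ 2 / h := by
    field_simp; ring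
  rw [h3, sub_nonneg, div_le_iff₀ hh] at h0
  linarith

/-- A finite-rank operator controlling the `L²` norm on a short interval, up to the derivative. -/
lemma exists_finiteRank_short (a : ℝ) {h : ℝ} (hh : 0 < h) :
    ∃ F : L2 →L[ℂ] L2, FiniteDimensional ℂ F.range ∧ ∀ u v, IsWeakDeriv u v →
      ∫ x in Ioc a (a + h), ‖u x‖ ^ 2 ≤
        (inner ℂ u (F u)).re + 2 * h ^ 2 * ∫ x in Ioc a (a + h), ‖v x‖ ^ 2 := by
  set I := Ioc a (a + h)
  have hfin : volume I ≠ ⊤ := measure_Ioc_lt_top.ne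
  have hvol : volume.real I = h := by
    rw [Real.volume_real_Ioc_of_le (by linarith)]; ring
  set χ : L2 := indicatorConstLp 2 measurableSet_Ioc hfin (1 : ℂ)
  have hχ : ∀ u : L2, inner ℂ χ u = ∫ x in I, u x := fun u =>
    L2.inner_indicatorConstLp_one measurableSet_Ioc hfin u
  -- The quadratic form of `F` is `(2 / h) |∫ u|²` over the cell: a Poincaré inequality with the
  -- mean kept. The factor `2` comes from `(a + b)² ≤ 2 (a² + b²)`.
  set F : L2 →L[ℂ] L2 := ((2 / h : ℝ) : ℂ) • (innerSL ℂ χ).smulRight χ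
  have hF : ∀ u, F u = ((2 / h : ℝ) : ℂ) • (inner ℂ χ u : ℂ) • χ := fun u => rfl
  refine ⟨F, ?_, fun u v huv => ?_⟩
  · have hle : F.range ≤ Submodule.span ℂ {χ} := by
      rintro _ ⟨u, rfl⟩
      rw [Submodule.mem_span_singleton]
      exact ⟨((2 / h : ℝ) : ℂ) * inner ℂ χ u, by rw [mul_smul]; rfl⟩
    exact Submodule.finiteDimensional_of_le hle
  · obtain ⟨U, hU, hU'⟩ := huv.exists_isPrimitive
    have hre : (inner ℂ u (F u)).re = 2 / h * ‖∫ x in I, u x‖ ^ 2 := by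
      rw [hF, inner_smul_right, inner_smul_right, ← inner_conj_symm u χ, hχ, Complex.mul_conj',
        ← Complex.ofReal_pow, ← Complex.ofReal_mul, Complex.ofReal_re]
    have iu : IntegrableOn u I := (L2.locallyIntegrable u).integrableOn_isCompact isCompact_Icc
      |>.mono_set Ioc_subset_Icc_self
    have iv : IntegrableOn v I := (L2.locallyIntegrable v).integrableOn_isCompact isCompact_Icc
      |>.mono_set Ioc_subset_Icc_self
    have iv2 : IntegrableOn (fun x => ‖v x‖ ^ 2) I := (memLp_norm_sq (Lp.memLp v)).integrableOn
    have iU : IntegrableOn U I := hU.continuous.integrableOn_Ioc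
    set J := ∫ x in I, ‖v x‖
    have hJ : J ^ 2 ≤ h * ∫ x in I, ‖v x‖ ^ 2 := sq_setIntegral_Ioc_le hh iv.norm iv2
    -- The oscillation over the cell is at most the `L¹` norm of the derivative, so each value
    -- differs from the mean by at most `J`.
    have hosc : ∀ x ∈ I, ∀ y ∈ I, ‖U x - U y‖ ≤ J := fun x hx y hy => by
      rw [hU.2 y x]
      refine intervalIntegral.norm_integral_le_integral_norm_uIoc.trans ?_
      refine setIntegral_mono_set iv.norm (Eventually.of_forall fun t => norm_nonneg _)
        (LE.le.eventuallyLE fun t ht => ?_)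
      rw [uIoc, mem_Ioc] at ht
      exact ⟨(le_min hy.1.le hx.1.le).trans_lt ht.1, ht.2.trans (max_le hy.2 hx.2)⟩
    have hm : ∀ x ∈ I, h * ‖U x‖ ≤ ‖∫ y in I, u y‖ + h * J := fun x hx => by
      have e1 : (∫ y in I, (U x - U y)) = (h : ℂ) * U x - ∫ y in I, u y := by
        have ic : IntegrableOn (fun _ : ℝ => U x) I := by simp [I]
        rw [integral_sub ic iU, setIntegral_const, hvol, Complex.real_smul]
        congr 1
        exact integral_congr_ae (ae_restrict_of_ae (hU'.mono fun t ht => ht.symm))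
      have e2 : ‖∫ y in I, (U x - U y)‖ ≤ J * volume.real I :=
        norm_setIntegral_le_of_norm_le_const hfin.lt_top fun y hy => hosc x hx y hy
      have e3 : (h : ℂ) * U x = (∫ y in I, (U x - U y)) + ∫ y in I, u y := by rw [e1]; ring
      have e4 : h * ‖U x‖ = ‖(h : ℂ) * U x‖ := by
        rw [norm_mul, Complex.norm_real, Real.norm_of_nonneg hh.le]
      rw [e4, e3]
      refine (norm_add_le _ _).trans ?_
      rw [hvol] at e2
      linarith
    set m := ‖∫ y in I, u y‖
    have hb : ∀ᵐ x ∂(volume.restrict I), ‖u x‖ ^ 2 ≤ 2 * (m ^ 2 / h ^ 2 + J ^ 2) := by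
      filter_upwards [ae_restrict_of_ae hU', ae_restrict_mem measurableSet_Ioc] with x h1 h2
      rw [h1]
      have h3 := hm x h2
      have h4 : ‖U x‖ ≤ m / h + J := by
        rw [div_add' _ _ _ hh.ne', le_div_iff₀ hh]; linarith
      calc ‖U x‖ ^ 2 ≤ (m / h + J) ^ 2 := pow_le_pow_left₀ (norm_nonneg _) h4 2
        _ ≤ 2 * ((m / h) ^ 2 + J ^ 2) := by nlinarith [sq_nonneg (m / h - J)]
        _ = _ := by rw [div_pow]
    have h5 : ∫ x in I, ‖u x‖ ^ 2 ≤ ∫ x in I, 2 * (m ^ 2 / h ^ 2 + J ^ 2) :=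
      integral_mono_ae (memLp_norm_sq (Lp.memLp u)).integrableOn
        (integrableOn_const (μ := volume) hfin) hb
    rw [setIntegral_const, hvol, smul_eq_mul] at h5
    rw [hre]
    refine h5.trans ?_
    have h6 : h * (2 * (m ^ 2 / h ^ 2 + J ^ 2)) = 2 / h * m ^ 2 + 2 * h * J ^ 2 := by
      field_simp
    rw [h6]
    nlinarith

lemma finiteDimensional_range_add {F G : L2 →L[ℂ] L2} (hF : FiniteDimensional ℂ F.range)
    (hG : FiniteDimensional ℂ G.range) : FiniteDimensional ℂ (F + G).range := by
  have hle : (F + G).range ≤ F.range ⊔ G.range := by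
    rintro _ ⟨u, rfl⟩
    exact Submodule.add_mem_sup ⟨u, rfl⟩ ⟨u, rfl⟩
  exact Submodule.finiteDimensional_of_le hle

lemma finiteDimensional_range_smul {F : L2 →L[ℂ] L2} (hF : FiniteDimensional ℂ F.range) (k : ℂ) :
    FiniteDimensional ℂ (k • F).range := by
  have hle : (k • F).range ≤ F.range := by
    rintro _ ⟨u, rfl⟩
    exact F.range.smul_mem k ⟨u, rfl⟩
  exact Submodule.finiteDimensional_of_le hle

/-- A finite-rank operator controlling the `L²` norm on a bounded interval, up to the derivative. -/
lemma exists_finiteRank (R : ℝ) (hR : 0 < R) {ε : ℝ} (hε : 0 < ε) :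
    ∃ F : L2 →L[ℂ] L2, FiniteDimensional ℂ F.range ∧ ∀ u v, IsWeakDeriv u v →
      ∫ x in Ioc (-R) R, ‖u x‖ ^ 2 ≤ (inner ℂ u (F u)).re + ε * ‖v‖ ^ 2 := by
  -- With `n` cells of length `h = 2R/n`, the error constant is `2h² = 8R²/n²`; having `n > 1`
  -- allows `n² ≥ n`, so `n > 8R²/ε` suffices.
  obtain ⟨n, hn⟩ := exists_nat_gt (max 1 (8 * R ^ 2 / ε))
  have hn1 : (1 : ℝ) < n := (le_max_left _ _).trans_lt hn
  have hn2 : 8 * R ^ 2 / ε < n := (le_max_right _ _).trans_lt hn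
  have hn0 : (0 : ℝ) < n := by linarith
  set h : ℝ := 2 * R / n
  have hh : 0 < h := by positivity
  have hhε : 2 * h ^ 2 ≤ ε := by
    rw [div_lt_iff₀ hε] at hn2
    have : 2 * h ^ 2 = 8 * R ^ 2 / n ^ 2 := by simp only [h]; field_simp; ring
    rw [this, div_le_iff₀ (by positivity)]
    nlinarith
  have key : ∀ k : ℕ, ∃ F : L2 →L[ℂ] L2, FiniteDimensional ℂ F.range ∧ ∀ u v, IsWeakDeriv u v →
      ∫ x in Ioc (-R) (-R + k * h), ‖u x‖ ^ 2 ≤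
        (inner ℂ u (F u)).re + 2 * h ^ 2 * ∫ x in Ioc (-R) (-R + k * h), ‖v x‖ ^ 2 := by
    intro k
    induction k with
    | zero =>
      refine ⟨0, ?_, fun u v _ => by simp⟩
      have : (0 : L2 →L[ℂ] L2).range = ⊥ := LinearMap.range_zero
      rw [this]
      infer_instance
    | succ k ih =>
      obtain ⟨F, hF, hF'⟩ := ih
      obtain ⟨G, hG, hG'⟩ := exists_finiteRank_short (-R + k * h) hh
      refine ⟨F + G, finiteDimensional_range_add hF hG, fun u v huv => ?_⟩
      have e : -R + ((k + 1 : ℕ) : ℝ) * h = -R + k * h + h := by push_cast; ring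
      have hk : -R ≤ -R + k * h := by
        have : 0 ≤ k * h := by positivity
        linarith
      have split : ∀ w : L2, ∫ x in Ioc (-R) (-R + k * h + h), ‖w x‖ ^ 2 =
          (∫ x in Ioc (-R) (-R + k * h), ‖w x‖ ^ 2) +
            ∫ x in Ioc (-R + k * h) (-R + k * h + h), ‖w x‖ ^ 2 := fun w => by
        have hi := memLp_norm_sq (Lp.memLp w)
        rw [← setIntegral_union (Ioc_disjoint_Ioc_of_le le_rfl) measurableSet_Ioc
          hi.integrableOn hi.integrableOn, Ioc_union_Ioc_eq_Ioc hk (by linarith)]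
      rw [e, split, split, _root_.add_apply, inner_add_right, Complex.add_re]
      linarith [hF' u v huv, hG' u v huv]
  obtain ⟨F, hF, hF'⟩ := key n
  have e : -R + n * h = R := by simp only [h]; field_simp; ring
  rw [e] at hF'
  refine ⟨F, hF, fun u v huv => (hF' u v huv).trans ?_⟩
  have hv : ∫ x in Ioc (-R) R, ‖v x‖ ^ 2 ≤ ‖v‖ ^ 2 := by
    rw [L2.norm_sq_eq]
    exact setIntegral_le_integral (memLp_norm_sq (Lp.memLp v))
      (Eventually.of_forall fun x => sq_nonneg _)
  have hv0 : 0 ≤ ‖v‖ ^ 2 := sq_nonneg _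
  nlinarith

lemma re_inner_mul {Q : L2 →L[ℂ] L2} {q : ℝ → ℝ} (hQ : ∀ u, ∀ᵐ x, Q u x = q x * u x) (u : L2) :
    (inner ℂ u (Q u)).re = ∫ x, q x * ‖u x‖ ^ 2 := by
  have : inner ℂ u (Q u) = ((∫ x, q x * ‖u x‖ ^ 2 : ℝ) : ℂ) := by
    rw [L2.inner_eq, ← integral_complex_ofReal]
    refine integral_congr_ae ?_
    filter_upwards [hQ u] with x hx
    rw [hx, mul_left_comm, Complex.conj_mul']
    norm_cast
  rw [this, Complex.ofReal_re]

/-- Up to a finite-rank operator, `w'' + c w' + (q - z) w` is boundedly invertible when `q - Re z` is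
negative near infinity. -/
lemma exists_finiteRank_isBoundedInverse (c : ℝ) {Q : L2 →L[ℂ] L2} {q : ℝ → ℝ}
    (hq : Continuous q) {M : ℝ} (hM : ∀ x, |q x| ≤ M) (hQ : ∀ u, ∀ᵐ x, Q u x = q x * u x) (z : ℂ)
    {R δ : ℝ} (hδ : 0 < δ) (hfar : ∀ x, R ≤ |x| → q x ≤ z.re - δ) :
    ∃ F : L2 →L[ℂ] L2, FiniteDimensional ℂ F.range ∧
      ∃ B, IsBoundedInverse (ellipticMap c (Q - z • ContinuousLinearMap.id ℂ L2 - F)) B := by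
  -- `K` is large enough that `q ≤ Re z - δ + K` everywhere; outside the bounded interval the bound
  -- already holds without `K`.
  set K : ℝ := |M| + |z.re| + δ
  have hK : 0 < K := by positivity
  -- With `ε = 1/(2K)`, absorbing `K` times the local mass costs only half of `‖v‖²`. The other half
  -- accounts for the `1/2` in the coercivity constant.
  obtain ⟨F, hF, hF'⟩ := exists_finiteRank (|R| + 1) (by positivity) (ε := 1 / (2 * K))
    (by positivity)
  refine ⟨(K : ℂ) • F, finiteDimensional_range_smul hF _,
    exists_isBoundedInverse_of_coercive c _ (δ := min δ (1 / 2)) (by positivity) ?_⟩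
  intro u v huv
  have hre : (inner ℂ u ((Q - z • ContinuousLinearMap.id ℂ L2 - (K : ℂ) • F) u)).re =
      (∫ x, q x * ‖u x‖ ^ 2) - z.re * ‖u‖ ^ 2 - K * (inner ℂ u (F u)).re := by
    have e : (Q - z • ContinuousLinearMap.id ℂ L2 - (K : ℂ) • F) u =
      Q u - z • u - (K : ℂ) • F u := rfl
    rw [e, inner_sub_right, inner_sub_right, inner_smul_right, inner_smul_right, Complex.sub_re,
      Complex.sub_re, re_inner_mul hQ, Complex.re_ofReal_mul, inner_self_eq_norm_sq_to_K]
    congr 2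
    have : (((‖u‖ : ℝ) : ℂ) ^ 2) = ((‖u‖ ^ 2 : ℝ) : ℂ) := by norm_cast
    change (z * (((‖u‖ : ℝ) : ℂ) ^ 2)).re = _
    rw [this, Complex.re_mul_ofReal]
  have iu := memLp_norm_sq (Lp.memLp u)
  have iq : Integrable (fun x => q x * ‖u x‖ ^ 2) :=
    iu.bdd_mul hq.aestronglyMeasurable (Eventually.of_forall hM)
  have hI : (∫ x, q x * ‖u x‖ ^ 2) ≤ (z.re - δ) * ‖u‖ ^ 2 +
      K * ∫ x in Ioc (-(|R| + 1)) (|R| + 1), ‖u x‖ ^ 2 := by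
    rw [L2.norm_sq_eq, ← integral_const_mul, ← integral_const_mul,
      ← integral_indicator measurableSet_Ioc,
      ← integral_add (iu.const_mul _) ((iu.const_mul K).indicator measurableSet_Ioc)]
    refine integral_mono iq ((iu.const_mul _).add ((iu.const_mul K).indicator measurableSet_Ioc))
      fun x => ?_
    have h0 := sq_nonneg ‖u x‖
    dsimp only [Pi.add_apply]
    by_cases hx : x ∈ Ioc (-(|R| + 1)) (|R| + 1)
    · rw [indicator_of_mem hx]
      have h1 := (le_abs_self _).trans (hM x)
      have h2 := le_abs_self M
      have h3 := neg_abs_le z.re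
      have : q x ≤ z.re - δ + K := by simp only [K]; linarith
      nlinarith
    · rw [indicator_of_notMem hx, add_zero]
      refine mul_le_mul_of_nonneg_right (hfar x ?_) h0
      by_contra hlt
      rw [not_le] at hlt
      have h4 := abs_lt.1 (hlt.trans_le (le_abs_self R))
      exact hx ⟨by linarith [h4.1], by linarith [h4.2]⟩
  rw [hre]
  have h1 := hF' u v huv
  have h2 : K * (1 / (2 * K) * ‖v‖ ^ 2) = ‖v‖ ^ 2 / 2 := by field_simp
  have h3 := mul_le_mul_of_nonneg_left h1 hK.le
  rw [mul_add, h2] at h3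
  have h4 : min δ (1 / 2) * ‖u‖ ^ 2 ≤ δ * ‖u‖ ^ 2 :=
    mul_le_mul_of_nonneg_right (min_le_left _ _) (sq_nonneg _)
  have h5 : min δ (1 / 2) * ‖v‖ ^ 2 ≤ 1 / 2 * ‖v‖ ^ 2 :=
    mul_le_mul_of_nonneg_right (min_le_right _ _) (sq_nonneg _)
  linarith

/-! ### Finite-rank perturbations of invertible operators with domain `H²(ℝ)` -/

/-- The unbounded operator in `L²(ℝ)` with domain `H²(ℝ)` given by a linear map. -/
def opOf (S : H2 →ₗ[ℂ] L2) : L2 →ₗ.[ℂ] L2 where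
  domain := H2
  toFun := S

/-- The operator `S - z`. -/
def shift (S : H2 →ₗ[ℂ] L2) (z : ℂ) : H2 →ₗ[ℂ] L2 := S - z • H2.subtype

lemma shift_apply (S : H2 →ₗ[ℂ] L2) (z : ℂ) (w : H2) : shift S z w = S w - z • (w : L2) := rfl

/-- The perturbation of `S` by a bounded operator. -/
def perturb (S : H2 →ₗ[ℂ] L2) (F : L2 →L[ℂ] L2) : H2 →ₗ[ℂ] L2 := S + (F : L2 →ₗ[ℂ] L2) ∘ₗ H2.subtype

lemma perturb_apply (S : H2 →ₗ[ℂ] L2) (F : L2 →L[ℂ] L2) (w : H2) : perturb S F w = S w + F w := rfl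

lemma mem_resolventSet_iff (S : H2 →ₗ[ℂ] L2) (z : ℂ) :
    z ∈ resolventSet (opOf S) ↔ ∃ B, IsBoundedInverse (shift S z) B := Iff.rfl

/-- `S` is a finite-rank perturbation of a boundedly invertible operator. -/
def HasParametrix (S : H2 →ₗ[ℂ] L2) : Prop :=
  ∃ F : L2 →L[ℂ] L2, FiniteDimensional ℂ F.range ∧ ∃ B, IsBoundedInverse (perturb S (-F)) B

lemma HasParametrix.perturb {S : H2 →ₗ[ℂ] L2} (h : HasParametrix S) {G : L2 →L[ℂ] L2}
    (hG : FiniteDimensional ℂ G.range) : HasParametrix (perturb S G) := by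
  obtain ⟨F, hF, B, hB⟩ := h
  refine ⟨F + G, finiteDimensional_range_add hF hG, B, ?_⟩
  have e : TravellingWave.perturb (TravellingWave.perturb S G) (-(F + G)) =
      TravellingWave.perturb S (-F) := by
    ext1 w
    simp only [perturb_apply, _root_.neg_apply, _root_.add_apply]
    abel
  rwa [e]

/-- An injective operator of the form identity plus finite rank is surjective. -/
lemma surjective_id_add_finiteRank (G : L2 →L[ℂ] L2) (hG : FiniteDimensional ℂ G.range)
    (hinj : ∀ x, x + G x = 0 → x = 0) (h : L2) : ∃ x, x + G x = h := by
  set V := G.range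
  let T : V →ₗ[ℂ] V := LinearMap.id + (G : L2 →ₗ[ℂ] L2).rangeRestrict ∘ₗ V.subtype
  have hT : ∀ v : V, ((T v : V) : L2) = v + G v := fun v => rfl
  have hTinj : Function.Injective T := by
    rw [← LinearMap.ker_eq_bot, LinearMap.ker_eq_bot']
    intro v hv
    refine Subtype.ext (hinj v ?_)
    rw [← hT, hv]; rfl
  obtain ⟨y, hy⟩ := LinearMap.injective_iff_surjective.1 hTinj ⟨G h, ⟨h, rfl⟩⟩
  have hy' : (y : L2) + G y = G h := by rw [← hT, hy]
  -- On the finite-dimensional range, injectivity gives a solution of `y + G y = G h`; then `h - y`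
  -- solves the full equation.
  refine ⟨h - y, ?_⟩
  rw [map_sub, ← hy']; abel

/-- On the range of `B`, `S` acts as `1 + F B`. Questions about `S` thereby reduce to a bounded
identity-plus-finite-rank operator. -/
lemma IsBoundedInverse.right {S : H2 →ₗ[ℂ] L2} {F B : L2 →L[ℂ] L2}
    (hB : IsBoundedInverse (perturb S (-F)) B) (h : L2) :
    ∃ w : H2, (w : L2) = B h ∧ S w = h + F (B h) := by
  obtain ⟨w, hw, hw'⟩ := hB.1 h
  refine ⟨w, hw, ?_⟩
  rw [perturb_apply, _root_.neg_apply] at hw'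
  rw [← hw, ← hw']; abel

/-- The Fredholm alternative. -/
lemma HasParametrix.exists_isBoundedInverse {S : H2 →ₗ[ℂ] L2} (h : HasParametrix S)
    (hinj : ∀ w : H2, S w = 0 → (w : L2) = 0) : ∃ B, IsBoundedInverse S B := by
  obtain ⟨F, hF, B, hB⟩ := h
  have hFB : FiniteDimensional ℂ (F ∘L B).range := by
    have hle : (F ∘L B).range ≤ F.range := by
      rintro _ ⟨u, rfl⟩
      exact ⟨B u, rfl⟩
    exact Submodule.finiteDimensional_of_le hle
  set G : L2 →L[ℂ] L2 := ContinuousLinearMap.id ℂ L2 + F ∘L B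
  have hG : ∀ x, G x = x + F (B x) := fun x => rfl
  have hGinj : ∀ x, x + (F ∘L B) x = 0 → x = 0 := fun x hx => by
    obtain ⟨w, hw, hw'⟩ := hB.right x
    have h0 : S w = 0 := hw'.trans hx
    have hw0 := hinj w h0
    have hBx : B x = 0 := by rw [← hw, hw0]
    have : x + F (B x) = 0 := hx
    rwa [hBx, map_zero, add_zero] at this
  have hker : G.ker = ⊥ := LinearMap.ker_eq_bot'.2 hGinj
  have hran : G.range = ⊤ :=
    LinearMap.range_eq_top.2 fun y => surjective_id_add_finiteRank (F ∘L B) hFB hGinj y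
  set T := ContinuousLinearEquiv.ofBijective G hker hran
  have hT : ∀ x, G (T.symm x) = x := fun x => T.apply_symm_apply x
  have hsol : ∀ y, ∃ w : H2, (w : L2) = (B ∘L (T.symm : L2 →L[ℂ] L2)) y ∧ S w = y := fun y => by
    obtain ⟨w, hw, hw'⟩ := hB.right (T.symm y)
    exact ⟨w, hw, by rw [hw', ← hG, hT]⟩
  refine ⟨_, hsol, fun w => ?_⟩
  obtain ⟨w', hw, hw'⟩ := hsol (S w)
  have h0 := hinj (w' - w) (by rw [map_sub, hw', sub_self])
  rw [← hw]
  exact sub_eq_zero.1 h0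

/-- The range is that of `1 + F B`, which is the identity on the closed, finite-codimensional kernel
of `F B`. -/
lemma HasParametrix.isClosed_range {S : H2 →ₗ[ℂ] L2} (h : HasParametrix S) :
    IsClosed (Set.range S) := by
  obtain ⟨F, hF, B, hB⟩ := h
  set N : L2 →ₗ[ℂ] L2 := (F ∘L B).toLinearMap
  have hFB : FiniteDimensional ℂ N.range := by
    have hle : N.range ≤ F.range := by
      rintro _ ⟨u, rfl⟩
      exact ⟨B u, rfl⟩
    exact Submodule.finiteDimensional_of_le hle
  set G : L2 →ₗ[ℂ] L2 := LinearMap.id + N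
  have hG : ∀ x, G x = x + F (B x) := fun x => rfl
  have e : Set.range S = (G.range : Set L2) := by
    ext y
    constructor
    · rintro ⟨w, rfl⟩
      refine ⟨TravellingWave.perturb S (-F) w, ?_⟩
      rw [hG, hB.2, perturb_apply, _root_.neg_apply]; abel
    · rintro ⟨x, rfl⟩
      obtain ⟨w, -, hw⟩ := hB.right x
      exact ⟨w, hw⟩
  rw [e]
  have : FiniteDimensional ℂ (L2 ⧸ N.ker) := Module.Finite.equiv N.quotKerEquivRange.symm
  have : N.ker.CoFG := this
  refine LinearMap.isClosed_range_of_isClosed_map_of_finiteDimensional_quotient (s := N.ker) ?_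
  have hmap : N.ker.map G = N.ker := by
    have hid : ∀ x ∈ N.ker, G x = x := fun x hx => by
      have : N x = 0 := hx
      simp [G, this]
    ext x
    constructor
    · rintro ⟨y, hy, rfl⟩
      rw [hid y hy]; exact hy
    · intro hx
      exact ⟨x, hx, hid x hx⟩
  rw [hmap]
  exact (F ∘L B).isClosed_ker

/-- The kernel of an operator with domain `H²(ℝ)`, as a subspace of `L²(ℝ)`. -/
def kerL2 (S : H2 →ₗ[ℂ] L2) : Submodule ℂ L2 := S.ker.map H2.subtype

lemma mem_kerL2 {S : H2 →ₗ[ℂ] L2} {x : L2} : x ∈ kerL2 S ↔ ∃ w : H2, S w = 0 ∧ (w : L2) = x :=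
  Iff.rfl

lemma coe_mem_kerL2 {S : H2 →ₗ[ℂ] L2} {w : H2} : (w : L2) ∈ kerL2 S ↔ S w = 0 :=
  ⟨fun ⟨w', h, e⟩ => by rwa [← Subtype.ext (show (w' : L2) = w from e)], fun h => ⟨w, h, rfl⟩⟩

/-- A null vector satisfies `w = -B (F w)`, so the kernel sits inside the `B`-image of the
finite-dimensional range of `F`. -/
lemma HasParametrix.finiteDimensional_kerL2 {S : H2 →ₗ[ℂ] L2} (h : HasParametrix S) :
    FiniteDimensional ℂ (kerL2 S) := by
  obtain ⟨F, hF, B, hB⟩ := h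
  have hle : kerL2 S ≤ F.range.map (B : L2 →ₗ[ℂ] L2) := by
    rintro _ ⟨w, hw, rfl⟩
    refine ⟨-F w, F.range.neg_mem ⟨w, rfl⟩, ?_⟩
    have h0 : S w = 0 := hw
    have h1 := hB.2 w
    rw [perturb_apply, h0, zero_add] at h1
    exact h1
  exact Submodule.finiteDimensional_of_le hle

/-- A semisimple eigenvalue of an operator with a parametrix is isolated among the eigenvalues. -/
lemma exists_isolated {S : H2 →ₗ[ℂ] L2} {z₀ : ℂ} (h : HasParametrix (shift S z₀))
    (hss : ∀ w : H2, shift S z₀ w ∈ kerL2 (shift S z₀) → shift S z₀ w = 0) :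
    ∃ r > 0, ∀ z, ‖z - z₀‖ < r → z ≠ z₀ → ∀ w : H2, shift S z w = 0 → (w : L2) = 0 := by
  set K := kerL2 (shift S z₀)
  have hK : FiniteDimensional ℂ K := h.finiteDimensional_kerL2
  set P : L2 →L[ℂ] L2 := K.starProjection
  have hP : ∀ x, P x ∈ K := fun x => K.starProjection_apply_mem x
  have hPK : ∀ x ∈ K, P x = x := fun x hx => Submodule.starProjection_eq_self_iff.2 hx
  have hPfin : FiniteDimensional ℂ P.range := by
    have hle : P.range ≤ K := by
      rintro _ ⟨u, rfl⟩
      exact hP u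
    exact Submodule.finiteDimensional_of_le hle
  -- If `(S - z₀) w = -P w`, the right side is in the kernel, so semisimplicity makes both sides
  -- vanish; then `w` lies in the kernel and equals `P w = 0`. Thus adding the projection `P` onto
  -- the kernel makes the operator invertible.
  obtain ⟨B, hB⟩ := (h.perturb hPfin).exists_isBoundedInverse (fun w hw => by
    rw [perturb_apply] at hw
    have h1 : shift S z₀ w = -P w := eq_neg_of_add_eq_zero_left hw
    have h2 := hss w (by rw [h1]; exact K.neg_mem (hP _))
    rw [h2, zero_add] at hw
    rwa [hPK w (coe_mem_kerL2.2 h2)] at hw)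
  have hBK : ∀ x ∈ K, B x = x := by
    rintro x ⟨w, hw, rfl⟩
    have h1 := hB.2 w
    have h0 : shift S z₀ w = 0 := hw
    rw [perturb_apply, h0, zero_add, hPK w (coe_mem_kerL2.2 h0)] at h1
    exact h1
  refine ⟨(‖B‖ + 1)⁻¹, by positivity, fun z hz hne w hw => ?_⟩
  set ε := z - z₀
  have hB1 : 0 < ‖B‖ + 1 := by positivity
  have hε : ‖ε‖ * (‖B‖ + 1) < 1 := by
    rwa [lt_inv_comm₀ (by exact norm_pos_iff.2 (sub_ne_zero.2 hne)) hB1, lt_inv_comm₀ hB1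
      (by exact norm_pos_iff.2 (sub_ne_zero.2 hne)), ← one_div, lt_div_iff₀ hB1] at hz
  have hε1 : ‖ε‖ < 1 := by nlinarith [norm_nonneg ε, norm_nonneg B]
  have hε1' : 1 - ε ≠ 0 := fun h0 => by
    have : ε = 1 := (sub_eq_zero.1 h0).symm
    rw [this] at hε1
    simp at hε1
  have e1 : perturb (shift S z₀) P w = ε • (w : L2) + P w := by
    rw [perturb_apply, shift_apply]
    rw [shift_apply, sub_eq_zero] at hw
    rw [hw, ← sub_smul]
  have e2 : (w : L2) = ε • B w + P w := by
    have h1 := hB.2 w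
    rw [e1, map_add, map_smul, hBK _ (hP _)] at h1
    exact h1.symm
  -- From `w = ε B w + P w` and `B = 1` on the kernel, this choice of `y` satisfies the homogeneous
  -- equation `y = ε B y`. As `‖ε‖ ‖B‖ < 1`, it vanishes and `w` belongs to the kernel.
  set y : L2 := (w : L2) - (1 - ε)⁻¹ • P w
  have e3 : y = ε • B y := by
    have h1 : B y = B w - (1 - ε)⁻¹ • P w := by
      rw [map_sub, map_smul, hBK _ (hP _)]
    have h3 : ε • B w = w - P w := eq_sub_of_add_eq e2.symm
    rw [h1, smul_sub, h3, sub_sub, smul_smul]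
    have h2 : P w + (ε * (1 - ε)⁻¹) • P w = (1 - ε)⁻¹ • P w := by
      rw [← one_smul ℂ (P w), smul_smul, smul_smul, ← add_smul]
      congr 1
      field_simp
      ring
    rw [h2]
  have hy : y = 0 := by
    have h1 : ‖y‖ ≤ ‖ε‖ * (‖B‖ * ‖y‖) := by
      conv_lhs => rw [e3]
      rw [norm_smul]
      exact mul_le_mul_of_nonneg_left (B.le_opNorm y) (norm_nonneg _)
    by_contra hne
    have h2 : 0 < ‖y‖ := norm_pos_iff.2 hne
    nlinarith [norm_nonneg ε]
  have hwK : (w : L2) ∈ K := by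
    rw [sub_eq_zero.1 hy]
    exact K.smul_mem _ (hP _)
  have h0 := coe_mem_kerL2.1 hwK
  rw [shift_apply] at h0 hw
  have h1 : ε • (w : L2) = 0 := by
    rw [sub_smul]
    rw [sub_eq_zero] at h0 hw
    rw [← hw, ← h0, sub_self]
  exact (smul_eq_zero.1 h1).resolve_left (sub_ne_zero.2 hne)

/-! ### Spectrum under rank-one perturbations along a null vector. -/

lemma mem_spectrum_of_eigenvector {S : H2 →ₗ[ℂ] L2} {z : ℂ} {e : H2} (he : (e : L2) ≠ 0)
    (h : shift S z e = 0) : z ∈ spectrum (opOf S) := by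
  rintro ⟨R, -, hR⟩
  have h1 : R (shift S z e) = e := hR e
  rw [h, map_zero] at h1
  exact he h1.symm

/-- Rank-one perturbations in the direction of a null vector do not change the resolvent set. -/
lemma mem_resolventSet_of_rankOne {S S' : H2 →ₗ[ℂ] L2} {ρ : L2 →L[ℂ] ℂ} {e : H2}
    (hS : ∀ w : H2, S' w = S w + ρ w • (e : L2)) (he : S e = 0) (hρ : ρ e = 0) {z : ℂ} (hz : z ≠ 0)
    (h : z ∈ resolventSet (opOf S)) : z ∈ resolventSet (opOf S') := by
  rw [mem_resolventSet_iff] at h ⊢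
  obtain ⟨R, hR1, hR2⟩ := h
  have hRe : R e = -z⁻¹ • (e : L2) := by
    have h1 := hR2 e
    rw [shift_apply, he, zero_sub, map_neg, map_smul] at h1
    calc R e = (-z⁻¹ * -z) • R e := by rw [neg_mul_neg, inv_mul_cancel₀ hz, one_smul]
      _ = -z⁻¹ • (e : L2) := by rw [mul_smul, neg_smul z, h1]
  -- If `(S - z) w = x`, then adding `z⁻¹ ρ(w) e` to `w` contributes `-ρ(w) e`, which cancels the
  -- perturbation; `ρ e = 0` keeps `ρ` unchanged by the correction.
  refine ⟨R + z⁻¹ • (ρ ∘L R).smulRight (e : L2), fun x => ?_, fun w => ?_⟩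
  · obtain ⟨w, hw, hw'⟩ := hR1 x
    refine ⟨w + (z⁻¹ * ρ w) • e, ?_, ?_⟩
    · rw [Submodule.coe_add, Submodule.coe_smul, hw, mul_smul]; rfl
    · rw [shift_apply] at hw' ⊢
      rw [hS, map_add, map_smul, he, smul_zero, add_zero, Submodule.coe_add, Submodule.coe_smul,
        map_add, map_smul, hρ, smul_zero, add_zero, smul_add, smul_smul, mul_inv_cancel_left₀ hz,
        ← hw']
      abel
  · have h1 : shift S' z w = shift S z w + ρ w • (e : L2) := by
      rw [shift_apply, shift_apply, hS]; abel
    have h2 : R (shift S' z w) = w - (z⁻¹ * ρ w) • (e : L2) := by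
      rw [h1, map_add, hR2, map_smul, hRe, smul_smul, mul_neg, neg_smul, mul_comm, sub_eq_add_neg]
    have h3 : (R + z⁻¹ • (ρ ∘L R).smulRight (e : L2)) (shift S' z w) =
      R (shift S' z w) + z⁻¹ • ρ (R (shift S' z w)) • (e : L2) := rfl
    rw [h3, h2, map_sub, map_smul, hρ, smul_zero, sub_zero, smul_smul]
    abel

/-- The hypotheses are symmetric under exchanging `S` and `S'` with `ρ` replaced by `-ρ`, so one
inclusion suffices away from `0`. At `0` both operators have the eigenvector `e`. -/
lemma spectrum_eq_of_rankOne {S S' : H2 →ₗ[ℂ] L2} {ρ : L2 →L[ℂ] ℂ} {e : H2}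
    (hS : ∀ w : H2, S' w = S w + ρ w • (e : L2)) (he : S e = 0) (he0 : (e : L2) ≠ 0)
    (hρ : ρ e = 0) : spectrum (opOf S') = spectrum (opOf S) := by
  have he' : S' e = 0 := by rw [hS, he, hρ, zero_smul, add_zero]
  ext z
  by_cases hz : z = 0
  · subst hz
    exact iff_of_true
      (mem_spectrum_of_eigenvector he0 (by rw [shift_apply, he', zero_smul, sub_zero]))
      (mem_spectrum_of_eigenvector he0 (by rw [shift_apply, he, zero_smul, sub_zero]))
  · refine not_congr ⟨fun h => ?_, fun h => mem_resolventSet_of_rankOne hS he hρ hz h⟩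
    refine mem_resolventSet_of_rankOne (ρ := -ρ) (fun w => ?_) he' (by simp [hρ]) hz h
    rw [hS, _root_.neg_apply, neg_smul]; abel

/-! ### Exponential decay of square-integrable solutions -/

/-- A positive value would persist as a lower bound on a half-line of infinite measure. This
replaces pointwise decay at infinity in the energy arguments. -/
lemma nonpos_of_monotoneOn_of_integrableOn {E : ℝ → ℝ} {R : ℝ} (hm : MonotoneOn E (Ici R))
    (hi : IntegrableOn E (Ioi R)) {x : ℝ} (hx : R ≤ x) : E x ≤ 0 := by
  by_contra hpos
  rw [not_le] at hpos
  have h1 : IntegrableOn (fun _ : ℝ => E x) (Ioi x) := by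
    refine Integrable.mono' (hi.mono_set (Ioi_subset_Ioi hx)) aestronglyMeasurable_const ?_
    filter_upwards [ae_restrict_mem measurableSet_Ioi] with y hy
    rw [Real.norm_of_nonneg hpos.le]
    exact hm hx (hx.trans (le_of_lt hy)) (le_of_lt hy)
  rw [integrableOn_const_iff] at h1
  rcases h1 with h1 | h1
  · exact hpos.ne' (by simpa using h1)
  · simp at h1

lemma monotoneOn_Ici_of_hasDerivAt {E E' : ℝ → ℝ} {R : ℝ} (h : ∀ x, HasDerivAt E (E' x) x)
    (h0 : ∀ x, R ≤ x → 0 ≤ E' x) : MonotoneOn E (Ici R) := by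
  refine monotoneOn_of_hasDerivWithinAt_nonneg (convex_Ici R)
    (fun x _ => (h x).continuousAt.continuousWithinAt) (fun x _ => (h x).hasDerivWithinAt) ?_
  intro x hx
  rw [interior_Ici] at hx
  exact h0 x (le_of_lt hx)

/-- A nondecreasing function bounded above converges, and the integral of its nonnegative derivative
is its total increase. -/
lemma integrableOn_deriv_of_nonpos {D D' : ℝ → ℝ} {R : ℝ} (h : ∀ x, HasDerivAt D (D' x) x)
    (h0 : ∀ x, R ≤ x → 0 ≤ D' x) (h1 : ∀ x, R ≤ x → D x ≤ 0) : IntegrableOn D' (Ioi R) := by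
  have hm := monotoneOn_Ici_of_hasDerivAt h h0
  have hm' : Monotone fun x => D (max x R) := fun x y hxy =>
    hm (mem_Ici.2 (le_max_right _ _)) (mem_Ici.2 (le_max_right _ _)) (max_le_max hxy le_rfl)
  have ht := tendsto_atTop_ciSup hm' ⟨0, by rintro _ ⟨x, rfl⟩; exact h1 _ (le_max_right _ _)⟩
  refine integrableOn_Ioi_deriv_of_nonneg' (fun x _ => h x) (fun x hx => h0 x (le_of_lt hx))
    (ht.congr' ?_)
  filter_upwards [eventually_ge_atTop R] with x hx
  rw [max_eq_left hx]

/-- `w` is a classical solution of `w'' + c w' + (q - z) w = g` which lies in `H¹(ℝ)`. -/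
structure Sol (c : ℝ) (q : ℝ → ℝ) (z : ℂ) (g w w₁ w₂ : ℝ → ℂ) : Prop where
  d1 : ∀ x, HasDerivAt w (w₁ x) x
  d2 : ∀ x, HasDerivAt w₁ (w₂ x) x
  ode : ∀ x, w₂ x + c * w₁ x + (q x - z) * w x = g x
  memLp : MemLp w 2 volume
  memLp_deriv : MemLp w₁ 2 volume

lemma memLp_comp_neg {f : ℝ → ℂ} (hf : MemLp f 2 volume) : MemLp (fun x => f (-x)) 2 volume :=
  hf.comp_measurePreserving (Measure.measurePreserving_neg volume)

/-- Reflection reverses the sign of `c`, so estimates at `+∞` valid for either sign of the drift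
also give those at `-∞`. -/
lemma Sol.reflect {c : ℝ} {q : ℝ → ℝ} {z : ℂ} {g w w₁ w₂ : ℝ → ℂ} (h : Sol c q z g w w₁ w₂) :
    Sol (-c) (fun x => q (-x)) z (fun x => g (-x)) (fun x => w (-x)) (fun x => -w₁ (-x))
      (fun x => w₂ (-x)) where
  d1 x := by
    have := (h.d1 (-x)).scomp x (hasDerivAt_neg x)
    simpa using! this
  d2 x := by
    have := ((h.d2 (-x)).scomp x (hasDerivAt_neg x)).neg
    simpa using! this
  ode x := by
    rw [← h.ode (-x)]; push_cast; ring
  memLp := memLp_comp_neg h.memLp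
  memLp_deriv := (memLp_comp_neg h.memLp_deriv).neg

lemma hasDerivAt_re {w : ℝ → ℂ} {w' : ℂ} {x : ℝ} (h : HasDerivAt w w' x) :
    HasDerivAt (fun x => (w x).re) w'.re x :=
  Complex.reCLM.hasFDerivAt.comp_hasDerivAt x h

lemma hasDerivAt_im {w : ℝ → ℂ} {w' : ℂ} {x : ℝ} (h : HasDerivAt w w' x) :
    HasDerivAt (fun x => (w x).im) w'.im x :=
  Complex.imCLM.hasFDerivAt.comp_hasDerivAt x h

/-- The energy `Re (w̄ w') + (c / 2) |w|²`. -/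
def energy (c : ℝ) (w w₁ : ℝ → ℂ) (x : ℝ) : ℝ :=
  (w x).re * (w₁ x).re + (w x).im * (w₁ x).im + c / 2 * ((w x).re ^ 2 + (w x).im ^ 2)

lemma integrable_re_mul_re {f g : ℝ → ℂ} (hf : MemLp f 2 volume) (hg : MemLp g 2 volume) :
    Integrable (fun x => (f x).re * (g x).re) :=
  MemLp.integrable_mul (p := 2) (q := 2) hf.re hg.re

lemma integrable_im_mul_im {f g : ℝ → ℂ} (hf : MemLp f 2 volume) (hg : MemLp g 2 volume) :
    Integrable (fun x => (f x).im * (g x).im) :=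
  MemLp.integrable_mul (p := 2) (q := 2) hf.im hg.im

lemma Sol.integrable_energy {c : ℝ} {q : ℝ → ℝ} {z : ℂ} {g w w₁ w₂ : ℝ → ℂ}
    (h : Sol c q z g w w₁ w₂) (k : ℝ) : Integrable (energy k w w₁) := by
  have := ((integrable_re_mul_re h.memLp h.memLp_deriv).add
    (integrable_im_mul_im h.memLp h.memLp_deriv)).add
    (((integrable_re_mul_re h.memLp h.memLp).add (integrable_im_mul_im h.memLp h.memLp)).const_mul
      (k / 2))
  refine this.congr (Eventually.of_forall fun x => ?_)
  simp only [Pi.add_apply, energy]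
  ring

/-- The term `(c / 2) |w|²` of the energy is chosen so that its derivative cancels the drift
contribution `-c Re (w̄ w')`. -/
lemma Sol.hasDerivAt_energy {c : ℝ} {q : ℝ → ℝ} {z : ℂ} {g w w₁ w₂ : ℝ → ℂ}
    (h : Sol c q z g w w₁ w₂) (x : ℝ) :
    HasDerivAt (energy c w w₁) ((w₁ x).re ^ 2 + (w₁ x).im ^ 2 +
      (z.re - q x) * ((w x).re ^ 2 + (w x).im ^ 2) +
      ((w x).re * (g x).re + (w x).im * (g x).im)) x := by
  have hr := hasDerivAt_re (h.d1 x)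
  have hi := hasDerivAt_im (h.d1 x)
  have hr1 := hasDerivAt_re (h.d2 x)
  have hi1 := hasDerivAt_im (h.d2 x)
  have ho := h.ode x
  have er := congrArg Complex.re ho
  have ei := congrArg Complex.im ho
  simp only [Complex.add_re, Complex.add_im, Complex.mul_re, Complex.mul_im, Complex.sub_re,
    Complex.sub_im, Complex.ofReal_re, Complex.ofReal_im] at er ei
  have hd := ((hr.mul hr1).add (hi.mul hi1)).add (((hr.pow 2).add (hi.pow 2)).const_mul (c / 2))
  refine hd.congr_deriv ?_
  rw [← er, ← ei]
  push_cast
  ring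

/-- Decay at `+∞` of solutions and generalized solutions of order two. -/
lemma Sol.integrableOn_Ioi {c : ℝ} {q : ℝ → ℝ} {z : ℂ} {u u₁ u₂ w w₁ w₂ : ℝ → ℂ}
    (hw : Sol c q z u w w₁ w₂) (hu : Sol c q z 0 u u₁ u₂) {R δ : ℝ} (hδ : 0 < δ)
    (hfar : ∀ x, R ≤ x → δ ≤ z.re - q x) :
    ∃ D : ℝ → ℝ, IntegrableOn D (Ioi R) ∧ ∀ x, R ≤ x →
      Real.exp (c * x) * (‖w₁ x + c / 2 * w x‖ ^ 2 + δ / 2 * ‖w x‖ ^ 2) ≤ D x := by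
  -- Young's inequality bounds the coupling `Re (w̄ u)` below by `-(δ/2)|w|² - (1/(2δ))|u|²`. With
  -- `K δ = 1/δ`, the second loss is covered by `K` times the energy derivative of `u`.
  set K : ℝ := 1 / δ ^ 2
  have hK : 0 < K := by positivity
  have hKδ : K * δ = 1 / δ := by simp only [K]; field_simp
  set E : ℝ → ℝ := fun x => energy c w w₁ x + K * energy c u u₁ x
  set E' : ℝ → ℝ := fun x => ((w₁ x).re ^ 2 + (w₁ x).im ^ 2 +
      (z.re - q x) * ((w x).re ^ 2 + (w x).im ^ 2) +
      ((w x).re * (u x).re + (w x).im * (u x).im)) + K * ((u₁ x).re ^ 2 + (u₁ x).im ^ 2 +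
      (z.re - q x) * ((u x).re ^ 2 + (u x).im ^ 2))
  have hE : ∀ x, HasDerivAt E (E' x) x := fun x => by
    refine ((hw.hasDerivAt_energy x).add ((hu.hasDerivAt_energy x).const_mul K)).congr_deriv ?_
    simp [E']
  have hEi : Integrable E := (hw.integrable_energy c).add ((hu.integrable_energy c).const_mul K)
  have hcross : ∀ x, -(δ / 2) * ((w x).re ^ 2 + (w x).im ^ 2) -
      K * δ / 2 * ((u x).re ^ 2 + (u x).im ^ 2) ≤
      (w x).re * (u x).re + (w x).im * (u x).im := fun x => by
    have h1 : ∀ a b : ℝ, -(δ / 2) * a ^ 2 - K * δ / 2 * b ^ 2 ≤ a * b := fun a b => by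
      have h2 : a * b - (-(δ / 2) * a ^ 2 - K * δ / 2 * b ^ 2) = δ / 2 * (a + b / δ) ^ 2 := by
        rw [hKδ]; field_simp; ring
      have h3 : 0 ≤ δ / 2 * (a + b / δ) ^ 2 := by positivity
      linarith
    linarith [h1 (w x).re (u x).re, h1 (w x).im (u x).im]
  have hlow : ∀ x, R ≤ x →
      ((w₁ x).re ^ 2 + (w₁ x).im ^ 2) + δ / 2 * ((w x).re ^ 2 + (w x).im ^ 2) +
        K * ((u₁ x).re ^ 2 + (u₁ x).im ^ 2) ≤ E' x := fun x hx => by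
    have h1 := hfar x hx
    have h2 := hcross x
    have h3 : δ * ((w x).re ^ 2 + (w x).im ^ 2) ≤ (z.re - q x) * ((w x).re ^ 2 + (w x).im ^ 2) :=
      mul_le_mul_of_nonneg_right h1 (by positivity)
    have h4 : δ * ((u x).re ^ 2 + (u x).im ^ 2) ≤ (z.re - q x) * ((u x).re ^ 2 + (u x).im ^ 2) :=
      mul_le_mul_of_nonneg_right h1 (by positivity)
    have h5 := mul_le_mul_of_nonneg_left h4 hK.le
    have h6 : 0 ≤ K * δ * ((u x).re ^ 2 + (u x).im ^ 2) := by positivity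
    simp only [E']
    linarith
  have hE0 : ∀ x, R ≤ x → E x ≤ 0 := fun x hx =>
    nonpos_of_monotoneOn_of_integrableOn (monotoneOn_Ici_of_hasDerivAt hE fun y hy => by
      have := hlow y hy
      have h0 : 0 ≤ ((w₁ y).re ^ 2 + (w₁ y).im ^ 2) + δ / 2 * ((w y).re ^ 2 + (w y).im ^ 2) +
        K * ((u₁ y).re ^ 2 + (u₁ y).im ^ 2) := by positivity
      linarith) hEi.integrableOn hx
  have hD : ∀ x, HasDerivAt (fun x => Real.exp (c * x) * E x)
      (Real.exp (c * x) * (c * E x + E' x)) x := fun x => by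
    have h1 : HasDerivAt (fun x => Real.exp (c * x)) (Real.exp (c * x) * c) x := by
      simpa using! ((hasDerivAt_id x).const_mul c).exp
    refine (h1.mul (hE x)).congr_deriv ?_
    ring
  -- Completing the square: `|w₁|² + c Re (w̄ w₁) + (c²/2)|w|² = |w₁ + (c/2) w|² + (c²/4)|w|²`, and
  -- likewise for `u`. Hence the weighted energy is also nondecreasing.
  have hlow' : ∀ x, R ≤ x → ‖w₁ x + c / 2 * w x‖ ^ 2 + δ / 2 * ‖w x‖ ^ 2 ≤ c * E x + E' x := by
    intro x hx
    have h1 := hlow x hx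
    have h2 : ‖w₁ x + c / 2 * w x‖ ^ 2 = ((w₁ x).re + c / 2 * (w x).re) ^ 2 +
        ((w₁ x).im + c / 2 * (w x).im) ^ 2 := by
      have e1 : (w₁ x + c / 2 * w x).re = (w₁ x).re + c / 2 * (w x).re := by
        have : (c : ℂ) / 2 = ((c / 2 : ℝ) : ℂ) := by push_cast; rfl
        rw [this, Complex.add_re, Complex.re_ofReal_mul]
      have e2 : (w₁ x + c / 2 * w x).im = (w₁ x).im + c / 2 * (w x).im := by
        have : (c : ℂ) / 2 = ((c / 2 : ℝ) : ℂ) := by push_cast; rfl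
        rw [this, Complex.add_im, Complex.im_ofReal_mul]
      rw [Complex.sq_norm, Complex.normSq_apply, e1, e2]
      ring
    have h3 : ‖w x‖ ^ 2 = (w x).re ^ 2 + (w x).im ^ 2 := by
      rw [Complex.sq_norm, Complex.normSq_apply]; ring
    rw [h2, h3]
    have h4 : 0 ≤ K * (((u₁ x).re + c / 2 * (u x).re) ^ 2 + ((u₁ x).im + c / 2 * (u x).im) ^ 2) := by
      positivity
    have h5 : 0 ≤ c ^ 2 / 4 * ((w x).re ^ 2 + (w x).im ^ 2) := by positivity
    have h6 : 0 ≤ K * (c ^ 2 / 4 * ((u x).re ^ 2 + (u x).im ^ 2)) := by positivity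
    have h7 : c * E x = (c * ((w x).re * (w₁ x).re + (w x).im * (w₁ x).im) +
        c ^ 2 / 2 * ((w x).re ^ 2 + (w x).im ^ 2)) +
        K * (c * ((u x).re * (u₁ x).re + (u x).im * (u₁ x).im) +
        c ^ 2 / 2 * ((u x).re ^ 2 + (u x).im ^ 2)) := by
      simp only [E, energy]; ring
    rw [h7]
    nlinarith
  have hnn : ∀ x, R ≤ x → 0 ≤ Real.exp (c * x) * (c * E x + E' x) := fun x hx => by
    refine mul_nonneg (Real.exp_pos _).le ((?_ : (0 : ℝ) ≤ _).trans (hlow' x hx))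
    positivity
  -- The dominating function is the derivative of `exp (c x) E`, which is nonpositive and
  -- nondecreasing on the half-line.
  refine ⟨_, integrableOn_deriv_of_nonpos hD hnn fun x hx =>
    mul_nonpos_of_nonneg_of_nonpos (Real.exp_pos _).le (hE0 x hx), fun x hx => ?_⟩
  exact mul_le_mul_of_nonneg_left (hlow' x hx) (Real.exp_pos _).le

/-- Multiplication by the weight `exp (c x / 2)`. -/
def wt (c : ℝ) (w : ℝ → ℂ) (x : ℝ) : ℂ := ((Real.exp (c / 2 * x) : ℝ) : ℂ) * w x

lemma norm_wt_sq (c : ℝ) (w : ℝ → ℂ) (x : ℝ) : ‖wt c w x‖ ^ 2 = Real.exp (c * x) * ‖w x‖ ^ 2 := by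
  rw [wt, norm_mul, mul_pow, Complex.norm_real, Real.norm_of_nonneg (Real.exp_pos _).le, sq,
    ← Real.exp_add]
  ring_nf

lemma continuous_wt {c : ℝ} {w : ℝ → ℂ} (h : Continuous w) : Continuous (wt c w) := by
  unfold wt
  fun_prop

lemma hasDerivAt_wt {c : ℝ} {w : ℝ → ℂ} {w' : ℂ} {x : ℝ} (h : HasDerivAt w w' x) :
    HasDerivAt (wt c w) (((Real.exp (c / 2 * x) : ℝ) : ℂ) * (w' + c / 2 * w x)) x := by
  have h1 : HasDerivAt (fun x => Real.exp (c / 2 * x)) (Real.exp (c / 2 * x) * (c / 2)) x := by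
    simpa using! ((hasDerivAt_id x).const_mul (c / 2)).exp
  refine (h1.ofReal_comp.mul h).congr_deriv ?_
  push_cast
  ring

lemma Sol.continuous {c : ℝ} {q : ℝ → ℝ} {z : ℂ} {g w w₁ w₂ : ℝ → ℂ} (h : Sol c q z g w w₁ w₂) :
    Continuous w := continuous_iff_continuousAt.2 fun x => (h.d1 x).continuousAt

lemma Sol.continuous_deriv {c : ℝ} {q : ℝ → ℝ} {z : ℂ} {g w w₁ w₂ : ℝ → ℂ}
    (h : Sol c q z g w w₁ w₂) : Continuous w₁ :=
  continuous_iff_continuousAt.2 fun x => (h.d2 x).continuousAt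

lemma integrable_of_continuous_of_dominated {N D₁ D₂ : ℝ → ℝ} {R : ℝ} (hN : Continuous N)
    (h0 : ∀ x, 0 ≤ N x) (i1 : IntegrableOn D₁ (Ioi R)) (h1 : ∀ x, R ≤ x → N x ≤ D₁ x)
    (i2 : IntegrableOn D₂ (Ioi R)) (h2 : ∀ x, R ≤ x → N (-x) ≤ D₂ x) : Integrable N := by
  have j1 : IntegrableOn N (Ioi R) := by
    refine Integrable.mono' i1 hN.aestronglyMeasurable ?_
    filter_upwards [ae_restrict_mem measurableSet_Ioi] with x hx
    rw [Real.norm_of_nonneg (h0 x)]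
    exact h1 x (le_of_lt hx)
  have j2 : IntegrableOn (fun x => N (-x)) (Ioi R) := by
    refine Integrable.mono' i2 (hN.comp continuous_neg).aestronglyMeasurable ?_
    filter_upwards [ae_restrict_mem measurableSet_Ioi] with x hx
    rw [Real.norm_of_nonneg (h0 _)]
    exact h2 x (le_of_lt hx)
  have j3 : IntegrableOn N (Iio (-R)) := by
    have h := ((Measure.measurePreserving_neg (volume : Measure ℝ)).integrableOn_comp_preimage
      (Homeomorph.neg ℝ).measurableEmbedding (f := fun x => N (-x)) (s := Ioi R)).2 j2
    have e : (fun x : ℝ => -x) ⁻¹' Ioi R = Iio (-R) := by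
      ext x; simp only [mem_preimage, mem_Ioi, mem_Iio]; constructor <;> intro h <;> linarith
    have e' : ((fun x => N (-x)) ∘ fun x : ℝ => -x) = N := by ext x; simp
    rw [e, e'] at h
    exact h
  have j4 : IntegrableOn N (Icc (-R) R) := hN.integrableOn_Icc
  rw [← integrableOn_univ]
  refine ((j3.union j4).union j1).mono_set fun x _ => ?_
  by_cases hx : x < -R
  · exact Or.inl (Or.inl hx)
  · by_cases hx' : R < x
    · exact Or.inr hx'
    · exact Or.inl (Or.inr ⟨not_lt.1 hx, not_lt.1 hx'⟩)

/-- Solutions and generalized solutions of order two remain square-integrable, together with their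
derivatives, after multiplication by the weight `exp (c x / 2)`. -/
lemma Sol.memLp_wt {c : ℝ} {q : ℝ → ℝ} {z : ℂ} {u u₁ u₂ w w₁ w₂ : ℝ → ℂ}
    (hw : Sol c q z u w w₁ w₂) (hu : Sol c q z 0 u u₁ u₂) {R δ : ℝ} (hδ : 0 < δ)
    (hfar : ∀ x, R ≤ |x| → δ ≤ z.re - q x) :
    MemLp (wt c w) 2 volume ∧ MemLp (wt c fun x => w₁ x + c / 2 * w x) 2 volume := by
  obtain ⟨D₁, i1, h1⟩ := hw.integrableOn_Ioi hu hδ (R := R)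
    (fun x hx => hfar x (hx.trans (le_abs_self x)))
  obtain ⟨D₂, i2, h2⟩ := hw.reflect.integrableOn_Ioi hu.reflect hδ (R := R)
    (fun x hx => hfar (-x) (by rw [abs_neg]; exact hx.trans (le_abs_self x)))
  set N : ℝ → ℝ := fun x => Real.exp (c * x) * (‖w₁ x + c / 2 * w x‖ ^ 2 + δ / 2 * ‖w x‖ ^ 2)
  have hcw := hw.continuous
  have hcw1 := hw.continuous_deriv
  have hc1 : Continuous fun x => w₁ x + c / 2 * w x := by fun_prop
  have hNc : Continuous N := by fun_prop
  have hN : Integrable N := by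
    refine integrable_of_continuous_of_dominated hNc (fun x => by positivity) i1 h1 i2
      fun x hx => ?_
    refine le_of_eq_of_le ?_ (h2 x hx)
    have e : -w₁ (-x) + ((-c : ℝ) : ℂ) / 2 * w (-x) = -(w₁ (-x) + c / 2 * w (-x)) := by
      push_cast; ring
    rw [e, norm_neg, neg_mul, ← mul_neg]
  constructor
  · rw [memLp_two_iff_integrable_sq_norm (continuous_wt hcw).aestronglyMeasurable]
    refine Integrable.mono' (hN.const_mul (2 / δ))
      ((continuous_wt hcw).norm.pow 2).aestronglyMeasurable (Eventually.of_forall fun x => ?_)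
    rw [Real.norm_of_nonneg (sq_nonneg _), norm_wt_sq]
    have e : 2 / δ * N x = Real.exp (c * x) * (2 / δ * ‖w₁ x + c / 2 * w x‖ ^ 2 + ‖w x‖ ^ 2) := by
      simp only [N]; field_simp
    rw [e]
    refine mul_le_mul_of_nonneg_left ?_ (Real.exp_pos _).le
    have : 0 ≤ 2 / δ * ‖w₁ x + c / 2 * w x‖ ^ 2 := by positivity
    linarith
  · rw [memLp_two_iff_integrable_sq_norm (continuous_wt hc1).aestronglyMeasurable]
    refine Integrable.mono' hN ((continuous_wt hc1).norm.pow 2).aestronglyMeasurable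
      (Eventually.of_forall fun x => ?_)
    rw [Real.norm_of_nonneg (sq_nonneg _), norm_wt_sq]
    refine mul_le_mul_of_nonneg_left ?_ (Real.exp_pos _).le
    have : 0 ≤ δ / 2 * ‖w x‖ ^ 2 := by positivity
    linarith

/-! ### Symmetry: real eigenvalues, absence of Jordan blocks, the ground state -/

section

variable {c : ℝ} {q : ℝ → ℝ} {z : ℂ} {g u u₁ u₂ w w₁ w₂ : ℝ → ℂ}

lemma Sol.zero : Sol c q z 0 0 0 0 where
  d1 x := hasDerivAt_const x 0
  d2 x := hasDerivAt_const x 0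
  ode x := by simp
  memLp := MemLp.zero
  memLp_deriv := MemLp.zero

/-- A null solution is a chain of length two over the zero solution. -/
lemma Sol.memLp_wt_self (hu : Sol c q z 0 u u₁ u₂) {R δ : ℝ} (hδ : 0 < δ)
    (hfar : ∀ x, R ≤ |x| → δ ≤ z.re - q x) :
    MemLp (wt c u) 2 volume ∧ MemLp (wt c fun x => u₁ x + c / 2 * u x) 2 volume :=
  hu.memLp_wt Sol.zero hδ hfar

lemma Sol.hasDerivAt_wt (h : Sol c q z g w w₁ w₂) (x : ℝ) :
    HasDerivAt (wt c w) (wt c (fun x => w₁ x + c / 2 * w x) x) x :=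
  TravellingWave.hasDerivAt_wt (h.d1 x)

/-- Conjugation by `exp (c x / 2)` removes the drift, leaving `V'' = (z - q + c²/4) V` plus the
weighted source, with real potential. This is the source of all the symmetry used below. -/
lemma Sol.hasDerivAt_wt_deriv (h : Sol c q z g w w₁ w₂) (x : ℝ) :
    HasDerivAt (wt c fun x => w₁ x + c / 2 * w x)
      (wt c g x + (z - q x + c ^ 2 / 4) * wt c w x) x := by
  refine (TravellingWave.hasDerivAt_wt (c := c)
    ((h.d2 x).add ((h.d1 x).const_mul (c / 2 : ℂ)))).congr_deriv ?_
  rw [wt, wt, ← h.ode x, Pi.add_apply]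
  ring

lemma hasDerivAt_conj {f : ℝ → ℂ} {f' : ℂ} {x : ℝ} (h : HasDerivAt f f' x) :
    HasDerivAt (fun x => (starRingEnd ℂ) (f x)) ((starRingEnd ℂ) f') x :=
  Complex.conjCLE.toContinuousLinearMap.hasFDerivAt.comp_hasDerivAt x h

/-- Green's identity in the space weighted by `exp (c x)`. -/
lemma Sol.green (hw : Sol c q z g w w₁ w₂) (hu : Sol c q z 0 u u₁ u₂)
    (mg : MemLp (wt c g) 2 volume) (mw : MemLp (wt c w) 2 volume)
    (mw₁ : MemLp (wt c fun x => w₁ x + c / 2 * w x) 2 volume) (mu : MemLp (wt c u) 2 volume)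
    (mu₁ : MemLp (wt c fun x => u₁ x + c / 2 * u x) 2 volume) :
    (∫ x, (starRingEnd ℂ) (wt c u x) * wt c g x) +
      (z - (starRingEnd ℂ) z) * ∫ x, (starRingEnd ℂ) (wt c u x) * wt c w x = 0 := by
  have i1 := integrable_conj_mul mu mg
  have i2 := (integrable_conj_mul mu mw).const_mul (z - (starRingEnd ℂ) z)
  rw [← integral_const_mul, ← integral_add i1 i2]
  -- The integrand is the derivative of the Wronskian of the weighted functions, with the conjugate
  -- on `u`; both are integrable, so there are no boundary terms.
  refine integral_eq_zero_of_hasDerivAt_of_integrable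
    (f := fun x => (starRingEnd ℂ) (wt c u x) * wt c (fun x => w₁ x + c / 2 * w x) x -
      (starRingEnd ℂ) (wt c (fun x => u₁ x + c / 2 * u x) x) * wt c w x) (fun x => ?_)
    (i1.add i2) ((integrable_conj_mul mu mw₁).sub (integrable_conj_mul mu₁ mw))
  have h := ((hasDerivAt_conj (hu.hasDerivAt_wt x)).mul (hw.hasDerivAt_wt_deriv x)).sub
    ((hasDerivAt_conj (hu.hasDerivAt_wt_deriv x)).mul (hw.hasDerivAt_wt x))
  refine h.congr_deriv ?_
  have h0 : wt c 0 x = 0 := by simp [wt]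
  rw [h0, zero_add, map_mul, map_add, map_sub, Complex.conj_ofReal, map_div₀, map_pow,
    Complex.conj_ofReal]
  have h4 : (starRingEnd ℂ) 4 = 4 := Complex.conj_ofNat 4
  rw [h4]
  ring

lemma eq_zero_of_integral_conj_mul_self {V : ℝ → ℂ} (hc : Continuous V) (hV : MemLp V 2 volume)
    (h : ∫ x, (starRingEnd ℂ) (V x) * V x = 0) (x : ℝ) : V x = 0 := by
  have e : ∫ x, (starRingEnd ℂ) (V x) * V x = ((∫ x, ‖V x‖ ^ 2 : ℝ) : ℂ) := by
    rw [← integral_complex_ofReal]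
    refine integral_congr_ae (Eventually.of_forall fun x => ?_)
    dsimp only
    rw [Complex.conj_mul']
    norm_cast
  rw [e, Complex.ofReal_eq_zero,
    integral_eq_zero_iff_of_nonneg (fun x => sq_nonneg _) (memLp_norm_sq hV)] at h
  have h1 := (Continuous.ae_eq_iff_eq volume (hc.norm.pow 2) continuous_const).1 h
  have h2 : ‖V x‖ ^ 2 = 0 := congrFun h1 x
  exact norm_eq_zero.1 (pow_eq_zero_iff two_ne_zero |>.1 h2)

lemma eq_zero_of_wt_eq_zero {x : ℝ} (h : wt c u x = 0) : u x = 0 := by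
  rw [wt, mul_eq_zero, Complex.ofReal_eq_zero] at h
  exact h.resolve_left (Real.exp_pos _).ne'

/-- Eigenvalues to the right of the essential spectrum are real. -/
lemma Sol.eq_zero_of_im_ne_zero (hu : Sol c q z 0 u u₁ u₂) {R δ : ℝ} (hδ : 0 < δ)
    (hfar : ∀ x, R ≤ |x| → δ ≤ z.re - q x) (hz : z.im ≠ 0) (x : ℝ) : u x = 0 := by
  obtain ⟨m, m₁⟩ := hu.memLp_wt_self hδ hfar
  have h0 : wt c 0 = 0 := by funext x; simp [wt]
  have h := hu.green hu (by rw [h0]; exact MemLp.zero) m m₁ m m₁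
  have hne : z - (starRingEnd ℂ) z ≠ 0 := fun h1 => hz (by
    have := congrArg Complex.im h1
    simp at this
    linarith)
  rw [h0] at h
  simp only [Pi.zero_apply, mul_zero, integral_zero, zero_add, mul_eq_zero, hne, false_or] at h
  exact eq_zero_of_wt_eq_zero (eq_zero_of_integral_conj_mul_self (continuous_wt hu.continuous) m h x)

/-- Eigenvalues to the right of the essential spectrum are semisimple. -/
lemma Sol.eq_zero_of_chain (hw : Sol c q z u w w₁ w₂) (hu : Sol c q z 0 u u₁ u₂) {R δ : ℝ}
    (hδ : 0 < δ) (hfar : ∀ x, R ≤ |x| → δ ≤ z.re - q x) (x : ℝ) : u x = 0 := by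
  by_cases hz : z.im = 0
  · obtain ⟨m, m₁⟩ := hu.memLp_wt_self hδ hfar
    obtain ⟨n, n₁⟩ := hw.memLp_wt hu hδ hfar
    -- For real `z` the second term of Green's identity vanishes, and the source of `w` is `u`
    -- itself, so the weighted `L²` norm of `u` is zero.
    have h := hw.green hu m n n₁ m m₁
    rw [Complex.conj_eq_iff_im.2 hz, sub_self, zero_mul, add_zero] at h
    exact eq_zero_of_wt_eq_zero
      (eq_zero_of_integral_conj_mul_self (continuous_wt hu.continuous) m h x)
  · exact hu.eq_zero_of_im_ne_zero hδ hfar hz x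

end

/-- The logarithmic derivative of a positive square-integrable solution is bounded at `+∞`. -/
lemma abs_logDeriv_le {θ θ₁ Q : ℝ → ℝ} {R M : ℝ} (h1 : ∀ x, HasDerivAt θ (θ₁ x) x)
    (h2 : ∀ x, HasDerivAt θ₁ (Q x * θ x) x) (hθ : ∀ x, 0 < θ x) (hM : 0 ≤ M)
    (hQ0 : ∀ x, R ≤ x → 0 ≤ Q x) (hQM : ∀ x, R ≤ x → Q x ≤ M ^ 2)
    (i0 : Integrable fun x => θ x ^ 2) (i1 : Integrable fun x => θ x * θ₁ x)
    (i2 : Integrable fun x => θ₁ x ^ 2) {x : ℝ} (hx : R ≤ x) : |θ₁ x / θ x| ≤ M := by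
  have hd : ∀ x, HasDerivAt (fun x => θ x * θ₁ x) (θ₁ x ^ 2 + Q x * θ x ^ 2) x := fun x =>
    ((h1 x).mul (h2 x)).congr_deriv (by ring)
  have hneg : ∀ x, R ≤ x → θ x * θ₁ x ≤ 0 := fun x hx =>
    nonpos_of_monotoneOn_of_integrableOn (monotoneOn_Ici_of_hasDerivAt hd fun y hy => by
      have := mul_nonneg (hQ0 y hy) (sq_nonneg (θ y))
      positivity) i1.integrableOn hx
  have hd2 : ∀ x, HasDerivAt (fun x => θ₁ x ^ 2 - M ^ 2 * θ x ^ 2)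
      (2 * ((Q x - M ^ 2) * (θ x * θ₁ x))) x := fun x =>
    (((h2 x).pow 2).sub (((h1 x).pow 2).const_mul (M ^ 2))).congr_deriv (by push_cast; ring)
  -- Its derivative is `2 (Q - M²) θ θ₁`, a product of nonpositive factors up to a positive
  -- constant; being integrable and nondecreasing, the quantity is nonpositive.
  have h3 : θ₁ x ^ 2 - M ^ 2 * θ x ^ 2 ≤ 0 :=
    nonpos_of_monotoneOn_of_integrableOn (monotoneOn_Ici_of_hasDerivAt hd2 fun y hy => by
      have h4 : Q y - M ^ 2 ≤ 0 := by linarith [hQM y hy]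
      have := mul_nonneg_of_nonpos_of_nonpos h4 (hneg y hy)
      linarith) (i2.sub (i0.const_mul _)).integrableOn hx
  rw [abs_div, abs_of_pos (hθ x), div_le_iff₀ (hθ x)]
  refine abs_le_of_sq_le_sq ?_ (mul_nonneg hM (hθ x).le)
  linarith

/-- The half-line sign argument applies at `+∞` to `F` and, after reflection, to `-F`. -/
lemma eq_zero_of_deriv_nonneg_of_integrable {F F' : ℝ → ℝ} (h : ∀ x, HasDerivAt F (F' x) x)
    (h0 : ∀ x, 0 ≤ F' x) (hi : Integrable F) (x : ℝ) : F x = 0 := by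
  refine le_antisymm (nonpos_of_monotoneOn_of_integrableOn (R := x)
    (monotoneOn_Ici_of_hasDerivAt h fun y _ => h0 y) hi.integrableOn le_rfl) ?_
  have h1 : ∀ y, HasDerivAt (fun y => -F (-y)) (F' (-y)) y := fun y => by
    have := ((h (-y)).scomp y (hasDerivAt_neg y)).neg
    simpa using! this
  have h2 := nonpos_of_monotoneOn_of_integrableOn (R := -x)
    (monotoneOn_Ici_of_hasDerivAt h1 fun y _ => h0 _) hi.comp_neg.neg.integrableOn le_rfl
  simpa using h2

/-- Let `ψ` be a positive null solution. Every eigenfunction for a real eigenvalue `z ≥ 0` is a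
multiple of `ψ`, and vanishes unless `z = 0`. -/
lemma Sol.ground_state {c : ℝ} {q ψ ψ₁ ψ₂ : ℝ → ℝ} {z : ℂ} {u u₁ u₂ : ℝ → ℂ}
    (hψ : Sol c q 0 0 (fun x => (ψ x : ℂ)) (fun x => (ψ₁ x : ℂ)) (fun x => (ψ₂ x : ℂ)))
    (hpos : ∀ x, 0 < ψ x) (hu : Sol c q z 0 u u₁ u₂) (hz : z.im = 0) (hz0 : 0 ≤ z.re)
    {R δ M₀ : ℝ} (hδ : 0 < δ) (hfar : ∀ x, R ≤ |x| → δ ≤ -q x) (hM₀ : ∀ x, |q x| ≤ M₀) :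
    (∃ a : ℂ, ∀ x, u x = a * ψ x) ∧ (z ≠ 0 → ∀ x, u x = 0) := by
  set e : ℝ → ℝ := fun x => Real.exp (c / 2 * x)
  have he : ∀ x, 0 < e x := fun x => Real.exp_pos _
  set θ : ℝ → ℝ := fun x => e x * ψ x
  set θ₁ : ℝ → ℝ := fun x => e x * (ψ₁ x + c / 2 * ψ x)
  set Q : ℝ → ℝ := fun x => c ^ 2 / 4 - q x
  have hθw : ∀ x, wt c (fun x => (ψ x : ℂ)) x = (θ x : ℂ) := fun x => by
    simp only [wt, θ, e]; push_cast; rfl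
  have hθ₁w : ∀ x, wt c (fun x => (ψ₁ x : ℂ) + c / 2 * ψ x) x = (θ₁ x : ℂ) := fun x => by
    simp only [wt, θ₁, e]; push_cast; rfl
  obtain ⟨mθ, mθ₁⟩ := hψ.memLp_wt_self hδ (fun x hx => by simpa using hfar x hx)
  have d1 : ∀ x, HasDerivAt θ (θ₁ x) x := fun x => by
    have h := hasDerivAt_re (hψ.hasDerivAt_wt x)
    simp only [hθw, hθ₁w, Complex.ofReal_re] at h
    exact h
  have d2 : ∀ x, HasDerivAt θ₁ (Q x * θ x) x := fun x => by
    have h := hasDerivAt_re (hψ.hasDerivAt_wt_deriv x)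
    simp only [hθw, hθ₁w, Complex.ofReal_re] at h
    refine h.congr_deriv ?_
    have : wt c 0 x + (0 - (q x : ℂ) + c ^ 2 / 4) * (θ x : ℂ) = ((Q x * θ x : ℝ) : ℂ) := by
      simp only [wt, Q, Pi.zero_apply, mul_zero, zero_add]; push_cast; ring
    rw [this, Complex.ofReal_re]
  have hθ : ∀ x, 0 < θ x := fun x => mul_pos (he x) (hpos x)
  have i0 : Integrable fun x => θ x ^ 2 := by
    simpa only [hθw, Complex.ofReal_re, sq] using integrable_re_mul_re mθ mθ
  have i1 : Integrable fun x => θ x * θ₁ x := by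
    simpa only [hθw, hθ₁w, Complex.ofReal_re] using integrable_re_mul_re mθ mθ₁
  have i2 : Integrable fun x => θ₁ x ^ 2 := by
    simpa only [hθ₁w, Complex.ofReal_re, sq] using integrable_re_mul_re mθ₁ mθ₁
  -- The summand `1` ensures `M ≥ 1`, so the bound `Q ≤ M` implies the required `Q ≤ M²`.
  set M : ℝ := c ^ 2 / 4 + M₀ + 1
  have hM₀0 : 0 ≤ M₀ := (abs_nonneg _).trans (hM₀ 0)
  have hM1 : 1 ≤ M := by
    have : 0 ≤ c ^ 2 / 4 := by positivity
    simp only [M]; linarith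
  have hQM : ∀ x, Q x ≤ M ^ 2 := fun x => by
    have h1 := (neg_le_abs _).trans (hM₀ x)
    have h2 : Q x ≤ M := by simp only [Q, M]; linarith
    nlinarith
  have hQ0 : ∀ x, R ≤ |x| → 0 ≤ Q x := fun x hx => by
    have h1 := hfar x hx
    have : 0 ≤ c ^ 2 / 4 := by positivity
    simp only [Q]; linarith
  -- `ρ` solves the Riccati equation `ρ' = Q - ρ²`. Its boundedness serves only to make `ρ |V|²`
  -- integrable.
  set ρ : ℝ → ℝ := fun x => θ₁ x / θ x
  have hρ1 : ∀ x, R ≤ x → |ρ x| ≤ M := fun x hx =>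
    abs_logDeriv_le d1 d2 hθ (by linarith) (fun y hy => hQ0 y (hy.trans (le_abs_self y)))
      (fun y _ => hQM y) i0 i1 i2 hx
  have hρ2 : ∀ x, R ≤ x → |ρ (-x)| ≤ M := fun x hx => by
    have := abs_logDeriv_le (θ := fun x => θ (-x)) (θ₁ := fun x => -θ₁ (-x)) (Q := fun x => Q (-x))
      (R := R) (M := M) (fun y => by simpa using! (d1 (-y)).scomp y (hasDerivAt_neg y))
      (fun y => by simpa using! ((d2 (-y)).scomp y (hasDerivAt_neg y)).neg) (fun y => hθ _)
      (by linarith) (fun y hy => hQ0 _ (by rw [abs_neg]; exact hy.trans (le_abs_self y)))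
      (fun y _ => hQM _) i0.comp_neg (by simpa only [mul_neg] using! i1.comp_neg.neg)
      (by simpa only [neg_sq] using! i2.comp_neg) hx
    rwa [neg_div, abs_neg] at this
  have cθ : Continuous θ := continuous_iff_continuousAt.2 fun x => (d1 x).continuousAt
  have cθ₁ : Continuous θ₁ := continuous_iff_continuousAt.2 fun x => (d2 x).continuousAt
  have cρ : Continuous ρ := cθ₁.div cθ fun x => (hθ x).ne'
  obtain ⟨C, hC⟩ := (isCompact_Icc (a := -R) (b := R)).exists_bound_of_continuousOn cρ.continuousOn
  have hρ : ∀ x, ‖ρ x‖ ≤ max M C := fun x => by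
    rw [Real.norm_eq_abs]
    by_cases h1 : R ≤ x
    · exact (hρ1 x h1).trans (le_max_left _ _)
    · by_cases h2 : R ≤ -x
      · have := hρ2 (-x) h2
        rw [neg_neg] at this
        exact this.trans (le_max_left _ _)
      · exact (hC x ⟨by linarith, by linarith⟩).trans (le_max_right _ _)
  have dρ : ∀ x, HasDerivAt ρ (Q x - ρ x ^ 2) x := fun x => by
    refine ((d2 x).div (d1 x) (hθ x).ne').congr_deriv ?_
    have := (hθ x).ne'
    simp only [ρ]
    field_simp
  obtain ⟨mV, mV₁⟩ := hu.memLp_wt_self hδ (fun x hx => by linarith [hfar x hx])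
  set V := wt c u
  set V₁ := wt c fun x => u₁ x + c / 2 * u x
  have zr : z = (z.re : ℂ) := Complex.ext rfl (by simpa using hz)
  have hV2 : ∀ x, wt c 0 x + (z - q x + c ^ 2 / 4) * V x = ((z.re + Q x : ℝ) : ℂ) * V x := fun x => by
    have h0 : wt c 0 x = 0 := by simp [wt]
    rw [h0, zero_add]
    conv_lhs => rw [zr]
    simp only [Q]; push_cast; ring
  -- By the Riccati equation, `F = Re (V̄ V') - ρ |V|²` has derivative `|V' - ρ V|² + (Re z) |V|² ≥
  -- 0`. Integrability forces `F = 0`, so both squares vanish.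
  set F : ℝ → ℝ := fun x => ((V x).re * (V₁ x).re + (V x).im * (V₁ x).im) -
    ρ x * ((V x).re * (V x).re + (V x).im * (V x).im)
  set F' : ℝ → ℝ := fun x => ((V₁ x).re - ρ x * (V x).re) ^ 2 + ((V₁ x).im - ρ x * (V x).im) ^ 2 +
    z.re * ((V x).re ^ 2 + (V x).im ^ 2)
  have hF : ∀ x, HasDerivAt F (F' x) x := fun x => by
    have a1 := hasDerivAt_re (hu.hasDerivAt_wt x)
    have b1 := hasDerivAt_im (hu.hasDerivAt_wt x)
    have a2 := hasDerivAt_re (hu.hasDerivAt_wt_deriv x)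
    have b2 := hasDerivAt_im (hu.hasDerivAt_wt_deriv x)
    rw [hV2, Complex.re_ofReal_mul] at a2
    rw [hV2, Complex.im_ofReal_mul] at b2
    refine (((a1.mul a2).add (b1.mul b2)).sub
      ((dρ x).mul ((a1.mul a1).add (b1.mul b1)))).congr_deriv ?_
    simp only [F', Pi.add_apply, Pi.mul_apply]
    change (V₁ x).re * (V₁ x).re + _ + _ - _ = _
    ring
  have hF0 : ∀ x, 0 ≤ F' x := fun x => by positivity
  have hFi : Integrable F := by
    refine ((integrable_re_mul_re mV mV₁).add (integrable_im_mul_im mV mV₁)).sub ?_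
    exact ((integrable_re_mul_re mV mV).add (integrable_im_mul_im mV mV)).bdd_mul
      cρ.aestronglyMeasurable (Eventually.of_forall hρ)
  have hFz := eq_zero_of_deriv_nonneg_of_integrable hF hF0 hFi
  have hF'z : ∀ x, F' x = 0 := fun x => by
    have h1 := hF x
    rw [show F = fun _ => 0 from funext hFz] at h1
    exact h1.unique (hasDerivAt_const x 0)
  have hsplit : ∀ x, V₁ x = ρ x * V x ∧ z.re * ((V x).re ^ 2 + (V x).im ^ 2) = 0 := fun x => by
    have h1 := hF'z x
    have h2 : 0 ≤ ((V₁ x).re - ρ x * (V x).re) ^ 2 := sq_nonneg _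
    have h3 : 0 ≤ ((V₁ x).im - ρ x * (V x).im) ^ 2 := sq_nonneg _
    have h4 : 0 ≤ z.re * ((V x).re ^ 2 + (V x).im ^ 2) := by positivity
    simp only [F'] at h1
    have h5 : (V₁ x).re - ρ x * (V x).re = 0 := pow_eq_zero_iff two_ne_zero |>.1 (by linarith)
    have h6 : (V₁ x).im - ρ x * (V x).im = 0 := pow_eq_zero_iff two_ne_zero |>.1 (by linarith)
    refine ⟨Complex.ext ?_ ?_, by linarith⟩
    · rw [Complex.re_ofReal_mul]; linarith
    · rw [Complex.im_ofReal_mul]; linarith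
  constructor
  · have hu1 : ∀ x, u₁ x = (ψ₁ x / ψ x : ℝ) * u x := fun x => by
      have h1 := (hsplit x).1
      have hex : ((e x : ℝ) : ℂ) ≠ 0 := Complex.ofReal_ne_zero.2 (he x).ne'
      have hρx : ρ x = ψ₁ x / ψ x + c / 2 := by
        have h2 := (he x).ne'
        have h3 := (hpos x).ne'
        simp only [ρ, θ, θ₁]
        field_simp
      have h2 : (e x : ℂ) * (u₁ x + c / 2 * u x) = (e x : ℂ) * (ρ x * u x) :=
        h1.trans (mul_left_comm _ _ _)
      have h3 := mul_left_cancel₀ hex h2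
      rw [hρx, Complex.ofReal_add, add_mul] at h3
      push_cast at h3 ⊢
      linear_combination h3
    have hd : ∀ x, HasDerivAt (fun x => u x / ψ x) 0 x := fun x => by
      have h3 : (ψ x : ℂ) ≠ 0 := Complex.ofReal_ne_zero.2 (hpos x).ne'
      refine ((hu.d1 x).div (hψ.d1 x) h3).congr_deriv ?_
      rw [hu1]
      push_cast
      field_simp
      ring
    refine ⟨u 0 / ψ 0, fun x => ?_⟩
    have h3 : (ψ x : ℂ) ≠ 0 := Complex.ofReal_ne_zero.2 (hpos x).ne'
    have h4 := is_const_of_deriv_eq_zero (fun y => (hd y).differentiableAt)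
      (fun y => (hd y).deriv) x 0
    rw [← h4, div_mul_cancel₀ _ h3]
  · intro hzne x
    have hre : z.re ≠ 0 := fun h => hzne (by rw [zr, h, Complex.ofReal_zero])
    have h1 := ((mul_eq_zero.1 (hsplit x).2).resolve_left hre)
    have h2 : (V x).re = 0 := pow_eq_zero_iff two_ne_zero |>.1
      (by nlinarith [sq_nonneg (V x).re, sq_nonneg (V x).im])
    have h3 : (V x).im = 0 := pow_eq_zero_iff two_ne_zero |>.1
      (by nlinarith [sq_nonneg (V x).re, sq_nonneg (V x).im])
    exact eq_zero_of_wt_eq_zero (Complex.ext h2 h3)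

/-! ### The linearization at the front -/

section FrontFacts

variable {f Φ : ℝ → ℝ} {c : ℝ}

lemma IsWaveFront.hasDerivAt (hΦ : IsWaveFront f c Φ) (x : ℝ) : HasDerivAt Φ (deriv Φ x) x :=
  (hΦ.contDiff.differentiable (by norm_num) x).hasDerivAt

lemma IsWaveFront.hasDerivAt_deriv (hΦ : IsWaveFront f c Φ) (x : ℝ) :
    HasDerivAt (deriv Φ) (deriv (deriv Φ) x) x :=
  (((contDiff_succ_iff_deriv (n := 1)).1 hΦ.contDiff).2.2.differentiable (by norm_num)
    x).hasDerivAt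

/-- Strict monotonicity keeps the front off the endpoints, where only one-sided derivatives of `f`
are available. -/
lemma IsWaveFront.mem_Ioo (hΦ : IsWaveFront f c Φ) (x : ℝ) : Φ x ∈ Ioo (0 : ℝ) 1 := by
  have hm : StrictMono Φ := strictMono_of_deriv_pos hΦ.deriv_pos
  exact ⟨(hΦ.mem_Icc (x - 1)).1.trans_lt (hm (by linarith)),
    (hm (lt_add_one x)).trans_le (hΦ.mem_Icc (x + 1)).2⟩

lemma IsBistable.continuousOn_der (hf : IsBistable f) : ContinuousOn (der f) (Icc 0 1) :=
  hf.contDiffOn.continuousOn_derivWithin (uniqueDiffOn_Icc one_pos) le_rfl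

lemma IsBistable.hasDerivAt (hf : IsBistable f) {t : ℝ} (ht : t ∈ Ioo (0 : ℝ) 1) :
    HasDerivAt f (der f t) t :=
  ((hf.contDiffOn.differentiableOn (by norm_num)) t
    (Ioo_subset_Icc_self ht)).hasDerivWithinAt.hasDerivAt (Icc_mem_nhds ht.1 ht.2)

/-- The coefficient `f'(Φ)`. -/
def coeff (f Φ : ℝ → ℝ) (x : ℝ) : ℝ := der f (Φ x)

lemma continuous_coeff (hf : IsBistable f) (hΦ : IsWaveFront f c Φ) : Continuous (coeff f Φ) :=
  hf.continuousOn_der.comp_continuous hΦ.contDiff.continuous hΦ.mem_Icc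

lemma exists_abs_coeff_le (hf : IsBistable f) (hΦ : IsWaveFront f c Φ) :
    ∃ M, ∀ x, |coeff f Φ x| ≤ M := by
  obtain ⟨C, hC⟩ := isCompact_Icc.exists_bound_of_continuousOn hf.continuousOn_der
  exact ⟨C, fun x => hC _ (hΦ.mem_Icc x)⟩

/-- The coefficient tends to `f'(0)` and `f'(1)` at the two ends; a level strictly between their
maximum and `s` gives a uniform margin. -/
lemma exists_coeff_far (hf : IsBistable f) (hΦ : IsWaveFront f c Φ) {s : ℝ}
    (hs : max (der f 0) (der f 1) < s) :
    ∃ R δ : ℝ, 0 < δ ∧ ∀ x, R ≤ |x| → δ ≤ s - coeff f Φ x := by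
  obtain ⟨t, ht, hts⟩ := exists_between hs
  have hlim : ∀ {l : Filter ℝ} {a : ℝ}, a ∈ Icc (0 : ℝ) 1 → Tendsto Φ l (𝓝 a) →
      der f a < t → ∀ᶠ x in l, coeff f Φ x < t := fun {l a} ha hl hlt => by
    have h1 : Tendsto Φ l (𝓝[Icc 0 1] a) :=
      tendsto_nhdsWithin_iff.2 ⟨hl, Eventually.of_forall hΦ.mem_Icc⟩
    exact ((hf.continuousOn_der a ha).tendsto.comp h1).eventually_lt_const hlt
  have h1 := hlim (by simp) hΦ.tendsto_atTop ((le_max_right _ _).trans_lt ht)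
  have h0 := hlim (by simp) hΦ.tendsto_atBot ((le_max_left _ _).trans_lt ht)
  obtain ⟨a, ha⟩ := eventually_atTop.1 h1
  obtain ⟨b, hb⟩ := eventually_atBot.1 h0
  refine ⟨max a (-b), s - t, by linarith, fun x hx => ?_⟩
  have hxt : coeff f Φ x < t := by
    rcases le_abs.1 hx with h | h
    · exact ha x ((le_max_left _ _).trans h)
    · exact hb x (by linarith [(le_max_right a (-b)).trans h])
  linarith

/-- The second derivative of the front. -/
lemma IsWaveFront.deriv_deriv_eq (hΦ : IsWaveFront f c Φ) (x : ℝ) :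
    deriv (deriv Φ) x = -c * deriv Φ x - f (Φ x) := by linarith [hΦ.ode x]

/-- The front is only assumed `C²`; the equation `Φ'' = -c Φ' - f(Φ)` supplies the third derivative.
-/
lemma IsWaveFront.hasDerivAt_deriv_deriv (hf : IsBistable f) (hΦ : IsWaveFront f c Φ) (x : ℝ) :
    HasDerivAt (deriv (deriv Φ)) (-c * deriv (deriv Φ) x - coeff f Φ x * deriv Φ x) x := by
  rw [show deriv (deriv Φ) = fun x => -c * deriv Φ x - f (Φ x) from funext hΦ.deriv_deriv_eq]
  have h1 := (hf.hasDerivAt (hΦ.mem_Ioo x)).comp x (hΦ.hasDerivAt x)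
  refine (((hΦ.hasDerivAt_deriv x).const_mul (-c)).sub h1).congr_deriv ?_
  change _ = -c * (-c * deriv Φ x - f (Φ x)) - coeff f Φ x * deriv Φ x
  rw [← hΦ.deriv_deriv_eq]
  rfl

lemma IsWaveFront.continuous_deriv (hΦ : IsWaveFront f c Φ) : Continuous (deriv Φ) :=
  continuous_iff_continuousAt.2 fun x => (hΦ.hasDerivAt_deriv x).continuousAt

lemma IsWaveFront.continuous_deriv_deriv (hf : IsBistable f) (hΦ : IsWaveFront f c Φ) :
    Continuous (deriv (deriv Φ)) :=
  continuous_iff_continuousAt.2 fun x => (hΦ.hasDerivAt_deriv_deriv hf x).continuousAt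

lemma IsWaveFront.memLp_deriv (hf : IsBistable f) (hΦ : IsWaveFront f c Φ) :
    MemLp (deriv Φ) 2 volume := by
  simpa using (memLp_frontDeriv hf hΦ).re

lemma IsWaveFront.integrable_deriv_sq (hf : IsBistable f) (hΦ : IsWaveFront f c Φ) :
    Integrable fun x => deriv Φ x ^ 2 :=
  (memLp_two_iff_integrable_sq hΦ.continuous_deriv.aestronglyMeasurable).1 (hΦ.memLp_deriv hf)

/-- The bounded function `G = Φ' Φ'' + (c/2) Φ'²` has derivative `Φ''² - f'(Φ) Φ'²`. Integrating
over `[-n, n]` bounds the mass of `Φ''²` uniformly in `n`. -/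
lemma IsWaveFront.memLp_deriv_deriv (hf : IsBistable f) (hΦ : IsWaveFront f c Φ) :
    MemLp (deriv (deriv Φ)) 2 volume := by
  set ψ := deriv Φ
  set ψ₁ := deriv (deriv Φ)
  have cψ : Continuous ψ := hΦ.continuous_deriv
  have cψ₁ : Continuous ψ₁ := hΦ.continuous_deriv_deriv hf
  rw [memLp_two_iff_integrable_sq cψ₁.aestronglyMeasurable]
  obtain ⟨B, hB⟩ := exists_deriv_le hf hΦ
  obtain ⟨K, hK⟩ := isCompact_Icc.exists_bound_of_continuousOn hf.contDiffOn.continuousOn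
  obtain ⟨M, hM⟩ := exists_abs_coeff_le hf hΦ
  have hB0 : 0 ≤ B := (hΦ.deriv_pos 0).le.trans (hB 0)
  have hψ : ∀ x, |ψ x| ≤ B := fun x => by rw [abs_of_pos (hΦ.deriv_pos x)]; exact hB x
  have hψ₁ : ∀ x, |ψ₁ x| ≤ |c| * B + K := fun x => by
    have h1 : ψ₁ x = -c * ψ x - f (Φ x) := hΦ.deriv_deriv_eq x
    rw [h1]
    refine (abs_sub _ _).trans (add_le_add ?_ (hK _ (hΦ.mem_Icc x)))
    rw [abs_mul, abs_neg]
    exact mul_le_mul_of_nonneg_left (hψ x) (abs_nonneg c)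
  set G : ℝ → ℝ := fun x => ψ x * ψ₁ x + c / 2 * ψ x ^ 2
  have hG : ∀ x, HasDerivAt G (ψ₁ x ^ 2 - coeff f Φ x * ψ x ^ 2) x := fun x => by
    refine (((hΦ.hasDerivAt_deriv x).mul (hΦ.hasDerivAt_deriv_deriv hf x)).add
      (((hΦ.hasDerivAt_deriv x).pow 2).const_mul (c / 2))).congr_deriv ?_
    simp only [ψ, ψ₁]
    push_cast
    ring
  set L : ℝ := B * (|c| * B + K) + |c| / 2 * B ^ 2
  have hGb : ∀ x, |G x| ≤ L := fun x => by
    refine (abs_add_le _ _).trans (add_le_add ?_ ?_)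
    · rw [abs_mul]
      exact mul_le_mul (hψ x) (hψ₁ x) (abs_nonneg _) hB0
    · rw [abs_mul, abs_div, abs_two, abs_pow]
      exact mul_le_mul_of_nonneg_left (pow_le_pow_left₀ (abs_nonneg _) (hψ x) 2) (by positivity)
  have iq : Integrable fun x => coeff f Φ x * ψ x ^ 2 :=
    (hΦ.integrable_deriv_sq hf).bdd_mul (continuous_coeff hf hΦ).aestronglyMeasurable
      (Eventually.of_forall hM)
  have cq := continuous_coeff hf hΦ
  refine integrable_of_intervalIntegral_norm_bounded (l := atTop) (a := fun n : ℝ => -n)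
    (b := fun n => n) (2 * L + ∫ x, |coeff f Φ x * ψ x ^ 2|)
    (fun n => (cψ₁.pow 2).integrableOn_Ioc) tendsto_neg_atTop_atBot tendsto_id ?_
  filter_upwards [eventually_ge_atTop 0] with n hn
  have e1 : ∫ x in (-n)..n, ‖ψ₁ x ^ 2‖ =
      (∫ x in (-n)..n, (ψ₁ x ^ 2 - coeff f Φ x * ψ x ^ 2)) +
        ∫ x in (-n)..n, coeff f Φ x * ψ x ^ 2 := by
    have c1 : Continuous fun x => ψ₁ x ^ 2 - coeff f Φ x * ψ x ^ 2 := by fun_prop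
    have c2 : Continuous fun x => coeff f Φ x * ψ x ^ 2 := by fun_prop
    rw [← intervalIntegral.integral_add (c1.intervalIntegrable _ _) (c2.intervalIntegrable _ _)]
    refine intervalIntegral.integral_congr fun x _ => ?_
    simp
  have e2 : ∫ x in (-n)..n, (ψ₁ x ^ 2 - coeff f Φ x * ψ x ^ 2) = G n - G (-n) := by
    have c1 : Continuous fun x => ψ₁ x ^ 2 - coeff f Φ x * ψ x ^ 2 := by fun_prop
    exact intervalIntegral.integral_eq_sub_of_hasDerivAt (fun x _ => hG x)
      (c1.intervalIntegrable _ _)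
  have h3 : ∫ x in (-n)..n, coeff f Φ x * ψ x ^ 2 ≤ ∫ x, |coeff f Φ x * ψ x ^ 2| := by
    rw [intervalIntegral.integral_of_le (by linarith)]
    refine (setIntegral_mono iq.integrableOn iq.abs.integrableOn fun x => le_abs_self _).trans ?_
    exact setIntegral_le_integral iq.abs (Eventually.of_forall fun x => abs_nonneg _)
  rw [e1, e2]
  have h4 := abs_le.1 (hGb n)
  have h5 := abs_le.1 (hGb (-n))
  linarith [h4.2, h5.1]

/-! ### Integral identities for the front and its speed. -/

lemma IsWaveFront.integral_deriv_mul_deriv_deriv (hf : IsBistable f) (hΦ : IsWaveFront f c Φ) :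
    ∫ x, deriv Φ x * deriv (deriv Φ) x = 0 := by
  refine integral_eq_zero_of_hasDerivAt_of_integrable (f := fun x => deriv Φ x ^ 2 / 2)
    (fun x => (((hΦ.hasDerivAt_deriv x).pow 2).div_const 2).congr_deriv (by push_cast; ring))
    (MemLp.integrable_mul (p := 2) (q := 2) (hΦ.memLp_deriv hf) (hΦ.memLp_deriv_deriv hf))
    ((hΦ.integrable_deriv_sq hf).div_const 2)

lemma IsWaveFront.integral_comp_mul_deriv (hf : IsBistable f) (hΦ : IsWaveFront f c Φ) :
    Integrable (fun x => f (Φ x) * deriv Φ x) ∧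
      ∫ x, f (Φ x) * deriv Φ x = ∫ s in (0 : ℝ)..1, f s := by
  have hcf := hf.contDiffOn.continuousOn
  -- Constant extension beyond `[0, 1]` gives `f` a primitive differentiable everywhere, including
  -- at the limiting values `0` and `1`.
  set F : ℝ → ℝ := IccExtend (zero_le_one (α := ℝ)) ((Icc (0 : ℝ) 1).domRestrict f)
  have cF : Continuous F := (continuousOn_iff_continuous_domRestrict.1 hcf).Icc_extend'
  have hF : ∀ t ∈ Icc (0 : ℝ) 1, F t = f t := fun t ht => by
    simp only [F]
    rw [IccExtend_of_mem _ _ ht]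
    rfl
  obtain ⟨K, hK⟩ := isCompact_Icc.exists_bound_of_continuousOn hcf
  set A : ℝ → ℝ := fun t => ∫ s in (0 : ℝ)..t, F s
  have hA : ∀ t, HasDerivAt A (F t) t := fun t => (cF.integral_hasStrictDerivAt 0 t).hasDerivAt
  have cA : Continuous A := continuous_iff_continuousAt.2 fun t => (hA t).continuousAt
  have hd : ∀ x, HasDerivAt (fun x => A (Φ x)) (f (Φ x) * deriv Φ x) x := fun x => by
    have h := (hA (Φ x)).comp x (hΦ.hasDerivAt x)
    rw [hF _ (hΦ.mem_Icc x)] at h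
    exact h
  have hi : Integrable (fun x => f (Φ x) * deriv Φ x) :=
    (integrable_deriv hΦ).bdd_mul
      (hcf.comp_continuous hΦ.contDiff.continuous hΦ.mem_Icc).aestronglyMeasurable
      (Eventually.of_forall fun x => hK _ (hΦ.mem_Icc x))
  refine ⟨hi, ?_⟩
  rw [integral_of_hasDerivAt_of_tendsto hd hi ((cA.tendsto 0).comp hΦ.tendsto_atBot)
    ((cA.tendsto 1).comp hΦ.tendsto_atTop)]
  simp only [A, intervalIntegral.integral_same, sub_zero]
  refine intervalIntegral.integral_congr fun t ht => ?_
  rw [uIcc_of_le zero_le_one] at ht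
  exact hF t ht

lemma IsWaveFront.normSqDeriv_pos (hf : IsBistable f) (hΦ : IsWaveFront f c Φ) :
    0 < normSqDeriv Φ := by
  rw [normSqDeriv, integral_pos_iff_support_of_nonneg (fun x => sq_nonneg _)
    (hΦ.integrable_deriv_sq hf)]
  have : Function.support (fun x => deriv Φ x ^ 2) = univ := by
    ext x
    simp [(hΦ.deriv_pos x).ne']
  rw [this]
  simp

/-- The functional `λ` recovers the speed of the front. -/
lemma IsWaveFront.lam_eq (hf : IsBistable f) (hΦ : IsWaveFront f c Φ) : lam f Φ = c := by
  obtain ⟨hi, hint⟩ := hΦ.integral_comp_mul_deriv hf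
  have h1 : f ∘ Φ = fun x => -deriv (deriv Φ) x - c * deriv Φ x := by
    funext x
    simp only [Function.comp]
    linarith [hΦ.ode x]
  have h2 : ∫ x, f (Φ x) * deriv Φ x = -(c * normSqDeriv Φ) := by
    have e : (fun x => f (Φ x) * deriv Φ x) =
        fun x => -(deriv Φ x * deriv (deriv Φ) x) - c * deriv Φ x ^ 2 := by
      funext x
      have := congrFun h1 x
      simp only [Function.comp] at this
      rw [this]; ring
    have i1 : Integrable fun x => deriv Φ x * deriv (deriv Φ) x :=
      MemLp.integrable_mul (p := 2) (q := 2) (hΦ.memLp_deriv hf) (hΦ.memLp_deriv_deriv hf)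
    have i2 : Integrable fun x => -(deriv Φ x * deriv (deriv Φ) x) := i1.neg
    rw [e, integral_sub i2 ((hΦ.integrable_deriv_sq hf).const_mul c), integral_neg,
      hΦ.integral_deriv_mul_deriv_deriv hf, integral_const_mul, normSqDeriv]
    ring
  rw [lam, ← hint, h2, neg_neg, mul_div_assoc, div_self (hΦ.normSqDeriv_pos hf).ne', mul_one]

lemma memLp_coeff_mul (hf : IsBistable f) (hΦ : IsWaveFront f c Φ) {g : ℝ → ℂ}
    (hg : MemLp g 2 volume) : MemLp (fun x => (coeff f Φ x : ℂ) * g x) 2 volume :=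
  hg.mul (r := 2) (memLp_coeff hf hΦ)

/-- The derivative of the front is a null solution of the linearized equation. -/
lemma IsWaveFront.sol (hf : IsBistable f) (hΦ : IsWaveFront f c Φ) :
    Sol c (coeff f Φ) 0 0 (fun x => ((deriv Φ x : ℝ) : ℂ))
      (fun x => ((deriv (deriv Φ) x : ℝ) : ℂ))
      (fun x => ((-c * deriv (deriv Φ) x - coeff f Φ x * deriv Φ x : ℝ) : ℂ)) where
  d1 x := (hΦ.hasDerivAt_deriv x).ofReal_comp
  d2 x := (hΦ.hasDerivAt_deriv_deriv hf x).ofReal_comp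
  ode x := by push_cast; rw [Pi.zero_apply]; ring
  memLp := memLp_frontDeriv hf hΦ
  memLp_deriv := (hΦ.memLp_deriv_deriv hf).ofReal

/-- `Φ''` as an element of `L²(ℝ)`. -/
def frontDeriv₂ (hf : IsBistable f) (hΦ : IsWaveFront f c Φ) : L2 :=
  (hΦ.sol hf).memLp_deriv.toLp

lemma memLp_frontDeriv₃ (hf : IsBistable f) (hΦ : IsWaveFront f c Φ) :
    MemLp (fun x => ((-c * deriv (deriv Φ) x - coeff f Φ x * deriv Φ x : ℝ) : ℂ)) 2 volume := by
  refine (((hΦ.sol hf).memLp_deriv.const_mul (-c : ℂ)).sub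
    (memLp_coeff_mul hf hΦ (hΦ.sol hf).memLp)).ae_eq (Eventually.of_forall fun x => ?_)
  simp

lemma isWeakDeriv_frontDeriv (hf : IsBistable f) (hΦ : IsWaveFront f c Φ) :
    IsWeakDeriv (frontDeriv hf hΦ) (frontDeriv₂ hf hΦ) :=
  isWeakDeriv_toLp (hΦ.sol hf).d1 (hΦ.sol hf).continuous_deriv _ _

lemma isWeakDeriv_frontDeriv₂ (hf : IsBistable f) (hΦ : IsWaveFront f c Φ) :
    IsWeakDeriv (frontDeriv₂ hf hΦ) (memLp_frontDeriv₃ hf hΦ).toLp := by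
  have h1 := hΦ.continuous_deriv_deriv hf
  have h2 := hΦ.continuous_deriv
  have h3 := continuous_coeff hf hΦ
  exact isWeakDeriv_toLp (hΦ.sol hf).d2 (Complex.continuous_ofReal.comp (by fun_prop)) _ _

/-- Multiplication by `f'(Φ)` as a bounded operator. -/
def mulCoeffL (hf : IsBistable f) (hΦ : IsWaveFront f c Φ) : L2 →L[ℂ] L2 :=
  (mulCoeff hf hΦ).mkContinuous ‖(memLp_coeff hf hΦ).toLp‖ fun u => Lp.norm_smul_le (r := 2) _ u

lemma mulCoeffL_ae (hf : IsBistable f) (hΦ : IsWaveFront f c Φ) (u : L2) :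
    ∀ᵐ x, mulCoeffL hf hΦ u x = coeff f Φ x * u x := by
  have h : mulCoeffL hf hΦ u = (memLp_coeff hf hΦ).toLp • u := rfl
  rw [h]
  filter_upwards [Lp.coeFn_lpSMul (r := 2) (memLp_coeff hf hΦ).toLp u, (memLp_coeff hf hΦ).coeFn_toLp]
    with x h1 h2
  rw [h1, Pi.smul_apply', h2]
  rfl

lemma shift_localMap (hf : IsBistable f) (hΦ : IsWaveFront f c Φ) (z : ℂ) :
    shift (localMap hf hΦ) z =
      ellipticMap c (mulCoeffL hf hΦ - z • ContinuousLinearMap.id ℂ L2) := by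
  ext1 w
  have h1 : localMap hf hΦ w = D2 w + (lam f Φ : ℂ) • D1 w + mulCoeffL hf hΦ w := rfl
  have h2 : (mulCoeffL hf hΦ - z • ContinuousLinearMap.id ℂ L2) (w : L2) =
    mulCoeffL hf hΦ w - z • (w : L2) := rfl
  rw [shift_apply, h1, hΦ.lam_eq hf, ellipticMap_apply, h2]
  abel

lemma hasParametrix_shift_localMap (hf : IsBistable f) (hΦ : IsWaveFront f c Φ) {z : ℂ}
    (hz : max (der f 0) (der f 1) < z.re) : HasParametrix (shift (localMap hf hΦ) z) := by
  obtain ⟨R, δ, hδ, hfar⟩ := exists_coeff_far hf hΦ hz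
  obtain ⟨M, hM⟩ := exists_abs_coeff_le hf hΦ
  obtain ⟨F, hF, B, hB⟩ := exists_finiteRank_isBoundedInverse c (continuous_coeff hf hΦ) hM
    (mulCoeffL_ae hf hΦ) z hδ (fun x hx => by linarith [hfar x hx])
  refine ⟨F, hF, B, ?_⟩
  have e : perturb (shift (localMap hf hΦ) z) (-F) =
      ellipticMap c (mulCoeffL hf hΦ - z • ContinuousLinearMap.id ℂ L2 - F) := by
    rw [shift_localMap]
    ext1 w
    rw [perturb_apply, ellipticMap_apply, ellipticMap_apply, _root_.neg_apply, _root_.sub_apply _ F]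
    abel
  rwa [e]

/-- Elements of `H²(ℝ)` solving the resolvent equation with continuous right-hand side are
classical solutions. -/
lemma exists_sol (hf : IsBistable f) (hΦ : IsWaveFront f c Φ) {z : ℂ} {w : H2} {h : L2}
    {g : ℝ → ℂ} (hw : shift (localMap hf hΦ) z w = h) (hg : Continuous g) (hgh : ∀ᵐ x, h x = g x) :
    ∃ W W₁ W₂ : ℝ → ℂ, (∀ᵐ x, (w : L2) x = W x) ∧ Sol c (coeff f Φ) z g W W₁ W₂ := by
  obtain ⟨W, hW, hW'⟩ := (isWeakDeriv_D1 w).exists_isPrimitive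
  obtain ⟨W₁, hW₁, hW₁'⟩ := (isWeakDeriv_D2 w).exists_isPrimitive
  -- Solving the equation for the second derivative provides a continuous representative of it, so
  -- the absolutely continuous representative `W₁` is in fact `C¹`.
  set W₂ : ℝ → ℂ := fun x => g x - c * W₁ x - (coeff f Φ x - z) * W x
  have hcq := continuous_coeff hf hΦ
  have hcW := hW.continuous
  have hcW₁ := hW₁.continuous
  have hc₂ : Continuous W₂ := by fun_prop
  have h2 : ∀ᵐ x, D2 w x = W₂ x := by
    rw [shift_localMap, ellipticMap_apply] at hw
    have e : D2 w = h - (c : ℂ) • D1 w - (mulCoeffL hf hΦ (w : L2) - z • (w : L2)) := by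
      rw [← hw]
      have : (mulCoeffL hf hΦ - z • ContinuousLinearMap.id ℂ L2) (w : L2) =
        mulCoeffL hf hΦ w - z • (w : L2) := rfl
      rw [this]
      abel
    rw [e]
    filter_upwards [Lp.coeFn_sub (h - (c : ℂ) • D1 w) (mulCoeffL hf hΦ (w : L2) - z • (w : L2)),
      Lp.coeFn_sub h ((c : ℂ) • D1 w), Lp.coeFn_sub (mulCoeffL hf hΦ (w : L2)) (z • (w : L2)),
      Lp.coeFn_smul (c : ℂ) (D1 w), Lp.coeFn_smul z (w : L2), mulCoeffL_ae hf hΦ w, hgh, hW', hW₁']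
      with x a1 a2 a3 a4 a5 a6 a7 a8 a9
    rw [a1, Pi.sub_apply, a2, Pi.sub_apply, a3, Pi.sub_apply, a4, Pi.smul_apply, a5, Pi.smul_apply,
      a6, a7, a8, a9, smul_eq_mul, smul_eq_mul]
    simp only [W₂]
    ring
  have pW : IsPrimitive W W₁ := ⟨hcW₁.locallyIntegrable, fun x y => by
    rw [hW.2 x y]
    exact intervalIntegral.integral_congr_ae (hW₁'.mono fun t ht _ => ht)⟩
  have pW₁ : IsPrimitive W₁ W₂ := ⟨hc₂.locallyIntegrable, fun x y => by
    rw [hW₁.2 x y]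
    exact intervalIntegral.integral_congr_ae (h2.mono fun t ht _ => ht)⟩
  exact ⟨W, W₁, W₂, hW',
    { d1 := pW.hasDerivAt hcW₁
      d2 := pW₁.hasDerivAt hc₂
      ode := fun x => by simp only [W₂]; ring
      memLp := (Lp.memLp (w : L2)).ae_eq hW'
      memLp_deriv := (Lp.memLp (D1 w)).ae_eq hW₁' }⟩

end FrontFacts

/-! ### Spectral analysis of the linearized operators -/

section SpectralAnalysis

variable {f Φ : ℝ → ℝ} {c : ℝ}

lemma frontDeriv_ne_zero (hf : IsBistable f) (hΦ : IsWaveFront f c Φ) : frontDeriv hf hΦ ≠ 0 := by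
  intro h0
  have h1 := L2.norm_sq_eq (frontDeriv hf hΦ)
  rw [h0, norm_zero, ← h0] at h1
  have h2 : ∫ x, ‖frontDeriv hf hΦ x‖ ^ 2 = normSqDeriv Φ := by
    refine integral_congr_ae ?_
    filter_upwards [(memLp_frontDeriv hf hΦ).coeFn_toLp] with x hx
    rw [frontDeriv, hx, Complex.norm_real, Real.norm_eq_abs, sq_abs]
  rw [h2] at h1
  have := hΦ.normSqDeriv_pos hf
  norm_num at h1
  linarith

/-- `Φ'` belongs to `H²(ℝ)` and is annihilated by the local operator. -/
lemma exists_front_H2 (hf : IsBistable f) (hΦ : IsWaveFront f c Φ) :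
    ∃ e : H2, (e : L2) = frontDeriv hf hΦ ∧ localMap hf hΦ e = 0 := by
  obtain ⟨e, he, he1, he2⟩ := exists_H2 (isWeakDeriv_frontDeriv hf hΦ)
    (isWeakDeriv_frontDeriv₂ hf hΦ)
  refine ⟨e, he, ?_⟩
  have h1 : localMap hf hΦ e = D2 e + (lam f Φ : ℂ) • D1 e + mulCoeffL hf hΦ e := rfl
  rw [h1, hΦ.lam_eq hf, he, he1, he2]
  refine Lp.ext ?_
  filter_upwards [Lp.coeFn_add ((memLp_frontDeriv₃ hf hΦ).toLp + (c : ℂ) • frontDeriv₂ hf hΦ)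
      (mulCoeffL hf hΦ (frontDeriv hf hΦ)),
    Lp.coeFn_add (memLp_frontDeriv₃ hf hΦ).toLp ((c : ℂ) • frontDeriv₂ hf hΦ),
    Lp.coeFn_smul (c : ℂ) (frontDeriv₂ hf hΦ), mulCoeffL_ae hf hΦ (frontDeriv hf hΦ),
    (memLp_frontDeriv hf hΦ).coeFn_toLp, (hΦ.sol hf).memLp_deriv.coeFn_toLp,
    (memLp_frontDeriv₃ hf hΦ).coeFn_toLp, Lp.coeFn_zero ℂ 2 (volume : Measure ℝ)]
    with x a1 a2 a3 a4 a5 a6 a7 a8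
  rw [a1, Pi.add_apply, a2, Pi.add_apply, a3, Pi.smul_apply, a4, a7, a8, frontDeriv, a5,
    frontDeriv₂, a6, smul_eq_mul, Pi.zero_apply]
  push_cast
  ring

/-- The bounded extension to `L²(ℝ)` of the nonlocal functional. -/
def functionalL (hf : IsBistable f) (hΦ : IsWaveFront f c Φ) : L2 →L[ℂ] ℂ :=
  -((-2 * lam f Φ / normSqDeriv Φ : ℝ) : ℂ) • innerSL ℂ (frontDeriv₂ hf hΦ)

/-- Integration by parts moves the derivative onto `Φ'`, making the nonlocal term bounded on `L²`.
-/
lemma nonlocalFunctional_eq (hf : IsBistable f) (hΦ : IsWaveFront f c Φ) (w : H2) :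
    nonlocalFunctional hf hΦ w = functionalL hf hΦ w := by
  have h1 : nonlocalFunctional hf hΦ w =
    ((-2 * lam f Φ / normSqDeriv Φ : ℝ) : ℂ) * inner ℂ (frontDeriv hf hΦ) (D1 w) := rfl
  have h2 : functionalL hf hΦ w =
    -((-2 * lam f Φ / normSqDeriv Φ : ℝ) : ℂ) * inner ℂ (frontDeriv₂ hf hΦ) (w : L2) := rfl
  rw [h1, h2, (isWeakDeriv_frontDeriv hf hΦ).inner_eq_neg (isWeakDeriv_D1 w)]
  ring

/-- `Φ'` and `Φ''` are orthogonal. This puts `Φ'` in the kernel of `L` and makes the rank-one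
correction of the resolvent explicit. -/
lemma functionalL_frontDeriv (hf : IsBistable f) (hΦ : IsWaveFront f c Φ) :
    functionalL hf hΦ (frontDeriv hf hΦ) = 0 := by
  have h2 : functionalL hf hΦ (frontDeriv hf hΦ) =
    -((-2 * lam f Φ / normSqDeriv Φ : ℝ) : ℂ) *
      inner ℂ (frontDeriv₂ hf hΦ) (frontDeriv hf hΦ) := rfl
  have h3 : inner ℂ (frontDeriv₂ hf hΦ) (frontDeriv hf hΦ) =
      ((∫ x, deriv Φ x * deriv (deriv Φ) x : ℝ) : ℂ) := by
    rw [L2.inner_eq, ← integral_complex_ofReal]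
    refine integral_congr_ae ?_
    filter_upwards [(memLp_frontDeriv hf hΦ).coeFn_toLp, (hΦ.sol hf).memLp_deriv.coeFn_toLp]
      with x a1 a2
    rw [frontDeriv, a1, frontDeriv₂, a2, Complex.conj_ofReal]
    push_cast
    ring
  rw [h2, h3, hΦ.integral_deriv_mul_deriv_deriv hf, Complex.ofReal_zero, mul_zero]

/-- The nonlocal operator as a linear map on `H²(ℝ)`. -/
def nonlocalMap (hf : IsBistable f) (hΦ : IsWaveFront f c Φ) : H2 →ₗ[ℂ] L2 :=
  localMap hf hΦ + (nonlocalFunctional hf hΦ).smulRight (frontDeriv hf hΦ)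

lemma nonlocalMap_apply (hf : IsBistable f) (hΦ : IsWaveFront f c Φ) (w : H2) :
    nonlocalMap hf hΦ w = localMap hf hΦ w + functionalL hf hΦ w • frontDeriv hf hΦ := by
  rw [← nonlocalFunctional_eq]
  rfl

lemma shift_nonlocalMap_apply (hf : IsBistable f) (hΦ : IsWaveFront f c Φ) (z : ℂ) (w : H2) :
    shift (nonlocalMap hf hΦ) z w =
      shift (localMap hf hΦ) z w + functionalL hf hΦ w • frontDeriv hf hΦ := by
  rw [shift_apply, shift_apply, nonlocalMap_apply]
  abel

lemma spectrum_nonlocalOp (hf : IsBistable f) (hΦ : IsWaveFront f c Φ) :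
    spectrum (nonlocalOp hf hΦ) = spectrum (localOp hf hΦ) := by
  obtain ⟨e, he, he'⟩ := exists_front_H2 hf hΦ
  refine spectrum_eq_of_rankOne (S := localMap hf hΦ) (S' := nonlocalMap hf hΦ)
    (ρ := functionalL hf hΦ) (e := e) (fun w => ?_) he' ?_ ?_
  · rw [he, nonlocalMap_apply]
  · rw [he]; exact frontDeriv_ne_zero hf hΦ
  · rw [he, functionalL_frontDeriv]

lemma hasParametrix_shift_nonlocalMap (hf : IsBistable f) (hΦ : IsWaveFront f c Φ) {z : ℂ}
    (hz : max (der f 0) (der f 1) < z.re) : HasParametrix (shift (nonlocalMap hf hΦ) z) := by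
  set G : L2 →L[ℂ] L2 := (functionalL hf hΦ).smulRight (frontDeriv hf hΦ)
  have hG : FiniteDimensional ℂ G.range := by
    have hle : G.range ≤ Submodule.span ℂ {frontDeriv hf hΦ} := by
      rintro _ ⟨u, rfl⟩
      exact Submodule.mem_span_singleton.2 ⟨functionalL hf hΦ u, rfl⟩
    exact Submodule.finiteDimensional_of_le hle
  have e : shift (nonlocalMap hf hΦ) z = perturb (shift (localMap hf hΦ) z) G := by
    ext1 w
    exact shift_nonlocalMap_apply hf hΦ z w
  rw [e]
  exact (hasParametrix_shift_localMap hf hΦ hz).perturb hG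

lemma eq_zero_of_ae_of_forall {u : L2} {U : ℝ → ℂ} (h : ∀ᵐ x, u x = U x) (h0 : ∀ x, U x = 0) :
    u = 0 := by
  refine Lp.ext ?_
  filter_upwards [h, Lp.coeFn_zero ℂ 2 (volume : Measure ℝ)] with x h1 h2
  rw [h1, h2, h0, Pi.zero_apply]

lemma ae_zero_L2 : ∀ᵐ x, (0 : L2) x = (0 : ℝ → ℂ) x := Lp.coeFn_zero ℂ 2 (volume : Measure ℝ)

/-- The local operator has no Jordan blocks to the right of the essential spectrum. -/
lemma shift_localMap_semisimple (hf : IsBistable f) (hΦ : IsWaveFront f c Φ) {z : ℂ}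
    (hz : max (der f 0) (der f 1) < z.re) {w : H2}
    (hw : shift (localMap hf hΦ) z w ∈ kerL2 (shift (localMap hf hΦ) z)) :
    shift (localMap hf hΦ) z w = 0 := by
  obtain ⟨R, δ, hδ, hfar⟩ := exists_coeff_far hf hΦ hz
  obtain ⟨e, he, hew⟩ := mem_kerL2.1 hw
  obtain ⟨U, U₁, U₂, hU, hUs⟩ := exists_sol hf hΦ he continuous_zero ae_zero_L2
  obtain ⟨W, W₁, W₂, hW, hWs⟩ := exists_sol hf hΦ hew.symm hUs.continuous hU
  rw [← hew]
  exact eq_zero_of_ae_of_forall hU (hWs.eq_zero_of_chain hUs hδ hfar)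

lemma eq_zero_of_shift_localMap_of_im_ne_zero (hf : IsBistable f) (hΦ : IsWaveFront f c Φ) {z : ℂ}
    (hz : max (der f 0) (der f 1) < z.re) (him : z.im ≠ 0) {w : H2}
    (hw : shift (localMap hf hΦ) z w = 0) : (w : L2) = 0 := by
  obtain ⟨R, δ, hδ, hfar⟩ := exists_coeff_far hf hΦ hz
  obtain ⟨U, U₁, U₂, hU, hUs⟩ := exists_sol hf hΦ hw continuous_zero ae_zero_L2
  exact eq_zero_of_ae_of_forall hU (hUs.eq_zero_of_im_ne_zero hδ hfar him)

lemma IsBistable.max_neg (hf : IsBistable f) : max (der f 0) (der f 1) < 0 :=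
  max_lt hf.der_zero_neg hf.der_one_neg

lemma shift_localMap_ground_state (hf : IsBistable f) (hΦ : IsWaveFront f c Φ) {z : ℂ}
    (hz : 0 ≤ z.re) (him : z.im = 0) {w : H2} (hw : shift (localMap hf hΦ) z w = 0) :
    (w : L2) ∈ Submodule.span ℂ {frontDeriv hf hΦ} ∧ (z ≠ 0 → (w : L2) = 0) := by
  obtain ⟨R, δ, hδ, hfar⟩ := exists_coeff_far hf hΦ hf.max_neg
  obtain ⟨M, hM⟩ := exists_abs_coeff_le hf hΦ
  obtain ⟨U, U₁, U₂, hU, hUs⟩ := exists_sol hf hΦ hw continuous_zero ae_zero_L2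
  obtain ⟨⟨a, ha⟩, h0⟩ := (hΦ.sol hf).ground_state hΦ.deriv_pos hUs him hz hδ
    (fun x hx => by linarith [hfar x hx]) hM
  refine ⟨Submodule.mem_span_singleton.2 ⟨a, Lp.ext ?_⟩,
    fun hne => eq_zero_of_ae_of_forall hU (h0 hne)⟩
  filter_upwards [hU, Lp.coeFn_smul a (frontDeriv hf hΦ), (memLp_frontDeriv hf hΦ).coeFn_toLp]
    with x h1 h2 h3
  rw [h1, h2, Pi.smul_apply, frontDeriv, h3, ha, smul_eq_mul]

lemma kerL2_shift_zero (hf : IsBistable f) (hΦ : IsWaveFront f c Φ) :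
    kerL2 (shift (localMap hf hΦ) 0) = Submodule.span ℂ {frontDeriv hf hΦ} := by
  obtain ⟨e, he, he'⟩ := exists_front_H2 hf hΦ
  refine le_antisymm ?_ ?_
  · rintro _ ⟨w, hw, rfl⟩
    exact (shift_localMap_ground_state hf hΦ (z := 0) le_rfl rfl hw).1
  · rw [Submodule.span_singleton_le_iff_mem, ← he, coe_mem_kerL2, shift_apply, he', zero_smul,
      sub_zero]

/-- Without an eigenvector the Fredholm alternative would produce a bounded inverse. -/
lemma exists_eigenvector_of_mem_spectrum {S : H2 →ₗ[ℂ] L2} {z : ℂ} (h : HasParametrix (shift S z))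
    (hz : z ∈ spectrum (opOf S)) : ∃ w : H2, (w : L2) ≠ 0 ∧ shift S z w = 0 := by
  by_contra! hne
  refine hz ((mem_resolventSet_iff S z).2 (h.exists_isBoundedInverse fun w hw => ?_))
  by_contra h0
  exact hne w h0 hw

/-- Spectral points to the right of the essential spectrum are isolated. -/
lemma exists_spectrum_inter_ball (hf : IsBistable f) (hΦ : IsWaveFront f c Φ) {z₀ : ℂ}
    (hz₀ : max (der f 0) (der f 1) < z₀.re) (hmem : z₀ ∈ spectrum (localOp hf hΦ)) :
    ∃ r > 0, spectrum (localOp hf hΦ) ∩ Metric.ball z₀ r = {z₀} := by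
  obtain ⟨r, hr, hiso⟩ := exists_isolated (hasParametrix_shift_localMap hf hΦ hz₀)
    (fun w hw => shift_localMap_semisimple hf hΦ hz₀ hw)
  set m := max (der f 0) (der f 1)
  -- The radius is capped by the distance to the line `Re z = m`, so that every spectral point in
  -- the ball is an eigenvalue.
  have hr' : 0 < min r (z₀.re - m) := lt_min hr (by linarith)
  refine ⟨min r (z₀.re - m), hr', Subset.antisymm ?_ ?_⟩
  · rintro z ⟨hz, hzb⟩
    rw [mem_ball_iff_norm] at hzb
    by_contra hne
    have h1 : |(z - z₀).re| ≤ ‖z - z₀‖ := Complex.abs_re_le_norm _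
    rw [Complex.sub_re] at h1
    have h2 := (abs_le.1 h1).1
    have h3 := hzb.trans_le (min_le_right _ _)
    obtain ⟨w, hw0, hw⟩ := exists_eigenvector_of_mem_spectrum
      (hasParametrix_shift_localMap hf hΦ (z := z) (by linarith)) hz
    exact hw0 (hiso z (hzb.trans_le (min_le_left _ _)) hne w hw)
  · rintro _ rfl
    exact ⟨hmem, Metric.mem_ball_self hr'⟩

/-! ### Root spaces, essential spectrum and spectral gap of the nonlocal operator. -/

lemma mem_kerPow_succ {S : H2 →ₗ[ℂ] L2} {z : ℂ} {n : ℕ} {x : L2} :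
    x ∈ kerPow (opOf S) z (n + 1) ↔ ∃ w : H2, shift S z w ∈ kerPow (opOf S) z n ∧ (w : L2) = x :=
  Iff.rfl

/-- The root subspaces of the nonlocal operator to the right of the essential spectrum. -/
lemma kerPow_nonlocalMap_le (hf : IsBistable f) (hΦ : IsWaveFront f c Φ) {z : ℂ}
    (hz : max (der f 0) (der f 1) < z.re) (n : ℕ) :
    kerPow (opOf (nonlocalMap hf hΦ)) z n ≤
      kerL2 (shift (localMap hf hΦ) z) ⊔ Submodule.span ℂ {frontDeriv hf hΦ} := by
  obtain ⟨e, he, he'⟩ := exists_front_H2 hf hΦ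
  set K := kerL2 (shift (localMap hf hΦ) z)
  set X := K ⊔ Submodule.span ℂ {frontDeriv hf hΦ}
  have hψX : frontDeriv hf hΦ ∈ X :=
    Submodule.mem_sup_right (Submodule.mem_span_singleton_self _)
  -- `X` contains every preimage of its elements under `L₀ - z`. For `z = 0` it equals the kernel
  -- and semisimplicity suffices; otherwise `(L₀ - z) Φ' = -z Φ'`, so adding `(a / z) Φ'` to `w`
  -- first removes the `Φ'` component of the image.
  have key : ∀ w : H2, shift (localMap hf hΦ) z w ∈ X → (w : L2) ∈ X := fun w hw => by
    by_cases hz0 : z = 0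
    · have hXK : X ≤ K := by
        refine sup_le le_rfl ?_
        simp only [K, hz0, kerL2_shift_zero, le_refl]
      exact Submodule.mem_sup_left
        (coe_mem_kerL2.2 (shift_localMap_semisimple hf hΦ hz (hXK hw)))
    · obtain ⟨k, hk, y, hy, hky⟩ := Submodule.mem_sup.1 hw
      obtain ⟨a, rfl⟩ := Submodule.mem_span_singleton.1 hy
      have h1 : shift (localMap hf hΦ) z (w + (a / z) • e) = k := by
        have h2 : shift (localMap hf hΦ) z e = -z • frontDeriv hf hΦ := by
          rw [shift_apply, he', he, zero_sub, neg_smul]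
        rw [map_add, map_smul, h2, ← hky, smul_smul, add_assoc, ← add_smul]
        have : a + a / z * -z = 0 := by field_simp; ring
        rw [this, zero_smul, add_zero]
      have h2 := shift_localMap_semisimple hf hΦ hz (w := w + (a / z) • e) (by rw [h1]; exact hk)
      have h3 : (w : L2) + (a / z) • frontDeriv hf hΦ ∈ K := by
        rw [← he]
        exact coe_mem_kerL2.2 h2
      have h4 := X.sub_mem (Submodule.mem_sup_left h3) (X.smul_mem (a / z) hψX)
      rwa [add_sub_cancel_right] at h4
  induction n with
  | zero => exact bot_le
  | succ n ih =>
    intro x hx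
    obtain ⟨w, hw, rfl⟩ := mem_kerPow_succ.1 hx
    refine key w ?_
    have h1 := ih hw
    rw [shift_nonlocalMap_apply] at h1
    -- The nonlocal term lies in `span Φ'`, hence in `X`, so membership of the image in `X` is the
    -- same for `L - z` and `L₀ - z`.
    have h2 := X.sub_mem h1 (X.smul_mem (functionalL hf hΦ w) hψX)
    rwa [add_sub_cancel_right] at h2

lemma kerPow_zero_le (hf : IsBistable f) (hΦ : IsWaveFront f c Φ) (n : ℕ) :
    kerPow (nonlocalOp hf hΦ) 0 n ≤ Submodule.span ℂ {frontDeriv hf hΦ} := by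
  have h := kerPow_nonlocalMap_le hf hΦ (z := 0) hf.max_neg n
  rwa [kerL2_shift_zero, sup_idem] at h

lemma exists_nonlocalMap_eq_zero (hf : IsBistable f) (hΦ : IsWaveFront f c Φ) :
    ∃ e : H2, (e : L2) = frontDeriv hf hΦ ∧ nonlocalMap hf hΦ e = 0 := by
  obtain ⟨e, he, he'⟩ := exists_front_H2 hf hΦ
  exact ⟨e, he, by rw [nonlocalMap_apply, he', he, functionalL_frontDeriv, zero_smul, add_zero]⟩

lemma kerPow_zero_succ (hf : IsBistable f) (hΦ : IsWaveFront f c Φ) (n : ℕ) :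
    kerPow (nonlocalOp hf hΦ) 0 (n + 1) = Submodule.span ℂ {frontDeriv hf hΦ} := by
  obtain ⟨e, he, he'⟩ := exists_nonlocalMap_eq_zero hf hΦ
  refine le_antisymm (kerPow_zero_le hf hΦ _) ?_
  rw [Submodule.span_singleton_le_iff_mem]
  refine (mem_kerPow_succ (S := nonlocalMap hf hΦ)).2 ⟨e, ?_, he⟩
  rw [shift_apply, he', zero_smul, sub_zero]
  exact Submodule.zero_mem _

lemma rootSpace_zero (hf : IsBistable f) (hΦ : IsWaveFront f c Φ) :
    rootSpace (nonlocalOp hf hΦ) 0 = Submodule.span ℂ {frontDeriv hf hΦ} :=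
  le_antisymm (iSup_le fun n => kerPow_zero_le hf hΦ n)
    ((kerPow_zero_succ hf hΦ 0).symm.le.trans (le_iSup (kerPow (nonlocalOp hf hΦ) 0) (0 + 1)))

lemma zero_mem_spectrum (hf : IsBistable f) (hΦ : IsWaveFront f c Φ) :
    (0 : ℂ) ∈ spectrum (nonlocalOp hf hΦ) := by
  obtain ⟨e, he, he'⟩ := exists_nonlocalMap_eq_zero hf hΦ
  exact mem_spectrum_of_eigenvector (S := nonlocalMap hf hΦ)
    (by rw [he]; exact frontDeriv_ne_zero hf hΦ) (by rw [shift_apply, he', zero_smul, sub_zero])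

lemma essentialSpectrum_nonlocalOp_subset (hf : IsBistable f) (hΦ : IsWaveFront f c Φ) :
    essentialSpectrum (nonlocalOp hf hΦ) ⊆ {z : ℂ | z.re ≤ max (der f 0) (der f 1)} := by
  rintro z ⟨hz, hiso⟩
  by_contra hre
  have hre' : max (der f 0) (der f 1) < z.re := not_le.1 hre
  have hP := hasParametrix_shift_nonlocalMap hf hΦ hre'
  refine hiso ⟨?_, ?_, ?_, ?_⟩
  · obtain ⟨w, hw0, hw⟩ := exists_eigenvector_of_mem_spectrum hP hz
    exact ⟨w, hw0, sub_eq_zero.1 hw⟩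
  · rw [spectrum_nonlocalOp] at hz ⊢
    exact exists_spectrum_inter_ball hf hΦ hre' hz
  · have h1 := (hasParametrix_shift_localMap hf hΦ hre').finiteDimensional_kerL2
    exact Submodule.finiteDimensional_of_le
      (iSup_le fun n => kerPow_nonlocalMap_le hf hΦ hre' n)
  · exact hP.isClosed_range

/-- Spectral points right of `m` are real eigenvalues. The ground-state argument excludes nonzero
ones with `Re z ≥ 0`, and isolation of `0` excludes small negative ones; halving `min r (-m)` keeps
the strip right of `m` and its negative real points in the isolating ball. -/
lemma exists_spectral_gap (hf : IsBistable f) (hΦ : IsWaveFront f c Φ) :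
    ∃ ν : ℝ, 0 < ν ∧ ν < -max (der f 0) (der f 1) ∧
      spectrum (nonlocalOp hf hΦ) ∩ {z : ℂ | -ν ≤ z.re} = {0} := by
  have h0 := zero_mem_spectrum hf hΦ
  rw [spectrum_nonlocalOp] at h0 ⊢
  obtain ⟨r, hr, hball⟩ := exists_spectrum_inter_ball hf hΦ (z₀ := 0) hf.max_neg h0
  have hm := hf.max_neg
  set m := max (der f 0) (der f 1)
  have hpos : 0 < min r (-m) := lt_min hr (by linarith)
  have hle1 := min_le_left r (-m)
  have hle2 := min_le_right r (-m)
  refine ⟨min r (-m) / 2, by linarith, by linarith, Subset.antisymm ?_ ?_⟩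
  · rintro z ⟨hz, hre⟩
    have hre' : -(min r (-m) / 2) ≤ z.re := hre
    have hzm : m < z.re := by linarith
    obtain ⟨w, hw0, hw⟩ := exists_eigenvector_of_mem_spectrum
      (hasParametrix_shift_localMap hf hΦ hzm) hz
    have him : z.im = 0 := by
      by_contra him
      exact hw0 (eq_zero_of_shift_localMap_of_im_ne_zero hf hΦ hzm him hw)
    by_contra hne
    rcases le_or_gt 0 z.re with h | h
    · exact hw0 ((shift_localMap_ground_state hf hΦ h him hw).2 hne)
    · have hzr : z = (z.re : ℂ) := Complex.ext rfl (by simpa using him)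
      have hn : ‖z‖ < r := by
        rw [hzr, Complex.norm_real, Real.norm_eq_abs, abs_of_neg h]
        linarith
      have : z ∈ ({0} : Set ℂ) := by
        rw [← hball]
        exact ⟨hz, by rwa [mem_ball_zero_iff]⟩
      exact hne this
  · rintro _ rfl
    exact ⟨h0, by simp only [mem_ofPred_eq, Complex.zero_re]; linarith⟩

/-- A solution would lie in `ker L² = span Φ'`, where `L` vanishes, contradicting `Φ' ≠ 0`. -/
lemma nonlocalMap_ne_frontDeriv (hf : IsBistable f) (hΦ : IsWaveFront f c Φ) (w : H2) :
    nonlocalMap hf hΦ w ≠ frontDeriv hf hΦ := by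
  intro h
  have hw : (w : L2) ∈ Submodule.span ℂ {frontDeriv hf hΦ} := by
    rw [← kerPow_zero_succ hf hΦ 1]
    refine (mem_kerPow_succ (S := nonlocalMap hf hΦ)).2 ⟨w, ?_, rfl⟩
    rw [shift_apply, zero_smul, sub_zero, h]
    have h1 := kerPow_zero_succ hf hΦ 0
    change _ ∈ kerPow (nonlocalOp hf hΦ) 0 (0 + 1)
    rw [h1]
    exact Submodule.mem_span_singleton_self _
  obtain ⟨e, he, he'⟩ := exists_nonlocalMap_eq_zero hf hΦ
  obtain ⟨a, ha⟩ := Submodule.mem_span_singleton.1 hw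
  have hwe : w = a • e := Subtype.ext (by rw [Submodule.coe_smul, he, ha])
  rw [hwe, map_smul, he', smul_zero] at h
  exact frontDeriv_ne_zero hf hΦ h.symm

end SpectralAnalysis

end

end TravellingWave

theorem proposition5p6 {f Φ : ℝ → ℝ} {c : ℝ} (hf : TravellingWave.IsBistable f)
    (hΦ : TravellingWave.IsWaveFront f c Φ) :
    -- the local and the nonlocal operator have the same spectrum
    TravellingWave.spectrum (TravellingWave.nonlocalOp hf hΦ) =
      TravellingWave.spectrum (TravellingWave.localOp hf hΦ) ∧
    -- zero is an algebraically simple eigenvalue of the nonlocal operator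
    (0 : ℂ) ∈ TravellingWave.spectrum (TravellingWave.nonlocalOp hf hΦ) ∧
    TravellingWave.IsAlgebraicallySimpleEigenvalue (TravellingWave.nonlocalOp hf hΦ) 0 ∧
    -- (i) location of the essential spectrum
    TravellingWave.essentialSpectrum (TravellingWave.nonlocalOp hf hΦ) ⊆
      {z : ℂ | z.re ≤ max (TravellingWave.der f 0) (TravellingWave.der f 1)} ∧
    -- (ii) spectral gap
    (∃ ν : ℝ, 0 < ν ∧ ν < -max (TravellingWave.der f 0) (TravellingWave.der f 1) ∧
      TravellingWave.spectrum (TravellingWave.nonlocalOp hf hΦ) ∩ {z : ℂ | -ν ≤ z.re} = {0}) ∧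
    -- (iii) `L w = Φ'` has no solution in `H²(ℝ)`, and `ker L² = ker L = span {Φ'}`
    (¬ ∃ w : (TravellingWave.nonlocalOp hf hΦ).domain,
      TravellingWave.nonlocalOp hf hΦ w = TravellingWave.frontDeriv hf hΦ) ∧
    TravellingWave.kerPow (TravellingWave.nonlocalOp hf hΦ) 0 2 =
      TravellingWave.kerPow (TravellingWave.nonlocalOp hf hΦ) 0 1 ∧
    TravellingWave.kerPow (TravellingWave.nonlocalOp hf hΦ) 0 1 =
      Submodule.span ℂ {TravellingWave.frontDeriv hf hΦ} := by
  refine ⟨TravellingWave.spectrum_nonlocalOp hf hΦ, TravellingWave.zero_mem_spectrum hf hΦ,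
    ⟨?_, ?_⟩, TravellingWave.essentialSpectrum_nonlocalOp_subset hf hΦ,
    TravellingWave.exists_spectral_gap hf hΦ, ?_, ?_, TravellingWave.kerPow_zero_succ hf hΦ 0⟩
  · obtain ⟨e, he, he'⟩ := TravellingWave.exists_nonlocalMap_eq_zero hf hΦ
    refine ⟨e, ?_, ?_⟩
    · rw [he]
      exact TravellingWave.frontDeriv_ne_zero hf hΦ
    · rw [zero_smul]
      exact he'
  · rw [TravellingWave.rootSpace_zero]
    exact finrank_span_singleton (TravellingWave.frontDeriv_ne_zero hf hΦ)
  · rintro ⟨w, hw⟩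
    exact TravellingWave.nonlocalMap_ne_frontDeriv hf hΦ w hw
  · exact (TravellingWave.kerPow_zero_succ hf hΦ 1).trans
      (TravellingWave.kerPow_zero_succ hf hΦ 0).symm
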